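/- Let $Q$ be a smooth $n$-dimensional manifold, $L:TQ\to\mathbb R$ a smooth Lagrangian, $\tau:TQ\to Q$ the projection, $S=dq^A\otimes\partial/\partial\dot q^A$ the vertical endomorphism of $TQ$, and $M\subseteq TQ$ an embedded submanifold of codimension $m$ satisfying the admissibility condition $\dim (T_vM)^\circ=\dim S^*\big((T_vM)^\circ\big)$ for all $v\in M$, where $(T_vM)^\circ\subseteq T_v^*TQ$ is the annihilator of $T_vM$. Let $pr_1,pr_2$ be the projections of the Whitney sum $T^*Q\oplus TQ$, let $W_0=T^*Q\times_QM=pr_2^{-1}(M)$ with inclusion $j:W_0\hookrightarrow T^*Q\oplus TQ$, and let $\omega_Q=dq^A\wedge dp_A$ be the canonical form of $T^*Q$, $\omega_L=-d(S^*dL)$ the Poincaré–Cartan form, $Leg_L:TQ\to T^*Q$ the fibre derivative and $E_L(v)=\langle Leg_L(v),v\rangle-L(v)$ the energy. Put $$\omega=j^*pr_1^*\omega_Q,\quad H_{W_0}=j^*(\langle pr_1,pr_2\rangle-pr_2^*L),\quad \bar\omega=j^*(pr_1^*\omega_Q+pr_2^*\omega_L),\quad \bar H=\langle pr_1,pr_2\rangle+pr_2^*E_L,$$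 and let $F:T^*Q\oplus TQ\to T^*Q\oplus TQ$, $F(\alpha,v)=(\alpha-Leg_L(v),v)$. For a presymplectic system $(W_0,\sigma,h)$ the Gotay–Nester algorithm produces $N_0=W_0$ and $N_{i+1}=\{x\in N_i: dh(x)(v)=0 \text{ for all } v\in T_xW_0 \text{ with } \sigma(x)(u,v)=0 \text{ for all } u\in T_xN_i\}$. Let $W_i$ be the sequence of $(W_0,\omega,H_{W_0})$ and $P_i$ the sequence of $(W_0,\bar\omega,j^*\bar H)$ (so $P_0=W_0$). Then: 1. For every $i$ such that $W_0,\dots,W_i$ are embedded submanifolds, $P_i$ is an embedded submanifold and $F$ restricts to a diffeomorphism $W_i\to P_i$. 2. (Linear constraints.) If $M$ is the total space of a distribution $D$ on $Q$, then $P_1=D^\circ\oplus D$, the mixed bundle of Vershik and Gershkovich. Moreover their equations are recovered: over the domain of a chart of $Q$ with a basis $\eta^1,\dots,\eta^m$ of smooth sections of $D^\circ$, a smooth curve $c(t)=(\lambda(t),v(t))$ in $T^*Q\oplus TQ$ over $q(t)$, defined on an open set of times, lies in $W_0$ and satisfies $i_{\dot c}\,\bar\omega=d(j^*\bar H)$ if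 and only if there are smooth functions $\lambda_\alpha(t)$ with $\lambda=-\lambda_\alpha\eta^\alpha$, $v=\dot q$, and $$\Big(\frac{d}{dt}\frac{\partial L}{\partial\dot q^A}-\frac{\partial L}{\partial q^A}\Big)dq^A=\dot\lambda_\alpha\eta^\alpha+\lambda_\alpha\, i_{\dot q}d\eta^\alpha,\qquad \langle\dot q,\eta^\alpha\rangle=0 .$$ 3. (Arbitrary constraints.) $P_1=S^*(TM^\circ)\times_QM$, that is, $P_1$ consists of the pairs $(\alpha,v)\in T^*Q\times_QM$ for which the semibasic covector $\tau^*\alpha=\alpha\circ T_v\tau$ belongs to $S^*\big((T_vM)^\circ\big)$; and for every $v\in M$ the map $\alpha\mapsto\tau^*\alpha$ is a bijection of the fibre $\{\alpha:(\alpha,v)\in P_1\}$ onto $S^*\big((T_vM)^\circ\big)$. -/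

import Mathlib

open Set Bundle
open scoped Manifold ContDiff Bundle

noncomputable section

namespace Vakonomic

section Submanifolds

variable {E H N : Type*} [NormedAddCommGroup E] [NormedSpace ℝ E] [TopologicalSpace H]
  (I : ModelWithCorners ℝ E H) [TopologicalSpace N] [ChartedSpace H N]

/-- Near `x`, the set `S` is the zero set of `c` smooth functions with independent
differentials at `x`. -/
def IsLocalLevelSet (S : Set N) (c : ℕ) (x : N) : Prop :=
  ∃ (U : Set N) (Φ : N → (Fin c → ℝ)), IsOpen U ∧ x ∈ U ∧
    ContMDiffOn I 𝓘(ℝ, Fin c → ℝ) ∞ Φ U ∧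
    Function.Surjective (mfderiv I 𝓘(ℝ, Fin c → ℝ) Φ x) ∧
    S ∩ U = {y ∈ U | Φ y = 0}

/-- `S` is an embedded submanifold of `N` of codimension `c`. -/
def IsSubmanifoldOfCodim (S : Set N) (c : ℕ) : Prop :=
  ∀ x ∈ S, IsLocalLevelSet I S c x

/-- `S` is an embedded submanifold of `N` (its dimension may vary from component to component). -/
def IsSubmanifold (S : Set N) : Prop :=
  ∀ x ∈ S, ∃ c : ℕ, IsLocalLevelSet I S c x

/-- `T_x S`: the velocities at `x` of the smooth curves of `N` that stay in `S`.  If `S` is an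
embedded submanifold, this is its tangent space at `x`. -/
def tangentTo (S : Set N) (x : N) : Set (TangentSpace I x) :=
  {v | ∃ γ : ℝ → N, ContMDiff 𝓘(ℝ, ℝ) I ∞ γ ∧ (∀ t, γ t ∈ S) ∧
    tangentMap 𝓘(ℝ, ℝ) I γ ⟨0, (1 : ℝ)⟩ = (⟨x, v⟩ : TangentBundle I N)}

/-- `(T_x S)°`: the covectors of `N` at `x` that vanish on `T_x S`. -/
def conormal (S : Set N) (x : N) : Submodule ℝ (TangentSpace I x →L[ℝ] ℝ) where
  carrier := {β | ∀ u ∈ tangentTo I S x, β u = 0}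
  zero_mem' := fun _ _ => rfl
  add_mem' := by
    intro a b ha hb u hu
    have h1 := ha u hu
    have h2 := hb u hu
    rw [add_apply, h1, h2, add_zero]
  smul_mem' := by
    intro c a ha u hu
    have h1 := ha u hu
    rw [smul_apply, h1, smul_zero]

/-- The differential of a real function. -/
def differential (f : N → ℝ) (x : N) : TangentSpace I x →L[ℝ] ℝ :=
  mfderiv I 𝓘(ℝ, ℝ) f x

/-- The exterior derivative `dθ(x)(u, v)` of a 1-form `θ` on a manifold without boundary, computed
in the chart of `N` centred at `x` (the one by which `TangentSpace I x` is the model space). -/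
def extDerivOneForm (θ : ∀ x : N, TangentSpace I x →L[ℝ] ℝ) (x : N)
    (u v : TangentSpace I x) : ℝ :=
  let θ' : E → (E →L[ℝ] ℝ) := fun y =>
    (θ ((extChartAt I x).symm y)).comp (mfderiv 𝓘(ℝ, E) I (extChartAt I x).symm y)
  fderiv ℝ θ' (extChartAt I x x) u v - fderiv ℝ θ' (extChartAt I x x) v u

/-- The constraint algorithm of Gotay and Nester on the submanifold `S` of `N`, for the presymplectic
form and the Hamiltonian that `Ω` and `h` induce on `S` (that is, `j^*Ω` and `j^*h`, where
`j : S → N` is the inclusion; pulling back by `j` is restricting to vectors tangent to `S`):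
`S₀ = S` and `S_{i+1}` is the set of the points `x` of `S_i` such that
`dh(x)(v) = 0` for all `v ∈ T_x S` with `Ω(x)(u, v) = 0` for all `u ∈ T_x S_i`. -/
def gotayNester (S : Set N) (Ω : ∀ x : N, TangentSpace I x → TangentSpace I x → ℝ) (h : N → ℝ) :
    ℕ → Set N
  | 0 => S
  | i + 1 => {x | x ∈ gotayNester S Ω h i ∧ ∀ v ∈ tangentTo I S x,
      (∀ u ∈ tangentTo I (gotayNester S Ω h i) x, Ω x u v = 0) → differential I h x v = 0}

/-- `X` solves `i_X (j^*Ω) = d(j^*h)` at the point `x` of `S`. -/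
def SolvesHamiltonEq (S : Set N) (Ω : ∀ x : N, TangentSpace I x → TangentSpace I x → ℝ)
    (h : N → ℝ) (x : N) (X : TangentSpace I x) : Prop :=
  x ∈ S ∧ X ∈ tangentTo I S x ∧ ∀ u ∈ tangentTo I S x, Ω x X u = differential I h x u

variable {E' H' N' : Type*} [NormedAddCommGroup E'] [NormedSpace ℝ E'] [TopologicalSpace H']
  (I' : ModelWithCorners ℝ E' H') [TopologicalSpace N'] [ChartedSpace H' N']

/-- `f` restricts to a diffeomorphism of the embedded submanifold `A` of `N` onto the embedded
submanifold `B` of `N'`. -/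
def RestrictsToDiffeo (f : N → N') (A : Set N) (B : Set N') : Prop :=
  MapsTo f A B ∧ ContMDiffOn I I' ∞ f A ∧
    ∃ g : N' → N, MapsTo g B A ∧ InvOn g f A B ∧ ContMDiffOn I' I ∞ g B

end Submanifolds

section Mechanics

variable (n : ℕ) (Q : Type*) [TopologicalSpace Q] [ChartedSpace (EuclideanSpace ℝ (Fin n)) Q]
  [IsManifold (𝓡 n) ∞ Q]

/-- The model vector space of an `n`-dimensional configuration manifold. -/
abbrev Coord : Type := EuclideanSpace ℝ (Fin n)

/-- `T_x^*Q` -/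
abbrev CotangentSpace (x : Q) : Type := TangentSpace (𝓡 n) x →L[ℝ] Trivial Q ℝ x

/-- `TQ` -/
abbrev TQ : Type _ := TangentBundle (𝓡 n) Q

/-- `T^*Q` -/
abbrev CotQ : Type _ := TotalSpace (Coord n →L[ℝ] ℝ) (CotangentSpace n Q)

/-- The Whitney sum `T^*Q ⊕ TQ`, a point of which is `⟨x, (α, v)⟩`. -/
abbrev Whitney : Type _ :=
  TotalSpace ((Coord n →L[ℝ] ℝ) × Coord n)
    (CotangentSpace n Q ×ᵇ (TangentSpace (𝓡 n) : Q → Type _))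

/-- The model of `TQ`. -/
abbrev modelTQ := (𝓡 n).prod 𝓘(ℝ, Coord n)

/-- The model of `T^*Q`. -/
abbrev modelCotQ := (𝓡 n).prod 𝓘(ℝ, Coord n →L[ℝ] ℝ)

/-- The model of `T^*Q ⊕ TQ`. -/
abbrev modelWhitney := (𝓡 n).prod 𝓘(ℝ, (Coord n →L[ℝ] ℝ) × Coord n)

variable {n Q}

/-- `pr₁ : T^*Q ⊕ TQ → T^*Q` -/
def pr₁ (p : Whitney n Q) : CotQ n Q := ⟨p.1, p.2.1⟩

/-- `pr₂ : T^*Q ⊕ TQ → TQ` -/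
def pr₂ (p : Whitney n Q) : TQ n Q := ⟨p.1, p.2.2⟩

/-- The tangent map at `v` of the projection `τ : TQ → Q`. -/
def dτ (v : TQ n Q) : TangentSpace (modelTQ n) v →L[ℝ] TangentSpace (𝓡 n) v.1 :=
  mfderiv (modelTQ n) (𝓡 n) (TotalSpace.proj : TQ n Q → Q) v

/-- The vertical lift `T_x Q → T_v (TQ)` at `v ∈ T_x Q`: the tangent map at `v` of the inclusion of
the fibre `T_x Q`. -/
def verticalLift (v : TQ n Q) : TangentSpace (𝓡 n) v.1 →L[ℝ] TangentSpace (modelTQ n) v :=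
  mfderiv 𝓘(ℝ, Coord n) (modelTQ n) (fun u : Coord n => (⟨v.1, u⟩ : TQ n Q)) v.2

/-- The canonical vertical endomorphism `S = dq^A ⊗ ∂/∂q̇^A` of `TQ`. -/
def verticalEndo (v : TQ n Q) : TangentSpace (modelTQ n) v →L[ℝ] TangentSpace (modelTQ n) v :=
  (verticalLift v).comp (dτ v)

/-- The action `β ↦ S^*β = β ∘ S` on covectors of `TQ` at `v`. -/
def verticalEndoDual (v : TQ n Q) :
    (TangentSpace (modelTQ n) v →L[ℝ] ℝ) →ₗ[ℝ] (TangentSpace (modelTQ n) v →L[ℝ] ℝ) where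
  toFun β := β.comp (verticalEndo v)
  map_add' _ _ := rfl
  map_smul' _ _ := rfl

/-- The Liouville 1-form `p_A dq^A` of `T^*Q`. -/
def liouvilleForm (p : CotQ n Q) : TangentSpace (modelCotQ n) p →L[ℝ] ℝ :=
  (p.2 : TangentSpace (𝓡 n) p.1 →L[ℝ] ℝ).comp
    (mfderiv (modelCotQ n) (𝓡 n) (TotalSpace.proj : CotQ n Q → Q) p)

/-- The canonical symplectic form `ω_Q = dq^A ∧ dp_A` of `T^*Q`. -/
def canonicalForm (p : CotQ n Q) (a b : TangentSpace (modelCotQ n) p) : ℝ :=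
  -extDerivOneForm (modelCotQ n) liouvilleForm p a b

/-- The Legendre transformation (the fibre derivative) of `L`. -/
def legendre (L : TQ n Q → ℝ) (v : TQ n Q) : TangentSpace (𝓡 n) v.1 →L[ℝ] ℝ :=
  fderiv ℝ (fun u : Coord n => L ⟨v.1, u⟩) v.2

/-- The energy `E_L = Δ L - L` of `L`, where `Δ` is the Liouville vector field. -/
def energy (L : TQ n Q → ℝ) (v : TQ n Q) : ℝ := legendre L v v.2 - L v

/-- The Poincaré-Cartan 2-form `ω_L = -d(S^* dL)`. -/
def poincareCartanForm (L : TQ n Q → ℝ) (v : TQ n Q) (a b : TangentSpace (modelTQ n) v) : ℝ :=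
  -extDerivOneForm (modelTQ n)
    (fun w => verticalEndoDual w (differential (modelTQ n) L w)) v a b

/-- The presymplectic form `Ω = pr₁^* ω_Q` on `T^*Q ⊕ TQ`. -/
def formΩ (p : Whitney n Q) (a b : TangentSpace (modelWhitney n) p) : ℝ :=
  canonicalForm (pr₁ p)
    (mfderiv (modelWhitney n) (modelCotQ n) pr₁ p a)
    (mfderiv (modelWhitney n) (modelCotQ n) pr₁ p b)

/-- The presymplectic form `Ω + pr₂^* ω_L` on `T^*Q ⊕ TQ`. -/
def formΩL (L : TQ n Q → ℝ) (p : Whitney n Q) (a b : TangentSpace (modelWhitney n) p) : ℝ :=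
  formΩ p a b + poincareCartanForm L (pr₂ p)
    (mfderiv (modelWhitney n) (modelTQ n) pr₂ p a)
    (mfderiv (modelWhitney n) (modelTQ n) pr₂ p b)

/-- `H = ⟨pr₁, pr₂⟩ - pr₂^* L`.  Its restriction to `T^*Q ×_Q M` is
`H_{W₀} = ⟨π₁, π₂⟩ - π₂^* (L|_M)`. -/
def hamiltonian (L : TQ n Q → ℝ) (p : Whitney n Q) : ℝ :=
  (pr₁ p).2 (pr₂ p).2 - L (pr₂ p)

/-- `H̄ = ⟨pr₁, pr₂⟩ + pr₂^* E_L`. -/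
def hamiltonianBar (L : TQ n Q → ℝ) (p : Whitney n Q) : ℝ :=
  (pr₁ p).2 (pr₂ p).2 + energy L (pr₂ p)

/-- The fibred diffeomorphism `F(α, v) = (α - Leg_L(v), v)` of `T^*Q ⊕ TQ`. -/
def fibredMap (L : TQ n Q → ℝ) (p : Whitney n Q) : Whitney n Q :=
  ⟨p.1, (p.2.1 - legendre L ⟨p.1, p.2.2⟩, p.2.2)⟩

/-- The admissibility condition on `M ⊆ TQ`: `dim (T_v M)° = dim S^* (T_v M)°` for all `v ∈ M`. -/
def Admissible (M : Set (TQ n Q)) : Prop :=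
  ∀ v ∈ M, Module.finrank ℝ (conormal (modelTQ n) M v) =
    Module.finrank ℝ ((conormal (modelTQ n) M v).map (verticalEndoDual v))

/-- `W₀ = T^*Q ×_Q M = pr₂⁻¹(M)` -/
def phaseSpace (M : Set (TQ n Q)) : Set (Whitney n Q) := pr₂ ⁻¹' M

/-- The sequence `W_i` of the vakonomic Hamiltonian system `(W₀, ω, H_{W₀})`. -/
def seqW (L : TQ n Q → ℝ) (M : Set (TQ n Q)) : ℕ → Set (Whitney n Q) :=
  gotayNester (modelWhitney n) (phaseSpace M) formΩ (hamiltonian L)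

/-- The sequence `P_i` of the system `(W₀, ω̄, j^*H̄)`, where `ω̄ = j^*(Ω + pr₂^* ω_L)`. -/
def seqP (L : TQ n Q → ℝ) (M : Set (TQ n Q)) : ℕ → Set (Whitney n Q) :=
  gotayNester (modelWhitney n) (phaseSpace M) (formΩL L) (hamiltonianBar L)

/-- The total space in `TQ` of a family of subspaces `D_x ⊆ T_x Q`. -/
def totalSet (D : ∀ x : Q, Submodule ℝ (TangentSpace (𝓡 n) x)) : Set (TQ n Q) :=
  {v | v.2 ∈ D v.1}

/-- The mixed bundle `D° ⊕ D ⊆ T^*Q ⊕ TQ`. -/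
def mixedBundle (D : ∀ x : Q, Submodule ℝ (TangentSpace (𝓡 n) x)) : Set (Whitney n Q) :=
  {p | (∀ u ∈ D p.1, (p.2.1 u : ℝ) = 0) ∧ p.2.2 ∈ D p.1}

/-- The pullback `α ↦ τ^*α = α ∘ T_vτ` of covectors of `Q` at `τ(v)` to covectors of `TQ` at `v`. -/
def pullτ (v : TQ n Q) (α : TangentSpace (𝓡 n) v.1 →L[ℝ] ℝ) : TangentSpace (modelTQ n) v →L[ℝ] ℝ :=
  α.comp (dτ v)

/-- The fibre `S^*((T_v M)°)` at `v ∈ M` of the subbundle `S^*(TM°)` of `T^*TQ` along `M`. -/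
def reactionForces (M : Set (TQ n Q)) (v : TQ n Q) : Submodule ℝ (TangentSpace (modelTQ n) v →L[ℝ] ℝ) :=
  (conormal (modelTQ n) M v).map (verticalEndoDual v)

/-- `S^*(TM°) ×_Q M ⊆ T^*Q ×_Q M`: the pairs `(α, v)`, `v ∈ M`, for which the semibasic covector
`τ^*α` of `TQ` at `v` lies in `S^*((T_v M)°)`. -/
def reactionBundle (M : Set (TQ n Q)) : Set (Whitney n Q) :=
  {p | pr₂ p ∈ M ∧ pullτ (pr₂ p) (pr₁ p).2 ∈ reactionForces M (pr₂ p)}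

/-- The tangent vector of `Q` at `φ⁻¹(x)` whose components in the chart `φ` are `y`. -/
def chartVector (φ : OpenPartialHomeomorph Q (Coord n)) (x y : Coord n) :
    TangentSpace (𝓡 n) (φ.symm x) :=
  mfderiv 𝓘(ℝ, Coord n) (𝓡 n) φ.symm x y

/-- The Lagrangian in the coordinates `(q^A, q̇^A)` of the chart `φ`. -/
def chartLagrangian (L : TQ n Q → ℝ) (φ : OpenPartialHomeomorph Q (Coord n)) (x y : Coord n) : ℝ :=
  L ⟨φ.symm x, chartVector φ x y⟩

/-- The 1-forms `η^α`, written in the chart `φ`, are a smooth basis of `D°` over its domain. -/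
def IsAnnihilatorBasis {m : ℕ} (D : ∀ x : Q, Submodule ℝ (TangentSpace (𝓡 n) x))
    (φ : OpenPartialHomeomorph Q (Coord n)) (η : Fin m → Coord n → (Coord n →L[ℝ] ℝ)) : Prop :=
  (∀ α, ContDiffOn ℝ ∞ (η α) φ.target) ∧
  ∀ x ∈ φ.target, LinearIndependent ℝ (fun α => η α x) ∧
    ∀ y : Coord n, chartVector φ x y ∈ D (φ.symm x) ↔ ∀ α, η α x y = 0

/-- The curve `c = (λ, v)` of `T^*Q ⊕ TQ` over the curve `q` of `Q` (`x` being `q` in the chart `φ`)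
satisfies, for `t ∈ J`, the Vershik-Gershkovich equations: `v = q̇`, `λ = -λ_α η^α` and
`(d/dt (∂L/∂q̇^A) - ∂L/∂q^A) dq^A = λ̇_α η^α + λ_α i_{q̇} dη^α`, `⟨q̇, η^α⟩ = 0`. -/
def SolvesVershikGershkovich {m : ℕ} (L : TQ n Q → ℝ) (φ : OpenPartialHomeomorph Q (Coord n))
    (η : Fin m → Coord n → (Coord n →L[ℝ] ℝ)) (J : Set ℝ) (c : ℝ → Whitney n Q) : Prop :=
  let x : ℝ → Coord n := fun t => φ (c t).1
  ∃ μ : Fin m → ℝ → ℝ, (∀ α, ContDiffOn ℝ ∞ (μ α) J) ∧ ∀ t ∈ J,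
    (pr₂ (c t) = ⟨φ.symm (x t), chartVector φ (x t) (deriv x t)⟩) ∧
    ((pr₁ (c t)).2 = -∑ α, μ α t • (η α (x t)).comp (mfderiv (𝓡 n) 𝓘(ℝ, Coord n) φ (c t).1)) ∧
    (∀ z : Coord n,
      deriv (fun s => fderiv ℝ (chartLagrangian L φ (x s)) (deriv x s) z) t
          - fderiv ℝ (fun x' => chartLagrangian L φ x' (deriv x t)) (x t) z =
        ∑ α, (deriv (μ α) t * η α (x t) z +
          μ α t * (fderiv ℝ (η α) (x t) (deriv x t) z - fderiv ℝ (η α) (x t) z (deriv x t)))) ∧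
    ∀ α, η α (x t) (deriv x t) = 0

end Mechanics

end Vakonomic

end

noncomputable section

namespace Vakonomic

open Filter Topology

/-! ### Smooth curves in the zero set of a submersion -/

section Curves

variable {E F : Type*} [NormedAddCommGroup E] [NormedSpace ℝ E]
  [NormedAddCommGroup F] [NormedSpace ℝ F] [CompleteSpace F]

/-! The comparison of the two sequences is naturality. With `p_L = ∂L/∂q̇`, the form `formΩL L` is
`dq ∧ d(p + p_L)` and `F` shifts `p` by `-p_L`; hence `F` pulls it back to `formΩ`, and pulls `H̄`
back to `H`, on the whole Whitney sum (`formΩL_fibredMap`, `hamiltonianBar_fibredMap`). The map `F`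
is a diffeomorphism, its inverse being the same map for `-L`, and it preserves `W₀` because it
leaves `v` alone. Tangent vectors are defined by curves, so a diffeomorphism carries them along for
arbitrary subsets, and induction on the stage gives `F(W_i) = P_i`
(`mem_gotayNester_iff_of_diffeo`).

The set `P₁` is found by linear algebra in bundle coordinates `(q, p, q̇)`. Let `M` be `g = 0` near
a point and `T = dg` there. A tangent vector of `W₀` is a triple `(a, b, c)` with `T(a, c) = 0` and
`b` free. Admissibility makes `S^*` injective on conormals, which forces `T(0, ·)` to be onto
(`tangentTo_submersive_of_admissible`), so tangent vectors of `M` have arbitrary base component. The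
kernel of the restricted form then consists of the vectors `(0, -dp_L(0, y), y)` with `T(0, y) = 0`,
and `dH̄` takes the value `p(y)` on them. So `P₁` is the condition that `p` vanishes on `ker T(0,
·)` (`mem_seqP_one_iff`). Such a `p` has the form `l ∘ T(0, ·)`, which is what `S^*` makes of the
conormal `l ∘ T` (`mem_reactionBundle_iff`). For a distribution, `ker T(0, ·)` is the fibre of `D`
itself (`vertical_tangent_totalSet_iff`), whence the mixed bundle.

For the Vershik-Gershkovich equations, Hamilton's equation is tested on triples `(a, b, c)`
(`coord_equations_iff`): `b` yields `v = q̇`, vertical `c` in `ker η` puts `λ` in the span of the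
`η^α`, and arbitrary `a`, completed to a tangent vector, yields the Euler-Lagrange equation with
multipliers. The multipliers are smooth by inverting a matrix (`exists_contDiffOn_coefficients`). -/

/-- The inverse function theorem applies to `Θ(t, y) = (t, g(z + t v + R y))`, whose derivative at
`0` is the identity because `v` lies in the kernel and `R` is a right inverse. The curve is the
image of `Θ⁻¹(t, 0)`. Working on `ℝ × F` spares any completeness assumption on `E`. -/
theorem exists_local_curve_of_rightInverse {g : E → F} {U : Set E} (hU : IsOpen U)
    (hg : ContDiffOn ℝ ∞ g U) {z : E} (hz : z ∈ U) (hgz : g z = 0) {R : F →L[ℝ] E}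
    (hR : (fderiv ℝ g z).comp R = ContinuousLinearMap.id ℝ F) {v : E} (hv : fderiv ℝ g z v = 0) :
    ∃ (δ : ℝ) (σ : ℝ → E), 0 < δ ∧ ContDiffOn ℝ ∞ σ (Ioo (-δ) δ) ∧ σ 0 = z ∧
      HasDerivAt σ v 0 ∧ ∀ t ∈ Ioo (-δ) δ, σ t ∈ U ∧ g (σ t) = 0 := by
  let A : ℝ × F →L[ℝ] E := (ContinuousLinearMap.fst ℝ ℝ F).smulRight v
    + R.comp (ContinuousLinearMap.snd ℝ ℝ F)
  let a : ℝ × F → E := fun p => z + A p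
  have ha : ContDiff ℝ ∞ a := contDiff_const.add A.contDiff
  have ha0 : a 0 = z := by simp [a]
  let V : Set (ℝ × F) := a ⁻¹' U
  have hV : IsOpen V := hU.preimage ha.continuous
  let Θ : ℝ × F → ℝ × F := fun p => (p.1, g (a p))
  have hΘ : ContDiffOn ℝ ∞ Θ V :=
    contDiff_fst.contDiffOn.prodMk (hg.comp ha.contDiffOn fun p hp => hp)
  have h0V : (0 : ℝ × F) ∈ V := by simpa [V, ha0] using hz
  have hΘ0 : Θ 0 = 0 := by simp [Θ, ha0, hgz]
  have hΘat : ∀ p ∈ V, ContDiffAt ℝ ∞ Θ p := fun p hp => hΘ.contDiffAt (hV.mem_nhds hp)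
  have hgd : HasFDerivAt g (fderiv ℝ g z) (a 0) := by
    rw [ha0]
    exact ((hg.contDiffAt (hU.mem_nhds hz)).differentiableAt (by simp)).hasFDerivAt
  have haA : HasFDerivAt a A 0 := (A.hasFDerivAt).const_add z
  have hid : (ContinuousLinearMap.fst ℝ ℝ F).prod ((fderiv ℝ g z).comp A) =
      ((ContinuousLinearEquiv.refl ℝ (ℝ × F) : (ℝ × F) ≃L[ℝ] (ℝ × F)) :
        (ℝ × F) →L[ℝ] (ℝ × F)) := by
    refine ContinuousLinearMap.ext fun p => ?_
    have : fderiv ℝ g z (R p.2) = p.2 := DFunLike.congr_fun hR p.2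
    simp [A, hv, this]
  have hΘd : HasFDerivAt Θ
      ((ContinuousLinearEquiv.refl ℝ (ℝ × F) : (ℝ × F) ≃L[ℝ] (ℝ × F)) :
        (ℝ × F) →L[ℝ] (ℝ × F)) 0 := by
    rw [← hid]
    exact hasFDerivAt_fst.prodMk (hgd.comp 0 haA)
  let e := (hΘat 0 h0V).toOpenPartialHomeomorph Θ hΘd (by simp)
  have he : ∀ p, e p = Θ p := fun p => rfl
  have h0s : (0 : ℝ × F) ∈ e.source :=
    (hΘat 0 h0V).mem_toOpenPartialHomeomorph_source hΘd (by simp)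
  have h0t : (0 : ℝ × F) ∈ e.target := by
    have := e.map_source h0s
    rwa [he, hΘ0] at this
  have hes0 : e.symm 0 = 0 := by
    have := e.left_inv h0s
    rwa [he, hΘ0] at this
  -- The local inverse is smooth wherever `Θ` has an invertible derivative; invertible operators
  -- form an open set, so this persists near `0`.
  have hcont : ContinuousAt (fderiv ℝ Θ) 0 :=
    ((hΘat 0 h0V).fderiv_right (m := 0) (by simp)).continuousAt
  have hinv : ∀ᶠ p in 𝓝 (0 : ℝ × F),
      fderiv ℝ Θ p ∈ range ((↑) : ((ℝ × F) ≃L[ℝ] (ℝ × F)) → ((ℝ × F) →L[ℝ] (ℝ × F))) := by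
    refine hcont.eventually_mem ?_
    rw [hΘd.fderiv]
    exact ContinuousLinearEquiv.nhds _
  have hgood : ∀ᶠ q in 𝓝 (0 : ℝ × F), q ∈ e.target ∧ e.symm q ∈ V ∧ ContDiffAt ℝ ∞ e.symm q := by
    have hc : Tendsto e.symm (𝓝 0) (𝓝 0) := by
      have := e.continuousAt_symm h0t
      rwa [ContinuousAt, hes0] at this
    filter_upwards [e.open_target.mem_nhds h0t, hc.eventually (hV.mem_nhds h0V),
      hc.eventually hinv] with q h1 h2 h3
    obtain ⟨f', hf'⟩ := h3
    refine ⟨h1, h2, e.contDiffAt_symm (f₀' := f') h1 ?_ (hΘat _ h2)⟩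
    rw [hf']
    exact ((hΘat _ h2).differentiableAt (by simp)).hasFDerivAt
  let w : ℝ → ℝ × F := fun t => (t, 0)
  have hw : ContDiff ℝ ∞ w := contDiff_id.prodMk contDiff_const
  have hw0 : w 0 = 0 := rfl
  have hgoodt : ∀ᶠ t in 𝓝 (0 : ℝ),
      w t ∈ e.target ∧ e.symm (w t) ∈ V ∧ ContDiffAt ℝ ∞ e.symm (w t) :=
    (hw.continuous.tendsto 0).eventually (by rw [hw0]; exact hgood)
  obtain ⟨δ, hδ, hball⟩ := Metric.eventually_nhds_iff_ball.1 hgoodt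
  have hmem : ∀ t ∈ Ioo (-δ) δ, t ∈ Metric.ball (0 : ℝ) δ := fun t ht => by
    rw [Real.ball_eq_Ioo]; simpa using ht
  refine ⟨δ, fun t => a (e.symm (w t)), hδ, ?_, ?_, ?_, ?_⟩
  · intro t ht
    exact (ha.contDiffAt.comp t
      ((hball t (hmem t ht)).2.2.comp t hw.contDiffAt)).contDiffWithinAt
  · simp [hw0, hes0, ha0]
  · have hs : HasFDerivAt e.symm
        ((ContinuousLinearEquiv.refl ℝ (ℝ × F)).symm : (ℝ × F) →L[ℝ] (ℝ × F)) (w 0) := by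
      refine e.hasFDerivAt_symm h0t ?_
      rw [hw0, hes0]
      exact hΘd
    have hwd : HasDerivAt w ((1 : ℝ), (0 : F)) 0 := (hasDerivAt_id 0).prodMk (hasDerivAt_const 0 0)
    have h1 := hs.comp_hasDerivAt (0 : ℝ) hwd
    have h2 : HasFDerivAt a A (e.symm (w 0)) := by rw [hw0, hes0]; exact haA
    have h3 := h2.comp_hasDerivAt (0 : ℝ) h1
    convert! h3 using 1
    simp [A]
  · intro t ht
    obtain ⟨h1, h2, -⟩ := hball t (hmem t ht)
    refine ⟨h2, ?_⟩
    have := e.right_inv h1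
    rw [he] at this
    exact congrArg Prod.snd this

/-- `tangentTo` asks for curves defined at all times, so the local curve is reparametrized by a
bounded function with derivative `1` at `0`. -/
theorem exists_curve_of_submersion {c : ℕ} {g : E → (Fin c → ℝ)} {U : Set E} (hU : IsOpen U)
    (hg : ContDiffOn ℝ ∞ g U) {z : E} (hz : z ∈ U) (hgz : g z = 0)
    (hs : Function.Surjective (fderiv ℝ g z)) {v : E} (hv : fderiv ℝ g z v = 0) :
    ∃ σ : ℝ → E, ContDiff ℝ ∞ σ ∧ σ 0 = z ∧
      HasDerivAt σ v 0 ∧ ∀ t, σ t ∈ U ∧ g (σ t) = 0 := by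
  obtain ⟨R, hR⟩ := (fderiv ℝ g z).toLinearMap.exists_rightInverse_of_surjective
    (LinearMap.range_eq_top.2 hs)
  obtain ⟨δ, σ, hδ, hσ, h0, hd, hmem⟩ := exists_local_curve_of_rightInverse hU hg hz hgz
    (R := LinearMap.toContinuousLinearMap R)
    (ContinuousLinearMap.ext fun y => DFunLike.congr_fun hR y) hv
  -- Amplitude `δ / 2` keeps the values strictly inside `(-δ, δ)`; the matching frequency makes the
  -- derivative at `0` equal to `1`.
  let s : ℝ → ℝ := fun t => δ / 2 * Real.sin (t / (δ / 2))
  have hsd : ContDiff ℝ ∞ s := contDiff_const.mul (Real.contDiff_sin.comp (contDiff_id.div_const _))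
  have hsm : ∀ t, s t ∈ Ioo (-δ) δ := fun t => by
    have h1 := Real.neg_one_le_sin (t / (δ / 2))
    have h2 := Real.sin_le_one (t / (δ / 2))
    constructor <;> simp only [s] <;> nlinarith
  have hs0 : s 0 = 0 := by simp [s]
  have hs' : HasDerivAt s 1 0 := by
    have h := (((hasDerivAt_id (0 : ℝ)).div_const (δ / 2)).sin).const_mul (δ / 2)
    have e1 : δ / 2 * (Real.cos (id 0 / (δ / 2)) * (1 / (δ / 2))) = 1 := by
      simp; field_simp
    rw [e1] at h
    exact h
  refine ⟨σ ∘ s, ?_, by simp [hs0, h0], ?_, fun t => hmem _ (hsm t)⟩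
  · exact contDiff_iff_contDiffAt.2 fun t =>
      (hσ.contDiffAt (isOpen_Ioo.mem_nhds (hsm t))).comp t hsd.contDiffAt
  · have h := HasDerivAt.scomp (0 : ℝ) (by rw [hs0]; exact hd) hs'
    simpa using h

end Curves

/-! ### Derivatives of maps between manifolds, read in the model spaces -/

section TangentMaps

variable {E H N : Type*} [NormedAddCommGroup E] [NormedSpace ℝ E] [TopologicalSpace H]
  {I : ModelWithCorners ℝ E H} [TopologicalSpace N] [ChartedSpace H N]
  {E' H' N' : Type*} [NormedAddCommGroup E'] [NormedSpace ℝ E']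
  [TopologicalSpace H'] {I' : ModelWithCorners ℝ E' H'} [TopologicalSpace N']
  [ChartedSpace H' N']
  {E'' H'' N'' : Type*} [NormedAddCommGroup E''] [NormedSpace ℝ E'']
  [TopologicalSpace H''] {I'' : ModelWithCorners ℝ E'' H''} [TopologicalSpace N'']
  [ChartedSpace H'' N'']

variable (I I') in
/-- `HasMFDerivAt`, with the derivative regarded as a map between the model vector spaces. -/
def HasModelDeriv (f : N → N') (x : N) (f' : E →L[ℝ] E') : Prop :=
  HasMFDerivAt I I' f x f'

variable (I I') in
/-- `mfderiv`, regarded as a map between the model vector spaces. -/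
def modelDeriv (f : N → N') (x : N) : E →L[ℝ] E' := mfderiv I I' f x

theorem HasModelDeriv.comp {g : N' → N''} {f : N → N'} {x : N} {y : N'} {g' : E' →L[ℝ] E''}
    {f' : E →L[ℝ] E'} (hg : HasModelDeriv I' I'' g y g') (hf : HasModelDeriv I I' f x f')
    (hy : f x = y) : HasModelDeriv I I'' (g ∘ f) x (g'.comp f') := by
  subst hy
  exact HasMFDerivAt.comp x hg hf

theorem HasModelDeriv.unique {f : N → N'} {x : N} {f' f₁ : E →L[ℝ] E'}
    (h : HasModelDeriv I I' f x f') (h₁ : HasModelDeriv I I' f x f₁) : f' = f₁ :=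
  hasMFDerivAt_unique h h₁

theorem HasModelDeriv.congr {f g : N → N'} {x : N} {f' : E →L[ℝ] E'}
    (h : HasModelDeriv I I' f x f') (hfg : g =ᶠ[𝓝 x] f) : HasModelDeriv I I' g x f' :=
  HasMFDerivAt.congr_of_eventuallyEq h hfg

theorem HasModelDeriv.modelDeriv_eq {f : N → N'} {x : N} {f' : E →L[ℝ] E'}
    (h : HasModelDeriv I I' f x f') : modelDeriv I I' f x = f' :=
  HasMFDerivAt.mfderiv h

theorem hasModelDeriv_const (y : N') (x : N) : HasModelDeriv I I' (fun _ => y) x 0 :=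
  hasMFDerivAt_const y x

theorem hasModelDeriv_id (x : N) : HasModelDeriv I I id x (ContinuousLinearMap.id ℝ E) :=
  hasMFDerivAt_id x

theorem hasModelDeriv_iff_hasFDerivAt {f : E → E'} {x : E} {f' : E →L[ℝ] E'} :
    HasModelDeriv 𝓘(ℝ, E) 𝓘(ℝ, E') f x f' ↔ HasFDerivAt f f' x :=
  hasMFDerivAt_iff_hasFDerivAt

theorem _root_.MDifferentiableAt.hasModelDeriv {f : N → N'} {x : N}
    (h : MDifferentiableAt I I' f x) : HasModelDeriv I I' f x (modelDeriv I I' f x) :=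
  h.hasMFDerivAt

theorem _root_.ContMDiffAt.hasModelDeriv {f : N → N'} {x : N}
    (h : ContMDiffAt I I' ∞ f x) : HasModelDeriv I I' f x (modelDeriv I I' f x) :=
  (h.mdifferentiableAt (by simp)).hasMFDerivAt

end TangentMaps

/-! ### Tangent spaces of level sets -/

section LevelSets

variable {E H N : Type*} [NormedAddCommGroup E] [NormedSpace ℝ E] [TopologicalSpace H]
  {I : ModelWithCorners ℝ E H} [TopologicalSpace N] [ChartedSpace H N]

theorem mem_tangentTo_iff {S : Set N} {x : N} {v : E} :
    v ∈ tangentTo I S x ↔ ∃ γ : ℝ → N, ContMDiff 𝓘(ℝ, ℝ) I ∞ γ ∧ (∀ t, γ t ∈ S) ∧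
      γ 0 = x ∧ HasModelDeriv 𝓘(ℝ, ℝ) I γ 0 (ContinuousLinearMap.toSpanSingleton ℝ v) := by
  constructor
  · rintro ⟨γ, hγ, hS, h⟩
    refine ⟨γ, hγ, hS, congrArg TotalSpace.proj h, ?_⟩
    have hx : γ 0 = x := congrArg TotalSpace.proj h
    subst hx
    have hv : modelDeriv 𝓘(ℝ, ℝ) I γ 0 (1 : ℝ) = v :=
      eq_of_heq (TotalSpace.mk.inj h).2
    have hd := (hγ 0).hasModelDeriv
    convert hd using 1
    refine ContinuousLinearMap.ext_ring ?_
    rw [hv]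
    exact ContinuousLinearMap.toSpanSingleton_apply_one ..
  · rintro ⟨γ, hγ, hS, rfl, h⟩
    refine ⟨γ, hγ, hS, ?_⟩
    have h1 : modelDeriv 𝓘(ℝ, ℝ) I γ 0 (1 : ℝ) = v := by
      rw [h.modelDeriv_eq]; exact ContinuousLinearMap.toSpanSingleton_apply_one ..
    exact congrArg (TotalSpace.mk (γ 0)) h1

theorem mapsTo_tangentTo {E' H' N' : Type*} [NormedAddCommGroup E'] [NormedSpace ℝ E']
    [TopologicalSpace H'] {I' : ModelWithCorners ℝ E' H'} [TopologicalSpace N']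
    [ChartedSpace H' N'] {f : N → N'} (hf : ContMDiff I I' ∞ f) {A : Set N} {B : Set N'}
    (h : MapsTo f A B) {x : N} {v : E} (hv : v ∈ tangentTo I A x) :
    modelDeriv I I' f x v ∈ tangentTo I' B (f x) := by
  rw [mem_tangentTo_iff] at hv ⊢
  obtain ⟨γ, hγ, hS, rfl, hd⟩ := hv
  refine ⟨f ∘ γ, hf.comp hγ, fun t => h (hS t), rfl, ?_⟩
  convert (hf (γ 0)).hasModelDeriv.comp hd rfl using 1
  refine ContinuousLinearMap.ext_ring ?_
  rw [ContinuousLinearMap.comp_apply, ContinuousLinearMap.toSpanSingleton_apply_one,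
    ContinuousLinearMap.toSpanSingleton_apply_one]

/-- `TangentSpace I x` is identified with the model space by this very chart. -/
theorem hasModelDeriv_extChartAt_self [IsManifold I ∞ N] (x : N) :
    HasModelDeriv I 𝓘(ℝ, E) (extChartAt I x) x (ContinuousLinearMap.id ℝ E) := by
  have : IsManifold I 1 N := IsManifold.of_le (n := ∞) (by simp)
  have h := (mdifferentiableAt_extChartAt (I := I) (mem_chart_source H x)).hasMFDerivAt
  rw [mfderiv_extChartAt_self] at h
  exact h

theorem contMDiffAt_extChartAt_symm [I.Boundaryless] [IsManifold I ∞ N] (x : N) {y : E}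
    (hy : y ∈ (extChartAt I x).target) : ContMDiffAt 𝓘(ℝ, E) I ∞ (extChartAt I x).symm y :=
  (contMDiffOn_extChartAt_symm x).contMDiffAt ((isOpen_extChartAt_target x).mem_nhds hy)

theorem hasModelDeriv_extChartAt_symm_self [I.Boundaryless] [IsManifold I ∞ N] (x : N) :
    HasModelDeriv 𝓘(ℝ, E) I (extChartAt I x).symm (extChartAt I x x)
      (ContinuousLinearMap.id ℝ E) := by
  have h := (contMDiffAt_extChartAt_symm (I := I) x (mem_extChartAt_target x)).hasModelDeriv
  have h1 := (hasModelDeriv_extChartAt_self (I := I) x).comp h (extChartAt_to_inv x)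
  have h2 := h1.unique ((hasModelDeriv_id (I := 𝓘(ℝ, E)) (extChartAt I x x)).congr
    (by filter_upwards [(isOpen_extChartAt_target x).mem_nhds (mem_extChartAt_target x)] with y hy
        exact (extChartAt I x).right_inv hy))
  rw [ContinuousLinearMap.id_comp] at h2
  rwa [h2] at h

/-- This converts the definition by curves into the linear equation used everywhere below. A curve
in `S` makes `Φ` vanish along it near time `0`; conversely a kernel vector is integrated in the
chart centred at `x` by `exists_curve_of_submersion`. -/
theorem mem_tangentTo_of_levelSet [I.Boundaryless] [IsManifold I ∞ N] {S U : Set N} {c : ℕ}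
    {Φ : N → (Fin c → ℝ)} {x : N} (hU : IsOpen U) (hxU : x ∈ U) (hxS : x ∈ S)
    (hΦ : ContMDiffOn I 𝓘(ℝ, Fin c → ℝ) ∞ Φ U)
    (hs : Function.Surjective (modelDeriv I 𝓘(ℝ, Fin c → ℝ) Φ x))
    (hSU : S ∩ U = {y ∈ U | Φ y = 0}) {v : E} :
    v ∈ tangentTo I S x ↔ modelDeriv I 𝓘(ℝ, Fin c → ℝ) Φ x v = 0 := by
  have hΦx := (hΦ.contMDiffAt (hU.mem_nhds hxU)).hasModelDeriv
  constructor
  · rw [mem_tangentTo_iff]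
    rintro ⟨γ, hγ, hS, rfl, hd⟩
    have h1 := hΦx.comp hd rfl
    have h2 : Φ ∘ γ =ᶠ[𝓝 0] fun _ => 0 := by
      filter_upwards [hγ.continuous.continuousAt.preimage_mem_nhds (hU.mem_nhds hxU)] with t ht
      exact (hSU.subset ⟨hS t, ht⟩).2
    have h4 := DFunLike.congr_fun (h1.unique ((hasModelDeriv_const 0 0).congr h2)) (1 : ℝ)
    rwa [ContinuousLinearMap.comp_apply, ContinuousLinearMap.toSpanSingleton_apply_one] at h4
  · intro hv
    let κ := extChartAt I x
    let V : Set E := κ.target ∩ κ.symm ⁻¹' U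
    have hV : IsOpen V := (continuousOn_extChartAt_symm x).isOpen_inter_preimage
      (isOpen_extChartAt_target x) hU
    have hκx : κ.symm (κ x) = x := extChartAt_to_inv x
    have hzV : κ x ∈ V := ⟨mem_extChartAt_target x, by simpa [hκx] using hxU⟩
    have hκ : ContMDiffOn 𝓘(ℝ, E) I ∞ κ.symm V := (contMDiffOn_extChartAt_symm x).mono
      inter_subset_left
    have hg : ContDiffOn ℝ ∞ (Φ ∘ κ.symm) V := by
      rw [← contMDiffOn_iff_contDiffOn]
      exact hΦ.comp hκ fun y hy => hy.2
    -- The centred chart has identity derivative, so the same `v` serves in the chart and on the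
    -- manifold.
    have hd : HasFDerivAt (Φ ∘ κ.symm) (modelDeriv I 𝓘(ℝ, Fin c → ℝ) Φ x) (κ x) :=
      hasModelDeriv_iff_hasFDerivAt.1 (hΦx.comp (hasModelDeriv_extChartAt_symm_self x) hκx)
    obtain ⟨σ, hσ, hσ0, hσd, hσm⟩ := exists_curve_of_submersion (v := (v : E)) hV hg hzV
      (by
        have := (hSU.subset ⟨hxS, hxU⟩).2
        simpa [hκx] using this)
      (by rw [hd.fderiv]; exact hs) (by rw [hd.fderiv]; exact hv)
    refine mem_tangentTo_iff.2 ⟨κ.symm ∘ σ, ?_, ?_, ?_, ?_⟩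
    · exact hκ.comp_contMDiff hσ.contMDiff fun t => (hσm t).1
    · intro t
      exact (hSU.superset ⟨(hσm t).1.2, (hσm t).2⟩).1
    · simp [hσ0, hκx]
    · exact (hasModelDeriv_extChartAt_symm_self x).comp
        (hasModelDeriv_iff_hasFDerivAt.2 hσd.hasFDerivAt) hσ0

end LevelSets

/-! ### Exterior derivatives in arbitrary coordinates -/

section ExteriorDerivative

variable {E H N : Type*} [NormedAddCommGroup E] [NormedSpace ℝ E] [TopologicalSpace H]
  {I : ModelWithCorners ℝ E H} [TopologicalSpace N] [ChartedSpace H N]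
  {G : Type*} [NormedAddCommGroup G] [NormedSpace ℝ G]

/-- This is `d(r^*ϑ) = r^*dϑ`: the term with the second derivative of `r` is symmetric and cancels
in the antisymmetrization. -/
theorem fderiv_pullback_antisymm {ϑ : G → (G →L[ℝ] ℝ)} {r : E → G} {y : E}
    (hϑ : DifferentiableAt ℝ ϑ (r y)) (hr : ContDiffAt ℝ ∞ r y) (a b : E) :
    fderiv ℝ (fun w => (ϑ (r w)).comp (fderiv ℝ r w)) y a b
        - fderiv ℝ (fun w => (ϑ (r w)).comp (fderiv ℝ r w)) y b a =
      fderiv ℝ ϑ (r y) (fderiv ℝ r y a) (fderiv ℝ r y b)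
        - fderiv ℝ ϑ (r y) (fderiv ℝ r y b) (fderiv ℝ r y a) := by
  have h1 : HasFDerivAt (fun w => ϑ (r w)) ((fderiv ℝ ϑ (r y)).comp (fderiv ℝ r y)) y :=
    hϑ.hasFDerivAt.comp y (hr.differentiableAt (by simp)).hasFDerivAt
  have h2 : HasFDerivAt (fderiv ℝ r) (fderiv ℝ (fderiv ℝ r) y) y :=
    ((hr.fderiv_right (m := 1) (by norm_cast)).differentiableAt (by simp)).hasFDerivAt
  have h3 := (h1.clm_comp h2).fderiv
  have h4 : IsSymmSndFDerivAt ℝ r y := hr.isSymmSndFDerivAt (by simp; norm_cast)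
  rw [h3]
  simp [h4.eq a b]

/-- `extDerivOneForm` is tied to the chart centred at each point; this frees it from that choice.
The transition `r = ρ ∘ κ⁻¹` pulls `ϑ` back to the form read in the centred chart `κ`, and
`fderiv_pullback_antisymm` does the rest. -/
theorem extDerivOneForm_of_parametrization [I.Boundaryless] [IsManifold I ∞ N]
    (θ : ∀ x : N, TangentSpace I x →L[ℝ] ℝ) {ψ : G → N} {ρ : N → G} {z : G}
    (hψ : ContMDiffAt 𝓘(ℝ, G) I ∞ ψ z) (hρ : ContMDiffAt I 𝓘(ℝ, G) ∞ ρ (ψ z))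
    (hψρ : ∀ᶠ y in 𝓝 (ψ z), ψ (ρ y) = y) (hρψ : ∀ᶠ w in 𝓝 z, ρ (ψ w) = w)
    {ϑ : G → (G →L[ℝ] ℝ)} (hϑ : ∀ᶠ w in 𝓝 z, ∀ a : G, ϑ w a = θ (ψ w) (modelDeriv 𝓘(ℝ, G) I ψ w a)) (hd : DifferentiableAt ℝ ϑ z) (u v : G) :
    extDerivOneForm I θ (ψ z) (modelDeriv 𝓘(ℝ, G) I ψ z u) (modelDeriv 𝓘(ℝ, G) I ψ z v) =
      fderiv ℝ ϑ z u v - fderiv ℝ ϑ z v u := by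
  set x := ψ z with hx
  let κ := extChartAt I x
  have hκx : κ.symm (κ x) = x := extChartAt_to_inv x
  have hκ : ContMDiffAt 𝓘(ℝ, E) I ∞ κ.symm (κ x) :=
    contMDiffAt_extChartAt_symm x (mem_extChartAt_target x)
  have hρx : ρ x = z := hρψ.self_of_nhds
  let r : E → G := ρ ∘ κ.symm
  have hrx : r (κ x) = z := by simp [r, hκx, hρx]
  have hr : ContDiffAt ℝ ∞ r (κ x) := by
    rw [← contMDiffAt_iff_contDiffAt]
    exact ContMDiffAt.comp (κ x) (by rw [hκx]; exact hρ) hκ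
  have hκt : Tendsto κ.symm (𝓝 (κ x)) (𝓝 x) := by
    have := hκ.continuousAt.tendsto; rwa [hκx] at this
  have hrt : Tendsto r (𝓝 (κ x)) (𝓝 z) := by
    have := hr.continuousAt.tendsto; rwa [hrx] at this
  have hr1 : ∀ᶠ y in 𝓝 (κ x), DifferentiableAt ℝ r y :=
    ((hr.of_le (m := 1) (by simp)).eventually (by simp)).mono fun y hy =>
      hy.differentiableAt (by simp)
  have hψ1 : ∀ᶠ w in 𝓝 z, MDifferentiableAt 𝓘(ℝ, G) I ψ w :=
    ((contMDiffAt_iff_contMDiffAt_nhds (by simp)).1 (ContMDiffAt.of_le (n := ∞) (m := 1) hψ (by simp))).mono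
      fun y hy => hy.mdifferentiableAt (by simp)
  have hsymm : κ.symm =ᶠ[𝓝 (κ x)] ψ ∘ r :=
    (hκt.eventually hψρ).mono fun y hy => hy.symm
  have hloc : (fun y => (θ (κ.symm y)).comp (mfderiv 𝓘(ℝ, E) I κ.symm y)) =ᶠ[𝓝 (κ x)]
      fun y => (ϑ (r y)).comp (fderiv ℝ r y) := by
    filter_upwards [hrt.eventually hϑ, hr1, hrt.eventually hψ1, hsymm.eventuallyEq_nhds]
      with y h1 h2 h3 h4
    have h5 := h3.hasModelDeriv.comp (hasModelDeriv_iff_hasFDerivAt.2 h2.hasFDerivAt) rfl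
    have h6 : modelDeriv 𝓘(ℝ, E) I κ.symm y = _ := (h5.congr h4).modelDeriv_eq
    have h7 : κ.symm y = ψ (r y) := h4.self_of_nhds
    refine ContinuousLinearMap.ext fun a => ?_
    rw [ContinuousLinearMap.comp_apply, h1]
    have h8 : modelDeriv 𝓘(ℝ, G) I ψ (r y) (fderiv ℝ r y a) = modelDeriv 𝓘(ℝ, E) I κ.symm y a := by
      rw [h6]; rfl
    rw [h8]
    exact congrArg (fun p => θ p (modelDeriv 𝓘(ℝ, E) I κ.symm y a)) h7
  have hψz := hψ.hasModelDeriv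
  have hrd := hasModelDeriv_iff_hasFDerivAt.2 (hr.differentiableAt (by simp)).hasFDerivAt
  -- Since `κ` has identity derivative at `x`, the derivative of `r` there undoes that of `ψ`.
  have hrψ : (fderiv ℝ r (κ x)).comp (modelDeriv 𝓘(ℝ, G) I ψ z) = ContinuousLinearMap.id ℝ G := by
    have h1 := hrd.comp ((hasModelDeriv_extChartAt_self (I := I) x).comp hψz hx.symm)
      (by simp [κ, hx])
    rw [ContinuousLinearMap.id_comp] at h1
    refine h1.unique ((hasModelDeriv_id (I := 𝓘(ℝ, G)) z).congr ?_)
    have h2 : ∀ᶠ w in 𝓝 z, ψ w ∈ κ.source :=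
      hψ.continuousAt.eventually_mem (extChartAt_source_mem_nhds x)
    filter_upwards [h2, hρψ] with w h3 h4
    change ρ (κ.symm (κ (ψ w))) = w
    rw [κ.left_inv h3, h4]
  have hru : ∀ u, fderiv ℝ r (κ x) (modelDeriv 𝓘(ℝ, G) I ψ z u) = u := fun u =>
    DFunLike.congr_fun hrψ u
  unfold extDerivOneForm
  have h8 := fderiv_pullback_antisymm (r := r) (y := κ x) (by rw [hrx]; exact hd) hr
    (modelDeriv 𝓘(ℝ, G) I ψ z u) (modelDeriv 𝓘(ℝ, G) I ψ z v)
  rw [hru, hru, hrx] at h8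
  rw [← h8]
  have h9 := hloc.fderiv_eq (𝕜 := ℝ)
  rw [← h9]

end ExteriorDerivative

/-! ### Charts of the base and the bundle trivializations -/

section Charts

variable {n : ℕ} {Q : Type*} [TopologicalSpace Q] [ChartedSpace (EuclideanSpace ℝ (Fin n)) Q]

/-- The tangent map of a chart. -/
def chartD (φ : OpenPartialHomeomorph Q (Coord n)) (q : Q) : Coord n →L[ℝ] Coord n :=
  modelDeriv (𝓡 n) 𝓘(ℝ, Coord n) φ q

/-- The tangent map of the inverse of a chart. -/
def chartDSymm (φ : OpenPartialHomeomorph Q (Coord n)) (x : Coord n) : Coord n →L[ℝ] Coord n :=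
  modelDeriv 𝓘(ℝ, Coord n) (𝓡 n) φ.symm x

variable {φ φ' : OpenPartialHomeomorph Q (Coord n)}

theorem contMDiffAt_chart (hφ : φ ∈ IsManifold.maximalAtlas (𝓡 n) ∞ Q) {q : Q}
    (hq : q ∈ φ.source) : ContMDiffAt (𝓡 n) 𝓘(ℝ, Coord n) ∞ φ q :=
  (contMDiffOn_of_mem_maximalAtlas hφ).contMDiffAt (φ.open_source.mem_nhds hq)

theorem contMDiffAt_chart_symm (hφ : φ ∈ IsManifold.maximalAtlas (𝓡 n) ∞ Q) {x : Coord n}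
    (hx : x ∈ φ.target) : ContMDiffAt 𝓘(ℝ, Coord n) (𝓡 n) ∞ φ.symm x :=
  (contMDiffOn_symm_of_mem_maximalAtlas hφ).contMDiffAt (φ.open_target.mem_nhds hx)

variable [IsManifold (𝓡 n) ∞ Q]

theorem hasModelDeriv_chart (hφ : φ ∈ IsManifold.maximalAtlas (𝓡 n) ∞ Q) {q : Q}
    (hq : q ∈ φ.source) : HasModelDeriv (𝓡 n) 𝓘(ℝ, Coord n) φ q (chartD φ q) :=
  (contMDiffAt_chart hφ hq).hasModelDeriv

theorem hasModelDeriv_chart_symm (hφ : φ ∈ IsManifold.maximalAtlas (𝓡 n) ∞ Q) {x : Coord n}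
    (hx : x ∈ φ.target) :
    HasModelDeriv 𝓘(ℝ, Coord n) (𝓡 n) φ.symm x (chartDSymm φ x) :=
  (contMDiffAt_chart_symm hφ hx).hasModelDeriv

theorem contDiffAt_transition (hφ : φ ∈ IsManifold.maximalAtlas (𝓡 n) ∞ Q)
    (hφ' : φ' ∈ IsManifold.maximalAtlas (𝓡 n) ∞ Q) {x : Coord n} (hx : x ∈ φ'.target)
    (hx' : φ'.symm x ∈ φ.source) : ContDiffAt ℝ ∞ (φ ∘ φ'.symm) x := by
  rw [← contMDiffAt_iff_contDiffAt]
  exact (contMDiffAt_chart hφ hx').comp x (contMDiffAt_chart_symm hφ' hx)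

theorem chartD_comp_chartDSymm (hφ : φ ∈ IsManifold.maximalAtlas (𝓡 n) ∞ Q)
    (hφ' : φ' ∈ IsManifold.maximalAtlas (𝓡 n) ∞ Q) {x : Coord n} (hx : x ∈ φ'.target)
    (hx' : φ'.symm x ∈ φ.source) :
    (chartD φ (φ'.symm x)).comp (chartDSymm φ' x) = fderiv ℝ (φ ∘ φ'.symm) x :=
  (hasModelDeriv_iff_hasFDerivAt.1 ((hasModelDeriv_chart hφ hx').comp
    (hasModelDeriv_chart_symm hφ' hx) rfl)).fderiv.symm

theorem chartD_chartDSymm (hφ : φ ∈ IsManifold.maximalAtlas (𝓡 n) ∞ Q) {x : Coord n}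
    (hx : x ∈ φ.target) (y : Coord n) : chartD φ (φ.symm x) (chartDSymm φ x y) = y := by
  have h1 := (hasModelDeriv_chart hφ (φ.map_target hx)).comp (hasModelDeriv_chart_symm hφ hx) rfl
  have h2 := h1.unique ((hasModelDeriv_id (I := 𝓘(ℝ, Coord n)) x).congr
    ((φ.open_target.mem_nhds hx |> eventually_mem_set.2).mono fun z hz => φ.right_inv hz))
  exact DFunLike.congr_fun h2 y

theorem chartDSymm_chartD (hφ : φ ∈ IsManifold.maximalAtlas (𝓡 n) ∞ Q) {q : Q}
    (hq : q ∈ φ.source) (y : Coord n) : chartDSymm φ (φ q) (chartD φ q y) = y := by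
  have h1 := (hasModelDeriv_chart_symm hφ (φ.map_source hq)).comp (hasModelDeriv_chart hφ hq) rfl
  have h2 := h1.unique ((hasModelDeriv_id (I := 𝓡 n) q).congr
    ((φ.open_source.mem_nhds hq |> eventually_mem_set.2).mono fun z hz => φ.left_inv hz))
  exact DFunLike.congr_fun h2 y

/-- With its cotangent analogue, this links the abstract trivializations, which define smoothness
into the bundles, to derivatives of charts of the base. -/
theorem trivializationAt_tangent_snd (q₀ q : Q) (w : Coord n)
    (hq : q ∈ (chartAt (Coord n) q₀).source) :
    (trivializationAt (Coord n) (TangentSpace (𝓡 n) : Q → Type _) q₀ (⟨q, w⟩ : TQ n Q)).2 =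
      chartD (chartAt (Coord n) q₀) q w := by
  have h := TangentBundle.continuousLinearMapAt_trivializationAt (I := 𝓡 n) hq
  have h1 := Trivialization.coe_linearMapAt_of_mem (R := ℝ)
    (trivializationAt (Coord n) (TangentSpace (𝓡 n) : Q → Type _) q₀) (b := q) hq
  exact (congrFun h1 w).symm.trans (DFunLike.congr_fun h w)

theorem trivializationAt_cotangent_snd (q₀ q : Q) (α : Coord n →L[ℝ] ℝ)
    (hq : q ∈ (chartAt (Coord n) q₀).source) :
    (trivializationAt (Coord n →L[ℝ] ℝ) (CotangentSpace n Q) q₀ (⟨q, α⟩ : CotQ n Q)).2 =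
      α.comp (chartDSymm (chartAt (Coord n) q₀) (chartAt (Coord n) q₀ q)) := by
  have h := TangentBundle.symmL_trivializationAt (I := 𝓡 n) hq
  have h1 : (trivializationAt (Coord n) (TangentSpace (𝓡 n)) q₀).symmL ℝ q =
      chartDSymm (chartAt (Coord n) q₀) (chartAt (Coord n) q₀ q) := by
    rw [h, ModelWithCorners.range_eq_univ, mfderivWithin_univ]
    rfl
  change ContinuousLinearMap.inCoordinates (Coord n) (TangentSpace (𝓡 n)) ℝ (Trivial Q ℝ)
    q₀ q q₀ q α = _
  unfold ContinuousLinearMap.inCoordinates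
  rw [h1]
  refine ContinuousLinearMap.ext fun w => ?_
  simp
  rfl

end Charts

/-! ### Coordinates induced on the tangent, cotangent and Whitney bundles -/

section BundleCharts

variable {n : ℕ} {Q : Type*} [TopologicalSpace Q] [ChartedSpace (EuclideanSpace ℝ (Fin n)) Q]

/-- The vector in the model space that represents a tangent vector. -/
def vecPart (v : TQ n Q) : Coord n := v.2

/-- The covector on the model space that represents a cotangent vector. -/
def covPart (p : CotQ n Q) : Coord n →L[ℝ] ℝ := p.2

/-- The coordinates `(q, q̇)` of `TQ` induced by a chart. -/
def tqCoord (φ : OpenPartialHomeomorph Q (Coord n)) (v : TQ n Q) : Coord n × Coord n :=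
  (φ v.1, chartD φ v.1 (vecPart v))

/-- The parametrization of `TQ` inverse to `tqCoord`. -/
def tqParam (φ : OpenPartialHomeomorph Q (Coord n)) (z : Coord n × Coord n) : TQ n Q :=
  ⟨φ.symm z.1, chartDSymm φ z.1 z.2⟩

/-- The coordinates `(q, p)` of `T^*Q` induced by a chart. -/
def cotCoord (φ : OpenPartialHomeomorph Q (Coord n)) (p : CotQ n Q) :
    Coord n × (Coord n →L[ℝ] ℝ) :=
  (φ p.1, (covPart p).comp (chartDSymm φ (φ p.1)))

/-- The parametrization of `T^*Q` inverse to `cotCoord`. -/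
def cotParam (φ : OpenPartialHomeomorph Q (Coord n)) (z : Coord n × (Coord n →L[ℝ] ℝ)) :
    CotQ n Q :=
  ⟨φ.symm z.1, z.2.comp (chartD φ (φ.symm z.1))⟩

variable [IsManifold (𝓡 n) ∞ Q]

/-- The coordinates `(q, p, q̇)` of the Whitney sum induced by a chart. -/
def whitneyCoord (φ : OpenPartialHomeomorph Q (Coord n)) (p : Whitney n Q) :
    Coord n × ((Coord n →L[ℝ] ℝ) × Coord n) :=
  (φ p.1, ((cotCoord φ (pr₁ p)).2, (tqCoord φ (pr₂ p)).2))

/-- The parametrization of the Whitney sum inverse to `whitneyCoord`. -/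
def whitneyParam (φ : OpenPartialHomeomorph Q (Coord n))
    (z : Coord n × ((Coord n →L[ℝ] ℝ) × Coord n)) : Whitney n Q :=
  ⟨φ.symm z.1, (z.2.1.comp (chartD φ (φ.symm z.1)), chartDSymm φ z.1 z.2.2)⟩

variable {φ : OpenPartialHomeomorph Q (Coord n)}

theorem tqCoord_tqParam (hφ : φ ∈ IsManifold.maximalAtlas (𝓡 n) ∞ Q) {z : Coord n × Coord n}
    (hz : z.1 ∈ φ.target) : tqCoord φ (tqParam φ z) = z :=
  Prod.ext (φ.right_inv hz) (chartD_chartDSymm hφ hz z.2)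

theorem tqParam_tqCoord (hφ : φ ∈ IsManifold.maximalAtlas (𝓡 n) ∞ Q) {v : TQ n Q}
    (hv : v.1 ∈ φ.source) : tqParam φ (tqCoord φ v) = v := by
  obtain ⟨q, w⟩ := v
  refine Eq.trans ?_ (congrArg (fun q' => (⟨q', (w : Coord n)⟩ : TQ n Q)) (φ.left_inv hv))
  exact congrArg (TotalSpace.mk _) (chartDSymm_chartD hφ hv w)

theorem cotCoord_cotParam (hφ : φ ∈ IsManifold.maximalAtlas (𝓡 n) ∞ Q)
    {z : Coord n × (Coord n →L[ℝ] ℝ)} (hz : z.1 ∈ φ.target) :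
    cotCoord φ (cotParam φ z) = z := by
  refine Prod.ext (φ.right_inv hz) (ContinuousLinearMap.ext fun y => ?_)
  change z.2 (chartD φ (φ.symm z.1) (chartDSymm φ (φ (φ.symm z.1)) y)) = z.2 y
  rw [φ.right_inv hz, chartD_chartDSymm hφ hz]

theorem cotParam_cotCoord (hφ : φ ∈ IsManifold.maximalAtlas (𝓡 n) ∞ Q) {p : CotQ n Q}
    (hp : p.1 ∈ φ.source) : cotParam φ (cotCoord φ p) = p := by
  obtain ⟨q, α⟩ := p
  refine Eq.trans ?_ (congrArg (fun q' => (⟨q', (α : Coord n →L[ℝ] ℝ)⟩ : CotQ n Q))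
    (φ.left_inv hp))
  have h : ((α : Coord n →L[ℝ] ℝ).comp (chartDSymm φ (φ q))).comp (chartD φ (φ.symm (φ q))) =
      (α : Coord n →L[ℝ] ℝ) := by
    refine ContinuousLinearMap.ext fun y : Coord n => ?_
    rw [φ.left_inv hp]
    exact congrArg (α : Coord n →L[ℝ] ℝ) (chartDSymm_chartD hφ hp y)
  exact congrArg (TotalSpace.mk _) h

theorem whitney_ext {p p' : Whitney n Q} (h₁ : pr₁ p = pr₁ p') (h₂ : pr₂ p = pr₂ p') :
    p = p' := by
  obtain ⟨q, α, w⟩ := p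
  obtain ⟨q', α', w'⟩ := p'
  obtain rfl : q = q' := congrArg TotalSpace.proj h₁
  obtain rfl : α = α' := eq_of_heq (TotalSpace.mk.inj h₁).2
  obtain rfl : w = w' := eq_of_heq (TotalSpace.mk.inj h₂).2
  rfl

theorem whitneyCoord_whitneyParam (hφ : φ ∈ IsManifold.maximalAtlas (𝓡 n) ∞ Q)
    {z : Coord n × ((Coord n →L[ℝ] ℝ) × Coord n)} (hz : z.1 ∈ φ.target) :
    whitneyCoord φ (whitneyParam φ z) = z := by
  refine Prod.ext (φ.right_inv hz) (Prod.ext ?_ ?_)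
  · have h := congrArg Prod.snd (cotCoord_cotParam hφ (z := (z.1, z.2.1)) hz)
    exact h
  · have h := congrArg Prod.snd (tqCoord_tqParam hφ (z := (z.1, z.2.2)) hz)
    exact h

theorem whitneyParam_whitneyCoord (hφ : φ ∈ IsManifold.maximalAtlas (𝓡 n) ∞ Q)
    {p : Whitney n Q} (hp : p.1 ∈ φ.source) : whitneyParam φ (whitneyCoord φ p) = p :=
  whitney_ext (cotParam_cotCoord hφ (p := pr₁ p) hp) (tqParam_tqCoord hφ (v := pr₂ p) hp)

variable {E H N : Type*} [NormedAddCommGroup E] [NormedSpace ℝ E] [TopologicalSpace H]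
  {I : ModelWithCorners ℝ E H} [TopologicalSpace N] [ChartedSpace H N]

/-- The trivialization of the Whitney sum is the product of the two trivializations, so smoothness
splits into components. -/
theorem contMDiffAt_whitney_iff {f : N → Whitney n Q} {x : N} :
    ContMDiffAt I (modelWhitney n) ∞ f x ↔
      ContMDiffAt I (modelCotQ n) ∞ (fun y => pr₁ (f y)) x ∧
        ContMDiffAt I (modelTQ n) ∞ (fun y => pr₂ (f y)) x := by
  have h : ContMDiffAt I 𝓘(ℝ, (Coord n →L[ℝ] ℝ) × Coord n) ∞
      (fun y => ((trivializationAt (Coord n →L[ℝ] ℝ) (CotangentSpace n Q) (f x).proj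
          (pr₁ (f y))).2,
        (trivializationAt (Coord n) (TangentSpace (𝓡 n) : Q → Type _) (f x).proj
          (pr₂ (f y))).2)) x ↔ _ := contMDiffAt_prod_module_iff _
  constructor
  · intro hf
    have h1 := contMDiffAt_totalSpace.1 hf
    have h2 := h.1 h1.2
    exact ⟨contMDiffAt_totalSpace.2 ⟨h1.1, h2.1⟩, contMDiffAt_totalSpace.2 ⟨h1.1, h2.2⟩⟩
  · rintro ⟨h1, h2⟩
    have h1 := contMDiffAt_totalSpace.1 h1
    have h2 := contMDiffAt_totalSpace.1 h2
    exact contMDiffAt_totalSpace.2 ⟨h1.1, h.2 ⟨h1.2, h2.2⟩⟩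

theorem contMDiff_pr₁ : ContMDiff (modelWhitney n) (modelCotQ n) ∞ (pr₁ : Whitney n Q → _) :=
  fun _ => (contMDiffAt_whitney_iff.1 contMDiffAt_id).1

theorem contMDiff_pr₂ : ContMDiff (modelWhitney n) (modelTQ n) ∞ (pr₂ : Whitney n Q → _) :=
  fun _ => (contMDiffAt_whitney_iff.1 contMDiffAt_id).2

/-- In the trivialization over the preferred chart `κ`, the fibre component is `D(κ ∘ φ⁻¹)(x) y`,
smooth in `(x, y)`. The three smoothness lemmas that follow rest on the same transition derivatives.
-/
theorem contMDiffAt_tqParam (hφ : φ ∈ IsManifold.maximalAtlas (𝓡 n) ∞ Q) {z : Coord n × Coord n}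
    (hz : z.1 ∈ φ.target) :
    ContMDiffAt 𝓘(ℝ, Coord n × Coord n) (modelTQ n) ∞ (tqParam φ : _ → TQ n Q) z := by
  have hbase : ContMDiffAt 𝓘(ℝ, Coord n × Coord n) (𝓡 n) ∞ (fun z => φ.symm z.1) z :=
    (contMDiffAt_chart_symm hφ hz).comp z contDiff_fst.contMDiff.contMDiffAt
  let κ := chartAt (Coord n) (φ.symm z.1)
  have hκ : κ ∈ IsManifold.maximalAtlas (𝓡 n) ∞ Q := IsManifold.chart_mem_maximalAtlas _
  have hzκ : φ.symm z.1 ∈ κ.source := mem_chart_source _ _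
  refine contMDiffAt_totalSpace.2 ⟨hbase, ?_⟩
  have h1 : ContDiffAt ℝ ∞ (fun z' : Coord n × Coord n => fderiv ℝ (κ ∘ φ.symm) z'.1 z'.2) z :=
    (((contDiffAt_transition hκ hφ hz hzκ).fderiv_right (m := ∞) (by simp)).comp z
      contDiffAt_fst).clm_apply contDiffAt_snd
  refine h1.contMDiffAt.congr_of_eventuallyEq ?_
  filter_upwards [continuousAt_fst.eventually_mem (φ.open_target.mem_nhds hz),
    hbase.continuousAt.eventually_mem (κ.open_source.mem_nhds hzκ)] with z' h2 h3
  refine (trivializationAt_tangent_snd _ _ _ h3).trans ?_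
  exact DFunLike.congr_fun (chartD_comp_chartDSymm hκ hφ h2 h3) z'.2

theorem contMDiffAt_cotParam (hφ : φ ∈ IsManifold.maximalAtlas (𝓡 n) ∞ Q)
    {z : Coord n × (Coord n →L[ℝ] ℝ)} (hz : z.1 ∈ φ.target) :
    ContMDiffAt 𝓘(ℝ, Coord n × (Coord n →L[ℝ] ℝ)) (modelCotQ n) ∞
      (cotParam φ : _ → CotQ n Q) z := by
  have hbase : ContMDiffAt 𝓘(ℝ, Coord n × (Coord n →L[ℝ] ℝ)) (𝓡 n) ∞ (fun z => φ.symm z.1) z :=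
    (contMDiffAt_chart_symm hφ hz).comp z contDiff_fst.contMDiff.contMDiffAt
  let κ := chartAt (Coord n) (φ.symm z.1)
  have hκ : κ ∈ IsManifold.maximalAtlas (𝓡 n) ∞ Q := IsManifold.chart_mem_maximalAtlas _
  have hzκ : φ.symm z.1 ∈ κ.source := mem_chart_source _ _
  refine contMDiffAt_totalSpace.2 ⟨hbase, ?_⟩
  have hκz : κ.symm (κ (φ.symm z.1)) ∈ φ.source := by
    rw [κ.left_inv hzκ]; exact φ.map_target hz
  have h0 := contDiffAt_transition hκ hφ hz hzκ
  have h1 : ContDiffAt ℝ ∞ (fun z' : Coord n × (Coord n →L[ℝ] ℝ) =>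
      z'.2.comp (fderiv ℝ (φ ∘ κ.symm) ((κ ∘ φ.symm) z'.1))) z := by
    refine contDiffAt_snd.clm_comp ?_
    refine ((contDiffAt_transition hφ hκ (κ.map_source hzκ) hκz).fderiv_right
      (m := ∞) (by simp)).comp (f := fun z' : Coord n × (Coord n →L[ℝ] ℝ) => (κ ∘ φ.symm) z'.1) z ?_
    exact h0.comp z contDiffAt_fst
  refine h1.contMDiffAt.congr_of_eventuallyEq ?_
  filter_upwards [continuousAt_fst.eventually_mem (φ.open_target.mem_nhds hz),
    hbase.continuousAt.eventually_mem (κ.open_source.mem_nhds hzκ)] with z' h2 h3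
  refine (trivializationAt_cotangent_snd _ _ _ h3).trans ?_
  have h4 : κ.symm (κ (φ.symm z'.1)) ∈ φ.source := by
    rw [κ.left_inv h3]; exact φ.map_target h2
  have h5 := chartD_comp_chartDSymm hφ hκ (κ.map_source h3) h4
  rw [κ.left_inv h3] at h5
  rw [Function.comp_apply, ← h5]
  rfl

theorem contMDiffAt_tqCoord (hφ : φ ∈ IsManifold.maximalAtlas (𝓡 n) ∞ Q) {v : TQ n Q}
    (hv : v.1 ∈ φ.source) :
    ContMDiffAt (modelTQ n) 𝓘(ℝ, Coord n × Coord n) ∞ (tqCoord φ) v := by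
  let κ := chartAt (Coord n) v.1
  have hκ : κ ∈ IsManifold.maximalAtlas (𝓡 n) ∞ Q := IsManifold.chart_mem_maximalAtlas _
  have hvκ : v.1 ∈ κ.source := mem_chart_source _ _
  have ht := (contMDiffAt_totalSpace.1 (contMDiffAt_id (I := modelTQ n) (n := ∞) (x := v))).2
  have hp : ContMDiffAt (modelTQ n) (𝓡 n) ∞ (fun v' : TQ n Q => v'.1) v :=
    contMDiff_proj _ _
  have hκv : κ.symm (κ v.1) ∈ φ.source := by rw [κ.left_inv hvκ]; exact hv
  have h1 : ContMDiffAt (modelTQ n) 𝓘(ℝ, Coord n →L[ℝ] Coord n) ∞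
      (fun v' : TQ n Q => fderiv ℝ (φ ∘ κ.symm) (κ v'.1)) v :=
    ((contDiffAt_transition hφ hκ (κ.map_source hvκ) hκv).fderiv_right
      (m := ∞) (by simp)).contMDiffAt.comp v ((contMDiffAt_chart hκ hvκ).comp v hp)
  refine (contMDiffAt_prod_module_iff _).2 ⟨(contMDiffAt_chart hφ hv).comp v hp, ?_⟩
  refine (h1.clm_apply ht).congr_of_eventuallyEq ?_
  filter_upwards [hp.continuousAt.eventually_mem (φ.open_source.mem_nhds hv),
    hp.continuousAt.eventually_mem (κ.open_source.mem_nhds hvκ)] with v' h2 h3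
  have h4 : κ.symm (κ v'.1) ∈ φ.source := by rw [κ.left_inv h3]; exact h2
  have h5 := chartD_comp_chartDSymm hφ hκ (κ.map_source h3) h4
  have h6 := trivializationAt_tangent_snd v.1 v'.1 (vecPart v') h3
  have h7 : (trivializationAt (Coord n) (TangentSpace (𝓡 n) : Q → Type _) (id v).proj (id v')).2
    = chartD κ v'.1 (vecPart v') := h6
  rw [h7, ← h5, ContinuousLinearMap.comp_apply, chartDSymm_chartD hκ h3, κ.left_inv h3]
  rfl

theorem contMDiffAt_cotCoord (hφ : φ ∈ IsManifold.maximalAtlas (𝓡 n) ∞ Q) {p : CotQ n Q}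
    (hv : p.1 ∈ φ.source) :
    ContMDiffAt (modelCotQ n) 𝓘(ℝ, Coord n × (Coord n →L[ℝ] ℝ)) ∞ (cotCoord φ) p := by
  let κ := chartAt (Coord n) p.1
  have hκ : κ ∈ IsManifold.maximalAtlas (𝓡 n) ∞ Q := IsManifold.chart_mem_maximalAtlas _
  have hvκ : p.1 ∈ κ.source := mem_chart_source _ _
  have ht := (contMDiffAt_totalSpace.1 (contMDiffAt_id (I := modelCotQ n) (n := ∞) (x := p))).2
  have hp : ContMDiffAt (modelCotQ n) (𝓡 n) ∞ (fun p' : CotQ n Q => p'.1) p :=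
    contMDiff_proj _ _
  have hφp : φ.symm (φ p.1) ∈ κ.source := by rw [φ.left_inv hv]; exact hvκ
  have h1 : ContMDiffAt (modelCotQ n) 𝓘(ℝ, Coord n →L[ℝ] Coord n) ∞
      (fun v' : CotQ n Q => fderiv ℝ (κ ∘ φ.symm) (φ v'.1)) p :=
    ((contDiffAt_transition hκ hφ (φ.map_source hv) hφp).fderiv_right
      (m := ∞) (by simp)).contMDiffAt.comp p ((contMDiffAt_chart hφ hv).comp p hp)
  refine (contMDiffAt_prod_module_iff _).2 ⟨(contMDiffAt_chart hφ hv).comp p hp, ?_⟩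
  refine (ContMDiffAt.clm_comp ht h1).congr_of_eventuallyEq ?_
  filter_upwards [hp.continuousAt.eventually_mem (φ.open_source.mem_nhds hv),
    hp.continuousAt.eventually_mem (κ.open_source.mem_nhds hvκ)] with p' h2 h3
  have h4 : φ.symm (φ p'.1) ∈ κ.source := by rw [φ.left_inv h2]; exact h3
  have h5 := chartD_comp_chartDSymm hκ hφ (φ.map_source h2) h4
  have h7 : (trivializationAt (Coord n →L[ℝ] ℝ) (CotangentSpace n Q) (id p).proj (id p')).2
    = (covPart p').comp (chartDSymm κ (κ p'.1)) :=
      trivializationAt_cotangent_snd p.1 p'.1 (covPart p') h3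
  rw [h7, ← h5]
  refine ContinuousLinearMap.ext fun y => ?_
  change covPart p' (chartDSymm φ (φ p'.1) y) = covPart p' (chartDSymm κ (κ p'.1)
    (chartD κ (φ.symm (φ p'.1)) (chartDSymm φ (φ p'.1) y)))
  rw [φ.left_inv h2, chartDSymm_chartD hκ h3]

theorem contMDiffAt_whitneyParam (hφ : φ ∈ IsManifold.maximalAtlas (𝓡 n) ∞ Q)
    {z : Coord n × ((Coord n →L[ℝ] ℝ) × Coord n)} (hz : z.1 ∈ φ.target) :
    ContMDiffAt 𝓘(ℝ, Coord n × ((Coord n →L[ℝ] ℝ) × Coord n)) (modelWhitney n) ∞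
      (whitneyParam φ : _ → Whitney n Q) z := by
  refine contMDiffAt_whitney_iff.2 ⟨?_, ?_⟩
  · exact (contMDiffAt_cotParam hφ (z := (z.1, z.2.1)) hz).comp z
      (contDiff_fst.prodMk (contDiff_fst.comp contDiff_snd)).contMDiff.contMDiffAt
  · exact (contMDiffAt_tqParam hφ (z := (z.1, z.2.2)) hz).comp z
      (contDiff_fst.prodMk (contDiff_snd.comp contDiff_snd)).contMDiff.contMDiffAt

theorem contMDiffAt_whitneyCoord (hφ : φ ∈ IsManifold.maximalAtlas (𝓡 n) ∞ Q) {p : Whitney n Q}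
    (hp : p.1 ∈ φ.source) :
    ContMDiffAt (modelWhitney n) 𝓘(ℝ, Coord n × ((Coord n →L[ℝ] ℝ) × Coord n)) ∞
      (whitneyCoord φ) p := by
  have h1 := (contMDiffAt_cotCoord hφ (p := pr₁ p) hp).comp p contMDiff_pr₁.contMDiffAt
  have h2 := (contMDiffAt_tqCoord hφ (v := pr₂ p) hp).comp p contMDiff_pr₂.contMDiffAt
  rw [contMDiffAt_prod_module_iff] at h1 h2
  exact (contMDiffAt_prod_module_iff _).2 ⟨h1.1, (contMDiffAt_prod_module_iff _).2 ⟨h1.2, h2.2⟩⟩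

end BundleCharts

/-! ### Coordinate expressions of the forms, the energy and the Hamiltonian -/

section Coordinates

variable {n : ℕ} {Q : Type*} [TopologicalSpace Q] [ChartedSpace (EuclideanSpace ℝ (Fin n)) Q]
  [IsManifold (𝓡 n) ∞ Q]

/-- The tangent map of `tqParam`. -/
def tqParamD (φ : OpenPartialHomeomorph Q (Coord n)) (z : Coord n × Coord n) :
    Coord n × Coord n →L[ℝ] Coord n × Coord n :=
  modelDeriv 𝓘(ℝ, Coord n × Coord n) (modelTQ n) (tqParam φ) z

/-- The tangent map of `cotParam`. -/
def cotParamD (φ : OpenPartialHomeomorph Q (Coord n)) (z : Coord n × (Coord n →L[ℝ] ℝ)) :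
    Coord n × (Coord n →L[ℝ] ℝ) →L[ℝ] Coord n × (Coord n →L[ℝ] ℝ) :=
  modelDeriv 𝓘(ℝ, Coord n × (Coord n →L[ℝ] ℝ)) (modelCotQ n) (cotParam φ) z

/-- The tangent map of `whitneyParam`. -/
def whitneyParamD (φ : OpenPartialHomeomorph Q (Coord n))
    (z : Coord n × ((Coord n →L[ℝ] ℝ) × Coord n)) :
    Coord n × ((Coord n →L[ℝ] ℝ) × Coord n) →L[ℝ] Coord n × ((Coord n →L[ℝ] ℝ) × Coord n) :=
  modelDeriv 𝓘(ℝ, Coord n × ((Coord n →L[ℝ] ℝ) × Coord n)) (modelWhitney n) (whitneyParam φ) z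

/-- The Lagrangian in the coordinates of a chart. -/
def coordLagrangian (L : TQ n Q → ℝ) (φ : OpenPartialHomeomorph Q (Coord n))
    (z : Coord n × Coord n) : ℝ := L (tqParam φ z)

/-- The momenta `∂L/∂q̇` in the coordinates of a chart. -/
def coordMomentum (L : TQ n Q → ℝ) (φ : OpenPartialHomeomorph Q (Coord n))
    (z : Coord n × Coord n) : Coord n →L[ℝ] ℝ :=
  (fderiv ℝ (coordLagrangian L φ) z).comp (ContinuousLinearMap.inr ℝ (Coord n) (Coord n))

variable {φ : OpenPartialHomeomorph Q (Coord n)} {L : TQ n Q → ℝ}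

theorem hasModelDeriv_tqParam (hφ : φ ∈ IsManifold.maximalAtlas (𝓡 n) ∞ Q)
    {z : Coord n × Coord n} (hz : z.1 ∈ φ.target) :
    HasModelDeriv 𝓘(ℝ, Coord n × Coord n) (modelTQ n) (tqParam φ) z (tqParamD φ z) :=
  (contMDiffAt_tqParam hφ hz).hasModelDeriv

theorem hasModelDeriv_cotParam (hφ : φ ∈ IsManifold.maximalAtlas (𝓡 n) ∞ Q)
    {z : Coord n × (Coord n →L[ℝ] ℝ)} (hz : z.1 ∈ φ.target) :
    HasModelDeriv 𝓘(ℝ, Coord n × (Coord n →L[ℝ] ℝ)) (modelCotQ n) (cotParam φ) z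
      (cotParamD φ z) :=
  (contMDiffAt_cotParam hφ hz).hasModelDeriv

theorem hasModelDeriv_whitneyParam (hφ : φ ∈ IsManifold.maximalAtlas (𝓡 n) ∞ Q)
    {z : Coord n × ((Coord n →L[ℝ] ℝ) × Coord n)} (hz : z.1 ∈ φ.target) :
    HasModelDeriv 𝓘(ℝ, Coord n × ((Coord n →L[ℝ] ℝ) × Coord n)) (modelWhitney n)
      (whitneyParam φ) z (whitneyParamD φ z) :=
  (contMDiffAt_whitneyParam hφ hz).hasModelDeriv

/-- Injective because `tqCoord` is a local left inverse, then onto by equality of dimensions.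
Through this, every tangent vector below is written in coordinates. -/
theorem tqParamD_bijective (hφ : φ ∈ IsManifold.maximalAtlas (𝓡 n) ∞ Q)
    {z : Coord n × Coord n} (hz : z.1 ∈ φ.target) : Function.Bijective (tqParamD φ z) := by
  have hs : (tqParam φ z).1 ∈ φ.source := φ.map_target hz
  have h1 := (contMDiffAt_tqCoord hφ hs).hasModelDeriv.comp (hasModelDeriv_tqParam hφ hz) rfl
  have h2 := h1.unique ((hasModelDeriv_id z).congr
    ((continuousAt_fst.eventually_mem (φ.open_target.mem_nhds hz)).mono
      fun w hw => tqCoord_tqParam hφ hw))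
  have hi : Function.Injective (tqParamD φ z) :=
    Function.LeftInverse.injective (g := modelDeriv (modelTQ n) 𝓘(ℝ, Coord n × Coord n) (tqCoord φ)
      (tqParam φ z)) fun a => DFunLike.congr_fun h2 a
  exact ⟨hi, LinearMap.injective_iff_surjective (f := (tqParamD φ z).toLinearMap) |>.1 hi⟩

theorem whitneyParamD_bijective (hφ : φ ∈ IsManifold.maximalAtlas (𝓡 n) ∞ Q)
    {z : Coord n × ((Coord n →L[ℝ] ℝ) × Coord n)} (hz : z.1 ∈ φ.target) :
    Function.Bijective (whitneyParamD φ z) := by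
  have hs : (whitneyParam φ z).1 ∈ φ.source := φ.map_target hz
  have h1 := (contMDiffAt_whitneyCoord hφ hs).hasModelDeriv.comp
    (hasModelDeriv_whitneyParam hφ hz) rfl
  have h2 := h1.unique ((hasModelDeriv_id z).congr
    ((continuousAt_fst.eventually_mem (φ.open_target.mem_nhds hz)).mono
      fun w hw => whitneyCoord_whitneyParam hφ hw))
  have hi : Function.Injective (whitneyParamD φ z) :=
    Function.LeftInverse.injective (g := modelDeriv (modelWhitney n)
      𝓘(ℝ, Coord n × ((Coord n →L[ℝ] ℝ) × Coord n)) (whitneyCoord φ)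
      (whitneyParam φ z)) fun a => DFunLike.congr_fun h2 a
  exact ⟨hi, LinearMap.injective_iff_surjective (f := (whitneyParamD φ z).toLinearMap) |>.1 hi⟩

theorem modelDeriv_pr₁_whitneyParamD (hφ : φ ∈ IsManifold.maximalAtlas (𝓡 n) ∞ Q)
    {z : Coord n × ((Coord n →L[ℝ] ℝ) × Coord n)} (hz : z.1 ∈ φ.target)
    (a : Coord n × ((Coord n →L[ℝ] ℝ) × Coord n)) :
    modelDeriv (modelWhitney n) (modelCotQ n) pr₁ (whitneyParam φ z) (whitneyParamD φ z a) =
      cotParamD φ (z.1, z.2.1) (a.1, a.2.1) := by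
  have h1 := (contMDiff_pr₁ (whitneyParam φ z)).hasModelDeriv.comp
    (hasModelDeriv_whitneyParam hφ hz) rfl
  have h2 := ((ContinuousLinearMap.fst ℝ (Coord n) ((Coord n →L[ℝ] ℝ) × Coord n)).prod
    ((ContinuousLinearMap.fst ℝ (Coord n →L[ℝ] ℝ) (Coord n)).comp
      (ContinuousLinearMap.snd ℝ (Coord n) ((Coord n →L[ℝ] ℝ) × Coord n)))).hasFDerivAt (x := z)
  have h3 := (hasModelDeriv_cotParam hφ (z := (z.1, z.2.1)) hz).comp
    (hasModelDeriv_iff_hasFDerivAt.2 h2) rfl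
  exact DFunLike.congr_fun (h1.unique h3) a

theorem modelDeriv_pr₂_whitneyParamD (hφ : φ ∈ IsManifold.maximalAtlas (𝓡 n) ∞ Q)
    {z : Coord n × ((Coord n →L[ℝ] ℝ) × Coord n)} (hz : z.1 ∈ φ.target)
    (a : Coord n × ((Coord n →L[ℝ] ℝ) × Coord n)) :
    modelDeriv (modelWhitney n) (modelTQ n) pr₂ (whitneyParam φ z) (whitneyParamD φ z a) =
      tqParamD φ (z.1, z.2.2) (a.1, a.2.2) := by
  have h1 := (contMDiff_pr₂ (whitneyParam φ z)).hasModelDeriv.comp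
    (hasModelDeriv_whitneyParam hφ hz) rfl
  have h2 := ((ContinuousLinearMap.fst ℝ (Coord n) ((Coord n →L[ℝ] ℝ) × Coord n)).prod
    ((ContinuousLinearMap.snd ℝ (Coord n →L[ℝ] ℝ) (Coord n)).comp
      (ContinuousLinearMap.snd ℝ (Coord n) ((Coord n →L[ℝ] ℝ) × Coord n)))).hasFDerivAt (x := z)
  have h3 := (hasModelDeriv_tqParam hφ (z := (z.1, z.2.2)) hz).comp
    (hasModelDeriv_iff_hasFDerivAt.2 h2) rfl
  exact DFunLike.congr_fun (h1.unique h3) a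

theorem dτ_tqParamD (hφ : φ ∈ IsManifold.maximalAtlas (𝓡 n) ∞ Q)
    {z : Coord n × Coord n} (hz : z.1 ∈ φ.target) (a : Coord n × Coord n) :
    dτ (tqParam φ z) (tqParamD φ z a) = chartDSymm φ z.1 a.1 := by
  have h1 := ((contMDiff_proj (TangentSpace (𝓡 n) : Q → Type _) (IB := 𝓡 n) (n := ∞)
    (F := Coord n)) (tqParam φ z)).hasModelDeriv.comp (hasModelDeriv_tqParam hφ hz) rfl
  have h3 := (hasModelDeriv_chart_symm hφ hz).comp
    (hasModelDeriv_iff_hasFDerivAt.2 (hasFDerivAt_fst (p := z))) rfl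
  exact DFunLike.congr_fun (h1.unique h3) a

theorem hasFDerivAt_fibre (x y : Coord n) :
    HasFDerivAt (fun y' : Coord n => (x, y')) (ContinuousLinearMap.inr ℝ (Coord n) (Coord n)) y :=
  hasFDerivAt_prodMk_right x y

theorem verticalLift_tqParam (hφ : φ ∈ IsManifold.maximalAtlas (𝓡 n) ∞ Q)
    {z : Coord n × Coord n} (hz : z.1 ∈ φ.target) (w : Coord n) :
    verticalLift (tqParam φ z) (chartDSymm φ z.1 w) = tqParamD φ z (0, w) := by
  have h1 : HasFDerivAt (fun u : Coord n => (z.1, chartD φ (φ.symm z.1) u))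
      ((ContinuousLinearMap.inr ℝ (Coord n) (Coord n)).comp (chartD φ (φ.symm z.1)))
      (chartDSymm φ z.1 z.2) :=
    (hasFDerivAt_fibre _ _).comp _ (chartD φ (φ.symm z.1)).hasFDerivAt
  have h2 := (hasModelDeriv_tqParam hφ hz).comp (hasModelDeriv_iff_hasFDerivAt.2 h1)
    (Prod.ext rfl (chartD_chartDSymm hφ hz z.2))
  have h3 : (fun u : Coord n => (⟨φ.symm z.1, u⟩ : TQ n Q)) =
      tqParam φ ∘ fun u : Coord n => (z.1, chartD φ (φ.symm z.1) u) := by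
    funext u
    refine congrArg (TotalSpace.mk _) ?_
    have := chartDSymm_chartD hφ (φ.map_target hz) u
    rw [φ.right_inv hz] at this
    exact this.symm
  rw [← h3] at h2
  have h4 := DFunLike.congr_fun h2.modelDeriv_eq (chartDSymm φ z.1 w)
  rw [ContinuousLinearMap.comp_apply, ContinuousLinearMap.comp_apply,
    chartD_chartDSymm hφ hz] at h4
  exact h4

theorem verticalEndo_tqParamD (hφ : φ ∈ IsManifold.maximalAtlas (𝓡 n) ∞ Q)
    {z : Coord n × Coord n} (hz : z.1 ∈ φ.target) (a : Coord n × Coord n) :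
    verticalEndo (tqParam φ z) (tqParamD φ z a) = tqParamD φ z (0, a.1) :=
  (congrArg (verticalLift (tqParam φ z)) (dτ_tqParamD hφ hz a)).trans
    (verticalLift_tqParam hφ hz a.1)

theorem contDiffAt_coordLagrangian (hφ : φ ∈ IsManifold.maximalAtlas (𝓡 n) ∞ Q)
    (hL : ContMDiff (modelTQ n) 𝓘(ℝ, ℝ) ∞ L) {z : Coord n × Coord n} (hz : z.1 ∈ φ.target) :
    ContDiffAt ℝ ∞ (coordLagrangian L φ) z := by
  rw [← contMDiffAt_iff_contDiffAt]
  exact (hL _).comp z (contMDiffAt_tqParam hφ hz)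

theorem contDiffAt_coordMomentum (hφ : φ ∈ IsManifold.maximalAtlas (𝓡 n) ∞ Q)
    (hL : ContMDiff (modelTQ n) 𝓘(ℝ, ℝ) ∞ L) {z : Coord n × Coord n} (hz : z.1 ∈ φ.target) :
    ContDiffAt ℝ ∞ (coordMomentum L φ) z :=
  ((contDiffAt_coordLagrangian hφ hL hz).fderiv_right (m := ∞) (by simp)).clm_comp
    contDiffAt_const

theorem differential_tqParamD (hφ : φ ∈ IsManifold.maximalAtlas (𝓡 n) ∞ Q)
    (hL : ContMDiff (modelTQ n) 𝓘(ℝ, ℝ) ∞ L) {z : Coord n × Coord n} (hz : z.1 ∈ φ.target)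
    (a : Coord n × Coord n) :
    differential (modelTQ n) L (tqParam φ z) (tqParamD φ z a) =
      fderiv ℝ (coordLagrangian L φ) z a := by
  have h1 := (hL (tqParam φ z)).hasModelDeriv.comp (hasModelDeriv_tqParam hφ hz) rfl
  exact (DFunLike.congr_fun (hasModelDeriv_iff_hasFDerivAt.1 h1).fderiv a).symm

theorem legendre_tqParam (hφ : φ ∈ IsManifold.maximalAtlas (𝓡 n) ∞ Q)
    (hL : ContMDiff (modelTQ n) 𝓘(ℝ, ℝ) ∞ L) {z : Coord n × Coord n} (hz : z.1 ∈ φ.target) :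
    (legendre L (tqParam φ z) : Coord n →L[ℝ] ℝ) =
      (coordMomentum L φ z).comp (chartD φ (φ.symm z.1)) := by
  have h1 : HasFDerivAt (fun u : Coord n => (z.1, chartD φ (φ.symm z.1) u))
      ((ContinuousLinearMap.inr ℝ (Coord n) (Coord n)).comp (chartD φ (φ.symm z.1)))
      (chartDSymm φ z.1 z.2) :=
    (hasFDerivAt_fibre _ _).comp _ (chartD φ (φ.symm z.1)).hasFDerivAt
  have h0 : (z.1, chartD φ (φ.symm z.1) (chartDSymm φ z.1 z.2)) = z :=
    Prod.ext rfl (chartD_chartDSymm hφ hz z.2)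
  have h2 : HasFDerivAt (coordLagrangian L φ) (fderiv ℝ (coordLagrangian L φ) z)
      (z.1, chartD φ (φ.symm z.1) (chartDSymm φ z.1 z.2)) := by
    rw [h0]
    exact ((contDiffAt_coordLagrangian hφ hL hz).differentiableAt (by simp)).hasFDerivAt
  have h3 := h2.comp (chartDSymm φ z.1 z.2) h1
  have h4 : (fun u : Coord n => L (⟨φ.symm z.1, u⟩ : TQ n Q)) =
      coordLagrangian L φ ∘ fun u : Coord n => (z.1, chartD φ (φ.symm z.1) u) := by
    funext u
    refine congrArg L (congrArg (TotalSpace.mk _) ?_)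
    have := chartDSymm_chartD hφ (φ.map_target hz) u
    rw [φ.right_inv hz] at this
    exact this.symm
  rw [← h4] at h3
  exact h3.fderiv

/-- In coordinates `S` sends `(a₁, a₂)` to `(0, a₁)`, so `S^*dL` is `p_L dq` with `p_L` the
coordinate momentum, and `ω_L = dq ∧ dp_L`. -/
theorem poincareCartanForm_tqParamD (hφ : φ ∈ IsManifold.maximalAtlas (𝓡 n) ∞ Q)
    (hL : ContMDiff (modelTQ n) 𝓘(ℝ, ℝ) ∞ L) {z : Coord n × Coord n} (hz : z.1 ∈ φ.target)
    (a b : Coord n × Coord n) :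
    poincareCartanForm L (tqParam φ z) (tqParamD φ z a) (tqParamD φ z b) =
      fderiv ℝ (coordMomentum L φ) z b a.1 - fderiv ℝ (coordMomentum L φ) z a b.1 := by
  have hp := ((contDiffAt_coordMomentum hφ hL hz).differentiableAt (by simp)).hasFDerivAt
  have hϑ := hp.clm_comp
    (hasFDerivAt_const (ContinuousLinearMap.fst ℝ (Coord n) (Coord n)) z)
  have hev := continuousAt_fst.eventually_mem (φ.open_target.mem_nhds hz)
  have h := extDerivOneForm_of_parametrization (I := modelTQ n)
    (fun w => verticalEndoDual w (differential (modelTQ n) L w))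
    (contMDiffAt_tqParam hφ hz) (contMDiffAt_tqCoord hφ (v := tqParam φ z) (φ.map_target hz))
    (((FiberBundle.continuous_proj (Coord n) (TangentSpace (𝓡 n) : Q → Type _)).continuousAt
      (x := tqParam φ z)).eventually_mem
      (φ.open_source.mem_nhds (φ.map_target hz)) |>.mono fun v hv => tqParam_tqCoord hφ hv)
    (hev.mono fun w hw => tqCoord_tqParam hφ hw)
    (ϑ := fun w => (coordMomentum L φ w).comp (ContinuousLinearMap.fst ℝ (Coord n) (Coord n)))
    (hev.mono fun w hw a => ?_) hϑ.differentiableAt a b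
  · rw [hϑ.fderiv] at h
    refine (congrArg Neg.neg h).trans ?_
    simp
  · have h1 := verticalEndo_tqParamD hφ hw a
    have h2 := differential_tqParamD hφ hL hw (0, a.1)
    exact h2.symm.trans (congrArg (differential (modelTQ n) L (tqParam φ w)) h1.symm)

theorem canonicalForm_cotParamD (hφ : φ ∈ IsManifold.maximalAtlas (𝓡 n) ∞ Q)
    {z : Coord n × (Coord n →L[ℝ] ℝ)} (hz : z.1 ∈ φ.target)
    (a b : Coord n × (Coord n →L[ℝ] ℝ)) :
    canonicalForm (cotParam φ z) (cotParamD φ z a) (cotParamD φ z b) = b.2 a.1 - a.2 b.1 := by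
  have hϑ := (hasFDerivAt_snd (p := z) (𝕜 := ℝ)).clm_comp
    (hasFDerivAt_const (ContinuousLinearMap.fst ℝ (Coord n) (Coord n →L[ℝ] ℝ)) z)
  have hev := continuousAt_fst.eventually_mem (φ.open_target.mem_nhds hz)
  have h := extDerivOneForm_of_parametrization (I := modelCotQ n) liouvilleForm
    (contMDiffAt_cotParam hφ hz) (contMDiffAt_cotCoord hφ (p := cotParam φ z) (φ.map_target hz))
    (((FiberBundle.continuous_proj (Coord n →L[ℝ] ℝ) (CotangentSpace n Q)).continuousAt
      (x := cotParam φ z)).eventually_mem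
      (φ.open_source.mem_nhds (φ.map_target hz)) |>.mono fun v hv => cotParam_cotCoord hφ hv)
    (hev.mono fun w hw => cotCoord_cotParam hφ hw)
    (ϑ := fun w => (Prod.snd w).comp (ContinuousLinearMap.fst ℝ (Coord n) (Coord n →L[ℝ] ℝ)))
    (hev.mono fun w hw a => ?_) hϑ.differentiableAt a b
  · rw [hϑ.fderiv] at h
    refine (congrArg Neg.neg h).trans ?_
    simp
  · have h1 := ((contMDiff_proj (CotangentSpace n Q) (IB := 𝓡 n) (n := ∞)
      (F := Coord n →L[ℝ] ℝ)) (cotParam φ w)).hasModelDeriv.comp (hasModelDeriv_cotParam hφ hw) rfl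
    have h3 := (hasModelDeriv_chart_symm hφ hw).comp
      (hasModelDeriv_iff_hasFDerivAt.2 (hasFDerivAt_fst (p := w))) rfl
    have h4 := DFunLike.congr_fun (h1.unique h3) a
    have h5 := (congrArg (fun u => w.2 (chartD φ (φ.symm w.1) u)) h4).trans
      (congrArg w.2 (chartD_chartDSymm hφ hw a.1))
    exact h5.symm

theorem formΩ_whitneyParamD (hφ : φ ∈ IsManifold.maximalAtlas (𝓡 n) ∞ Q)
    {z : Coord n × ((Coord n →L[ℝ] ℝ) × Coord n)} (hz : z.1 ∈ φ.target)
    (a b : Coord n × ((Coord n →L[ℝ] ℝ) × Coord n)) :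
    formΩ (whitneyParam φ z) (whitneyParamD φ z a) (whitneyParamD φ z b) =
      b.2.1 a.1 - a.2.1 b.1 := by
  have ha := modelDeriv_pr₁_whitneyParamD hφ hz a
  have hb := modelDeriv_pr₁_whitneyParamD hφ hz b
  have h := canonicalForm_cotParamD hφ (z := (z.1, z.2.1)) hz (a.1, a.2.1) (b.1, b.2.1)
  rw [← ha, ← hb] at h
  exact h

theorem formΩL_whitneyParamD (hφ : φ ∈ IsManifold.maximalAtlas (𝓡 n) ∞ Q)
    (hL : ContMDiff (modelTQ n) 𝓘(ℝ, ℝ) ∞ L)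
    {z : Coord n × ((Coord n →L[ℝ] ℝ) × Coord n)} (hz : z.1 ∈ φ.target)
    (a b : Coord n × ((Coord n →L[ℝ] ℝ) × Coord n)) :
    formΩL L (whitneyParam φ z) (whitneyParamD φ z a) (whitneyParamD φ z b) =
      b.2.1 a.1 - a.2.1 b.1 + (fderiv ℝ (coordMomentum L φ) (z.1, z.2.2) (b.1, b.2.2) a.1
        - fderiv ℝ (coordMomentum L φ) (z.1, z.2.2) (a.1, a.2.2) b.1) := by
  have ha := modelDeriv_pr₂_whitneyParamD hφ hz a
  have hb := modelDeriv_pr₂_whitneyParamD hφ hz b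
  have h := poincareCartanForm_tqParamD hφ hL (z := (z.1, z.2.2)) hz (a.1, a.2.2) (b.1, b.2.2)
  rw [← ha, ← hb] at h
  exact congrArg₂ (· + ·) (formΩ_whitneyParamD hφ hz a b) h

theorem energy_tqParam (hφ : φ ∈ IsManifold.maximalAtlas (𝓡 n) ∞ Q)
    (hL : ContMDiff (modelTQ n) 𝓘(ℝ, ℝ) ∞ L) {z : Coord n × Coord n} (hz : z.1 ∈ φ.target) :
    energy L (tqParam φ z) = coordMomentum L φ z z.2 - coordLagrangian L φ z := by
  have h := DFunLike.congr_fun (legendre_tqParam hφ hL hz) (chartDSymm φ z.1 z.2)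
  exact congrArg (· - coordLagrangian L φ z)
    (h.trans (congrArg (coordMomentum L φ z) (chartD_chartDSymm hφ hz z.2)))

theorem pairing_whitneyParam (hφ : φ ∈ IsManifold.maximalAtlas (𝓡 n) ∞ Q)
    {z : Coord n × ((Coord n →L[ℝ] ℝ) × Coord n)} (hz : z.1 ∈ φ.target) :
    (pr₁ (whitneyParam φ z)).2 (pr₂ (whitneyParam φ z)).2 = z.2.1 z.2.2 :=
  congrArg z.2.1 (chartD_chartDSymm hφ hz z.2.2)

theorem hamiltonianBar_whitneyParam (hφ : φ ∈ IsManifold.maximalAtlas (𝓡 n) ∞ Q)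
    (hL : ContMDiff (modelTQ n) 𝓘(ℝ, ℝ) ∞ L)
    {z : Coord n × ((Coord n →L[ℝ] ℝ) × Coord n)} (hz : z.1 ∈ φ.target) :
    hamiltonianBar L (whitneyParam φ z) = z.2.1 z.2.2 + (coordMomentum L φ (z.1, z.2.2) z.2.2
      - coordLagrangian L φ (z.1, z.2.2)) :=
  congrArg₂ (· + ·) (pairing_whitneyParam hφ hz) (energy_tqParam hφ hL (z := (z.1, z.2.2)) hz)

theorem fibredMap_whitneyParam (hφ : φ ∈ IsManifold.maximalAtlas (𝓡 n) ∞ Q)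
    (hL : ContMDiff (modelTQ n) 𝓘(ℝ, ℝ) ∞ L)
    {z : Coord n × ((Coord n →L[ℝ] ℝ) × Coord n)} (hz : z.1 ∈ φ.target) :
    fibredMap L (whitneyParam φ z) =
      whitneyParam φ (z.1, (z.2.1 - coordMomentum L φ (z.1, z.2.2), z.2.2)) := by
  have h := legendre_tqParam hφ hL (z := (z.1, z.2.2)) hz
  refine congrArg (fun β : Coord n →L[ℝ] ℝ =>
    (⟨φ.symm z.1, (β, chartDSymm φ z.1 z.2.2)⟩ : Whitney n Q)) ?_
  exact (congrArg (fun β => z.2.1.comp (chartD φ (φ.symm z.1)) - β) h).trans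
    (ContinuousLinearMap.sub_comp _ _ _).symm

end Coordinates

/-! ### Invariance of the constraint algorithm under diffeomorphisms -/

section Naturality

variable {E H N : Type*} [NormedAddCommGroup E] [NormedSpace ℝ E] [TopologicalSpace H]
  {I : ModelWithCorners ℝ E H} [TopologicalSpace N] [ChartedSpace H N]
  {E' H' N' : Type*} [NormedAddCommGroup E'] [NormedSpace ℝ E'] [TopologicalSpace H']
  {I' : ModelWithCorners ℝ E' H'} [TopologicalSpace N'] [ChartedSpace H' N']
  {F : N → N'} {G : N' → N}

theorem modelDeriv_leftInverse (hF : ContMDiff I I' ∞ F) (hG : ContMDiff I' I ∞ G)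
    (hGF : ∀ x, G (F x) = x) (x : N) (v : E) :
    modelDeriv I' I G (F x) (modelDeriv I I' F x v) = v := by
  have h1 := (hG (F x)).hasModelDeriv.comp (hF x).hasModelDeriv rfl
  have h2 := h1.unique ((hasModelDeriv_id x).congr (Eventually.of_forall hGF))
  exact DFunLike.congr_fun h2 v

theorem modelDeriv_rightInverse (hF : ContMDiff I I' ∞ F) (hG : ContMDiff I' I ∞ G)
    (hGF : ∀ x, G (F x) = x) (hFG : ∀ y, F (G y) = y) (x : N) (w : E') :
    modelDeriv I I' F x (modelDeriv I' I G (F x) w) = w := by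
  have h1 := (hF x).hasModelDeriv.comp (hG (F x)).hasModelDeriv (hGF x)
  have h2 := h1.unique ((hasModelDeriv_id (F x)).congr (Eventually.of_forall hFG))
  exact DFunLike.congr_fun h2 w

theorem mem_tangentTo_congr {S : Set N} {x y : N} (h : x = y) (v : E) :
    v ∈ tangentTo I S x ↔ v ∈ tangentTo I S y := by
  subst h; rfl

theorem mem_tangentTo_iff_of_diffeo (hF : ContMDiff I I' ∞ F) (hG : ContMDiff I' I ∞ G)
    (hGF : ∀ x, G (F x) = x) (hFG : ∀ y, F (G y) = y) {A : Set N} {B : Set N'}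
    (hAB : ∀ x, x ∈ A ↔ F x ∈ B) (x : N) (v : E) :
    v ∈ tangentTo I A x ↔ modelDeriv I I' F x v ∈ tangentTo I' B (F x) := by
  refine ⟨mapsTo_tangentTo hF fun y => (hAB y).1, fun h => ?_⟩
  have h1 := mapsTo_tangentTo hG (A := B) (B := A)
    (fun y hy => (hAB _).2 ((hFG y).symm ▸ hy)) h
  rw [modelDeriv_leftInverse hF hG hGF] at h1
  exact (mem_tangentTo_congr (hGF x) v).1 h1

/-- Each ingredient of a stage (tangent vectors of `S`, tangent vectors of the previous stage, the
form, the differential) corresponds under `F`. The induction is over all points at once, because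
tangency to a stage involves the whole set. -/
theorem mem_gotayNester_iff_of_diffeo (hF : ContMDiff I I' ∞ F) (hG : ContMDiff I' I ∞ G)
    (hGF : ∀ x, G (F x) = x) (hFG : ∀ y, F (G y) = y) {S : Set N} {S' : Set N'}
    (hS : ∀ x, x ∈ S ↔ F x ∈ S')
    {Ω : ∀ x : N, TangentSpace I x → TangentSpace I x → ℝ}
    {Ω' : ∀ x : N', TangentSpace I' x → TangentSpace I' x → ℝ}
    (hΩ : ∀ (x : N) (a b : E),
      Ω' (F x) (modelDeriv I I' F x a) (modelDeriv I I' F x b) = Ω x a b)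
    {h : N → ℝ} {h' : N' → ℝ} (hh' : ContMDiff I' 𝓘(ℝ, ℝ) ∞ h') (hh : ∀ x, h' (F x) = h x)
    (i : ℕ) (x : N) : x ∈ gotayNester I S Ω h i ↔ F x ∈ gotayNester I' S' Ω' h' i := by
  induction i generalizing x with
  | zero => exact hS x
  | succ i ih =>
    have hd : ∀ v : E, differential I' h' (F x) (modelDeriv I I' F x v) = differential I h x v := by
      intro v
      have h1 := ((hh' (F x)).hasModelDeriv.comp (hF x).hasModelDeriv rfl).congr
        (Eventually.of_forall fun y => (hh y).symm)
      exact (DFunLike.congr_fun h1.modelDeriv_eq v).symm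
    have hT := mem_tangentTo_iff_of_diffeo hF hG hGF hFG hS x
    have hTi := mem_tangentTo_iff_of_diffeo hF hG hGF hFG ih x
    have hsurj : ∀ w : E', ∃ v : E, modelDeriv I I' F x v = w := fun w =>
      ⟨_, modelDeriv_rightInverse hF hG hGF hFG x w⟩
    refine and_congr (ih x) ⟨fun H w hw hu => ?_, fun H v hv hu => ?_⟩
    · obtain ⟨v, rfl⟩ := hsurj w
      refine (hd v).trans (H v ((hT v).2 hw) fun u hu' => ?_)
      exact (hΩ x u v).symm.trans (hu _ ((hTi u).1 hu'))
    · refine (hd v).symm.trans (H _ ((hT v).1 hv) fun w hw => ?_)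
      obtain ⟨u, rfl⟩ := hsurj w
      exact (hΩ x u v).trans (hu u ((hTi u).2 hw))

theorem isSubmanifold_of_diffeo (hF : ContMDiff I I' ∞ F) (hG : ContMDiff I' I ∞ G)
    (hGF : ∀ x, G (F x) = x) (hFG : ∀ y, F (G y) = y) {A : Set N} {B : Set N'}
    (hAB : ∀ x, x ∈ A ↔ F x ∈ B) (hA : IsSubmanifold I A) : IsSubmanifold I' B := by
  intro y hy
  have hBA : ∀ y, y ∈ B ↔ G y ∈ A := fun y => by rw [hAB, hFG]
  obtain ⟨c, U, Φ, hU, hyU, hΦ, hs, hAU⟩ := hA (G y) ((hBA y).1 hy)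
  refine ⟨c, G ⁻¹' U, Φ ∘ G, hU.preimage hG.continuous, hyU,
    hΦ.comp hG.contMDiffOn fun _ h => h, ?_, ?_⟩
  · have h1 := (hΦ.contMDiffAt (hU.mem_nhds hyU)).hasModelDeriv.comp (hG y).hasModelDeriv rfl
    have h2 : Function.Surjective (modelDeriv I' I G y) := fun v =>
      ⟨_, modelDeriv_rightInverse hG hF hFG hGF y v⟩
    have h3 : Function.Surjective (modelDeriv I' 𝓘(ℝ, Fin c → ℝ) (Φ ∘ G) y) := by
      rw [h1.modelDeriv_eq]
      exact hs.comp h2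
    exact h3
  · ext y'
    have h1 := Set.ext_iff.1 hAU (G y')
    exact (and_congr_left' (hBA y')).trans h1

end Naturality

/-! ### The fibred map intertwines the two systems -/

section FibredMap

variable {n : ℕ} {Q : Type*} [TopologicalSpace Q] [ChartedSpace (EuclideanSpace ℝ (Fin n)) Q]
  [IsManifold (𝓡 n) ∞ Q] {L : TQ n Q → ℝ}

theorem legendre_neg (L : TQ n Q → ℝ) (v : TQ n Q) : legendre (-L) v = -legendre L v :=
  fderiv_fun_neg (𝕜 := ℝ) (f := fun u : Coord n => L ⟨v.1, u⟩) (x := (v.2 : Coord n))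

/-- The fibre derivative is odd in `L`, so the shift by `-L` undoes the shift by `L`; smoothness of
the inverse is then an instance of smoothness of `fibredMap`. -/
theorem fibredMap_neg_fibredMap (L : TQ n Q → ℝ) (p : Whitney n Q) :
    fibredMap (-L) (fibredMap L p) = p := by
  obtain ⟨q, α, w⟩ := p
  have h : (α - legendre L ⟨q, w⟩ : Coord n →L[ℝ] ℝ) - (legendre (-L) ⟨q, w⟩ : Coord n →L[ℝ] ℝ) =
      α :=
    (congrArg (fun β => (α - legendre L ⟨q, w⟩ : Coord n →L[ℝ] ℝ) - β)
      (legendre_neg L ⟨q, w⟩)).trans (by rw [sub_neg_eq_add]; exact sub_add_cancel _ _)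
  exact congrArg (fun β : Coord n →L[ℝ] ℝ => (⟨q, (β, w)⟩ : Whitney n Q)) h

theorem fibredMap_fibredMap_neg (L : TQ n Q → ℝ) (p : Whitney n Q) :
    fibredMap L (fibredMap (-L) p) = p := by
  simpa using fibredMap_neg_fibredMap (-L) p

theorem exists_chart_param (p : Whitney n Q) :
    ∃ φ ∈ IsManifold.maximalAtlas (𝓡 n) ∞ Q,
      ∃ z : Coord n × ((Coord n →L[ℝ] ℝ) × Coord n), z.1 ∈ φ.target ∧ whitneyParam φ z = p :=
  ⟨chartAt (Coord n) p.1, IsManifold.chart_mem_maximalAtlas _, whitneyCoord _ p,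
    mem_chart_target _ _, whitneyParam_whitneyCoord (IsManifold.chart_mem_maximalAtlas _)
      (mem_chart_source _ _)⟩

theorem contMDiffAt_of_whitneyParam {E H N : Type*} [NormedAddCommGroup E] [NormedSpace ℝ E]
    [TopologicalSpace H] {I : ModelWithCorners ℝ E H} [TopologicalSpace N] [ChartedSpace H N]
    {φ : OpenPartialHomeomorph Q (Coord n)} (hφ : φ ∈ IsManifold.maximalAtlas (𝓡 n) ∞ Q)
    {z : Coord n × ((Coord n →L[ℝ] ℝ) × Coord n)} (hz : z.1 ∈ φ.target) {f : Whitney n Q → N}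
    (hf : ContMDiffAt 𝓘(ℝ, Coord n × ((Coord n →L[ℝ] ℝ) × Coord n)) I ∞
      (f ∘ whitneyParam φ) z) : ContMDiffAt (modelWhitney n) I ∞ f (whitneyParam φ z) := by
  have hs : (whitneyParam φ z).1 ∈ φ.source := φ.map_target hz
  have h1 : ContMDiffAt (modelWhitney n) I ∞ ((f ∘ whitneyParam φ) ∘ whitneyCoord φ)
      (whitneyParam φ z) :=
    ContMDiffAt.comp _ (by rw [whitneyCoord_whitneyParam hφ hz]; exact hf)
      (contMDiffAt_whitneyCoord hφ hs)
  refine h1.congr_of_eventuallyEq ?_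
  have hc := (FiberBundle.continuous_proj ((Coord n →L[ℝ] ℝ) × Coord n)
    (CotangentSpace n Q ×ᵇ (TangentSpace (𝓡 n) : Q → Type _))).continuousAt
      (x := whitneyParam φ z)
  filter_upwards [hc.eventually_mem (φ.open_source.mem_nhds hs)] with p hp
  exact congrArg f (whitneyParam_whitneyCoord hφ hp).symm

/-- The fibred map `F` in the coordinates of a chart. -/
def coordFibredMap (L : TQ n Q → ℝ) (φ : OpenPartialHomeomorph Q (Coord n))
    (z : Coord n × ((Coord n →L[ℝ] ℝ) × Coord n)) : Coord n × ((Coord n →L[ℝ] ℝ) × Coord n) :=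
  (z.1, (z.2.1 - coordMomentum L φ (z.1, z.2.2), z.2.2))

/-- The map `(q, p, q̇) ↦ (q, q̇)`. -/
def baseVelocity (n : ℕ) : Coord n × ((Coord n →L[ℝ] ℝ) × Coord n) →L[ℝ] Coord n × Coord n :=
  (ContinuousLinearMap.fst ℝ (Coord n) ((Coord n →L[ℝ] ℝ) × Coord n)).prod
    ((ContinuousLinearMap.snd ℝ (Coord n →L[ℝ] ℝ) (Coord n)).comp
      (ContinuousLinearMap.snd ℝ (Coord n) ((Coord n →L[ℝ] ℝ) × Coord n)))

theorem contDiffAt_coordMomentum_baseVelocity {φ : OpenPartialHomeomorph Q (Coord n)}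
    (hφ : φ ∈ IsManifold.maximalAtlas (𝓡 n) ∞ Q) (hL : ContMDiff (modelTQ n) 𝓘(ℝ, ℝ) ∞ L)
    {z : Coord n × ((Coord n →L[ℝ] ℝ) × Coord n)} (hz : z.1 ∈ φ.target) :
    ContDiffAt ℝ ∞ (fun z' : Coord n × ((Coord n →L[ℝ] ℝ) × Coord n) =>
      coordMomentum L φ (z'.1, z'.2.2)) z :=
  (contDiffAt_coordMomentum hφ hL (z := (z.1, z.2.2)) hz).comp z (baseVelocity n).contDiff.contDiffAt

theorem contDiffAt_coordFibredMap {φ : OpenPartialHomeomorph Q (Coord n)}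
    (hφ : φ ∈ IsManifold.maximalAtlas (𝓡 n) ∞ Q) (hL : ContMDiff (modelTQ n) 𝓘(ℝ, ℝ) ∞ L)
    {z : Coord n × ((Coord n →L[ℝ] ℝ) × Coord n)} (hz : z.1 ∈ φ.target) :
    ContDiffAt ℝ ∞ (coordFibredMap L φ) z :=
  contDiffAt_fst.prodMk (((contDiffAt_fst.comp z contDiffAt_snd).sub
    (contDiffAt_coordMomentum_baseVelocity hφ hL hz)).prodMk (contDiffAt_snd.comp z contDiffAt_snd))

theorem fibredMap_comp_whitneyParam_eventuallyEq {φ : OpenPartialHomeomorph Q (Coord n)}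
    (hφ : φ ∈ IsManifold.maximalAtlas (𝓡 n) ∞ Q) (hL : ContMDiff (modelTQ n) 𝓘(ℝ, ℝ) ∞ L)
    {z : Coord n × ((Coord n →L[ℝ] ℝ) × Coord n)} (hz : z.1 ∈ φ.target) :
    fibredMap L ∘ whitneyParam φ =ᶠ[𝓝 z] whitneyParam φ ∘ coordFibredMap L φ :=
  (continuousAt_fst.eventually_mem (φ.open_target.mem_nhds hz)).mono fun _ hw =>
    fibredMap_whitneyParam hφ hL hw

theorem contMDiff_fibredMap (hL : ContMDiff (modelTQ n) 𝓘(ℝ, ℝ) ∞ L) :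
    ContMDiff (modelWhitney n) (modelWhitney n) ∞ (fibredMap L) := by
  intro p
  obtain ⟨φ, hφ, z, hz, rfl⟩ := exists_chart_param p
  refine contMDiffAt_of_whitneyParam hφ hz ?_
  refine ContMDiffAt.congr_of_eventuallyEq ?_ (fibredMap_comp_whitneyParam_eventuallyEq hφ hL hz)
  exact (contMDiffAt_whitneyParam hφ (z := coordFibredMap L φ z) hz).comp z
    (contDiffAt_coordFibredMap hφ hL hz).contMDiffAt

theorem modelDeriv_fibredMap (hL : ContMDiff (modelTQ n) 𝓘(ℝ, ℝ) ∞ L)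
    {φ : OpenPartialHomeomorph Q (Coord n)} (hφ : φ ∈ IsManifold.maximalAtlas (𝓡 n) ∞ Q)
    {z : Coord n × ((Coord n →L[ℝ] ℝ) × Coord n)} (hz : z.1 ∈ φ.target)
    (a : Coord n × ((Coord n →L[ℝ] ℝ) × Coord n)) :
    modelDeriv (modelWhitney n) (modelWhitney n) (fibredMap L) (whitneyParam φ z)
        (whitneyParamD φ z a) =
      whitneyParamD φ (coordFibredMap L φ z)
        (a.1, (a.2.1 - fderiv ℝ (coordMomentum L φ) (z.1, z.2.2) (a.1, a.2.2), a.2.2)) := by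
  have h1 := (contMDiff_fibredMap hL (whitneyParam φ z)).hasModelDeriv.comp
    (hasModelDeriv_whitneyParam hφ hz) rfl
  have h2 := (hasModelDeriv_whitneyParam hφ (z := coordFibredMap L φ z) hz).comp
    (hasModelDeriv_iff_hasFDerivAt.2
      ((contDiffAt_coordFibredMap hφ hL hz).differentiableAt (by simp)).hasFDerivAt) rfl
  have h3 := h1.unique (h2.congr (fibredMap_comp_whitneyParam_eventuallyEq hφ hL hz))
  have hm : HasFDerivAt (coordMomentum L φ) (fderiv ℝ (coordMomentum L φ) (z.1, z.2.2))
      (baseVelocity n z) :=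
    ((contDiffAt_coordMomentum hφ hL (z := (z.1, z.2.2)) hz).differentiableAt
      (by simp)).hasFDerivAt
  have h4 : HasFDerivAt (coordFibredMap L φ) _ z :=
    (ContinuousLinearMap.fst ℝ (Coord n) ((Coord n →L[ℝ] ℝ) × Coord n)).hasFDerivAt.prodMk
      ((((ContinuousLinearMap.fst ℝ (Coord n →L[ℝ] ℝ) (Coord n)).comp
        (ContinuousLinearMap.snd ℝ (Coord n) ((Coord n →L[ℝ] ℝ) × Coord n))).hasFDerivAt.sub
        (hm.comp z (baseVelocity n).hasFDerivAt)).prodMk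
      ((ContinuousLinearMap.snd ℝ (Coord n →L[ℝ] ℝ) (Coord n)).comp
        (ContinuousLinearMap.snd ℝ (Coord n) ((Coord n →L[ℝ] ℝ) × Coord n))).hasFDerivAt)
  rw [h4.fderiv] at h3
  exact DFunLike.congr_fun h3 a

/-- The form is `dq ∧ d(p + p_L)` and `F` replaces `p` by `p - p_L`: the derivatives of the momentum
cancel. -/
theorem formΩL_fibredMap (hL : ContMDiff (modelTQ n) 𝓘(ℝ, ℝ) ∞ L) (p : Whitney n Q)
    (a b : Coord n × ((Coord n →L[ℝ] ℝ) × Coord n)) :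
    formΩL L (fibredMap L p)
      (modelDeriv (modelWhitney n) (modelWhitney n) (fibredMap L) p a)
      (modelDeriv (modelWhitney n) (modelWhitney n) (fibredMap L) p b) = formΩ p a b := by
  obtain ⟨φ, hφ, z, hz, rfl⟩ := exists_chart_param p
  obtain ⟨a, rfl⟩ := (whitneyParamD_bijective hφ hz).2 a
  obtain ⟨b, rfl⟩ := (whitneyParamD_bijective hφ hz).2 b
  have h1 := formΩL_whitneyParamD hφ hL (z := coordFibredMap L φ z) hz
    (a.1, (a.2.1 - fderiv ℝ (coordMomentum L φ) (z.1, z.2.2) (a.1, a.2.2), a.2.2))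
    (b.1, (b.2.1 - fderiv ℝ (coordMomentum L φ) (z.1, z.2.2) (b.1, b.2.2), b.2.2))
  have h2 := formΩ_whitneyParamD hφ hz a b
  rw [modelDeriv_fibredMap hL hφ hz, modelDeriv_fibredMap hL hφ hz]
  have h3 : fibredMap L (whitneyParam φ z) = whitneyParam φ (coordFibredMap L φ z) :=
    fibredMap_whitneyParam hφ hL hz
  refine (congrArg (fun q : Whitney n Q => formΩL L q (whitneyParamD φ (coordFibredMap L φ z)
    (a.1, (a.2.1 - fderiv ℝ (coordMomentum L φ) (z.1, z.2.2) (a.1, a.2.2), a.2.2)))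
    (whitneyParamD φ (coordFibredMap L φ z)
    (b.1, (b.2.1 - fderiv ℝ (coordMomentum L φ) (z.1, z.2.2) (b.1, b.2.2), b.2.2)))) h3).trans ?_
  refine h1.trans (Eq.trans ?_ h2.symm)
  simp [coordFibredMap]
  ring

theorem hamiltonianBar_fibredMap (L : TQ n Q → ℝ) (p : Whitney n Q) :
    hamiltonianBar L (fibredMap L p) = hamiltonian L p := by
  obtain ⟨q, α, w⟩ := p
  have h : ∀ (α β : Coord n →L[ℝ] ℝ) (w : Coord n) (c : ℝ),
      (α - β) w + (β w - c) = α w - c := fun α β w c => by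
    rw [sub_apply]; ring
  exact h α (legendre L ⟨q, w⟩) w (L ⟨q, w⟩)

theorem contMDiff_hamiltonianBar (hL : ContMDiff (modelTQ n) 𝓘(ℝ, ℝ) ∞ L) :
    ContMDiff (modelWhitney n) 𝓘(ℝ, ℝ) ∞ (hamiltonianBar L) := by
  intro p
  obtain ⟨φ, hφ, z, hz, rfl⟩ := exists_chart_param p
  refine contMDiffAt_of_whitneyParam hφ hz ?_
  have h1 : ContDiffAt ℝ ∞ (fun z : Coord n × ((Coord n →L[ℝ] ℝ) × Coord n) =>
      z.2.1 z.2.2 + (coordMomentum L φ (z.1, z.2.2) z.2.2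
        - coordLagrangian L φ (z.1, z.2.2))) z :=
    ((contDiffAt_fst.comp z contDiffAt_snd).clm_apply (contDiffAt_snd.comp z contDiffAt_snd)).add
      (((contDiffAt_coordMomentum_baseVelocity hφ hL hz).clm_apply
        (contDiffAt_snd.comp z contDiffAt_snd)).sub
      (ContDiffAt.comp (g := coordLagrangian L φ) z
        (contDiffAt_coordLagrangian hφ hL (z := (z.1, z.2.2)) hz)
        (baseVelocity n).contDiff.contDiffAt))
  exact h1.contMDiffAt.congr_of_eventuallyEq
    ((continuousAt_fst.eventually_mem (φ.open_target.mem_nhds hz)).mono fun _ hw =>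
      hamiltonianBar_whitneyParam hφ hL hw)

theorem mem_seqW_iff_fibredMap_mem_seqP (hL : ContMDiff (modelTQ n) 𝓘(ℝ, ℝ) ∞ L)
    (M : Set (TQ n Q)) (i : ℕ) (p : Whitney n Q) :
    p ∈ seqW L M i ↔ fibredMap L p ∈ seqP L M i :=
  mem_gotayNester_iff_of_diffeo (contMDiff_fibredMap hL) (contMDiff_fibredMap (L := -L) hL.neg)
    (fibredMap_neg_fibredMap L) (fibredMap_fibredMap_neg L)
    (S := phaseSpace M) (S' := phaseSpace M) (fun _ => Iff.rfl)
    (formΩL_fibredMap hL) (contMDiff_hamiltonianBar hL) (hamiltonianBar_fibredMap L) i p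

theorem seqP_isSubmanifold_and_restrictsToDiffeo (hL : ContMDiff (modelTQ n) 𝓘(ℝ, ℝ) ∞ L)
    (M : Set (TQ n Q)) (i : ℕ) (hW : IsSubmanifold (modelWhitney n) (seqW L M i)) :
    IsSubmanifold (modelWhitney n) (seqP L M i) ∧
      RestrictsToDiffeo (modelWhitney n) (modelWhitney n) (fibredMap L)
        (seqW L M i) (seqP L M i) := by
  have hF := contMDiff_fibredMap hL
  have hG := contMDiff_fibredMap (L := -L) hL.neg
  have hi := mem_seqW_iff_fibredMap_mem_seqP hL M i
  refine ⟨isSubmanifold_of_diffeo hF hG (fibredMap_neg_fibredMap L)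
    (fibredMap_fibredMap_neg L) hi hW, fun p hp => (hi p).1 hp, hF.contMDiffOn,
    fibredMap (-L), fun p hp => (hi _).2 ?_, ⟨fun p _ => fibredMap_neg_fibredMap L p,
      fun p _ => fibredMap_fibredMap_neg L p⟩, hG.contMDiffOn⟩
  rwa [fibredMap_fibredMap_neg]

end FibredMap

/-! ### The first constraint set for arbitrary constraints -/

section Constraints

variable {n : ℕ} {Q : Type*} [TopologicalSpace Q] [ChartedSpace (EuclideanSpace ℝ (Fin n)) Q]
  [IsManifold (𝓡 n) ∞ Q] {L : TQ n Q → ℝ} {M : Set (TQ n Q)} {c : ℕ}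
  {φ : OpenPartialHomeomorph Q (Coord n)}

theorem exists_tq_param (v : TQ n Q) :
    ∃ φ ∈ IsManifold.maximalAtlas (𝓡 n) ∞ Q,
      ∃ z : Coord n × Coord n, z.1 ∈ φ.target ∧ tqParam φ z = v :=
  ⟨chartAt (Coord n) v.1, IsManifold.chart_mem_maximalAtlas _, tqCoord _ v,
    mem_chart_target _ _, tqParam_tqCoord (IsManifold.chart_mem_maximalAtlas _)
      (mem_chart_source _ _)⟩

/-- The tangent map of `tqCoord`. -/
def tqCoordD (φ : OpenPartialHomeomorph Q (Coord n)) (v : TQ n Q) :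
    Coord n × Coord n →L[ℝ] Coord n × Coord n :=
  modelDeriv (modelTQ n) 𝓘(ℝ, Coord n × Coord n) (tqCoord φ) v

theorem tqCoordD_tqParamD (hφ : φ ∈ IsManifold.maximalAtlas (𝓡 n) ∞ Q)
    {z : Coord n × Coord n} (hz : z.1 ∈ φ.target) (a : Coord n × Coord n) :
    tqCoordD φ (tqParam φ z) (tqParamD φ z a) = a := by
  have hs : (tqParam φ z).1 ∈ φ.source := φ.map_target hz
  have h1 := (contMDiffAt_tqCoord hφ hs).hasModelDeriv.comp (hasModelDeriv_tqParam hφ hz) rfl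
  have h2 := h1.unique ((hasModelDeriv_id z).congr
    ((continuousAt_fst.eventually_mem (φ.open_target.mem_nhds hz)).mono
      fun w hw => tqCoord_tqParam hφ hw))
  exact DFunLike.congr_fun h2 a

theorem tqParamD_mem_tangentTo_iff (hφ : φ ∈ IsManifold.maximalAtlas (𝓡 n) ∞ Q)
    {z : Coord n × Coord n} {V : Set (Coord n × Coord n)} (hV : IsOpen V) (hzV : z ∈ V)
    (hVφ : ∀ w ∈ V, w.1 ∈ φ.target) {g : Coord n × Coord n → (Fin c → ℝ)}
    (hg : ContDiffOn ℝ ∞ g V) (hs : Function.Surjective (fderiv ℝ g z))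
    (hM : ∀ w ∈ V, tqParam φ w ∈ M ↔ g w = 0) (hzM : tqParam φ z ∈ M) (a : Coord n × Coord n) :
    tqParamD φ z a ∈ tangentTo (modelTQ n) M (tqParam φ z) ↔ fderiv ℝ g z a = 0 := by
  have hz := hVφ z hzV
  let U₀ : Set (TQ n Q) := TotalSpace.proj ⁻¹' φ.source
  have hU₀ : IsOpen U₀ := φ.open_source.preimage
    (FiberBundle.continuous_proj (Coord n) (TangentSpace (𝓡 n) : Q → Type _))
  have hc : ContMDiffOn (modelTQ n) 𝓘(ℝ, Coord n × Coord n) ∞ (tqCoord φ) U₀ := fun v hv =>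
    (contMDiffAt_tqCoord hφ hv).contMDiffWithinAt
  have hzc := tqCoord_tqParam hφ hz
  have hzU : tqParam φ z ∈ U₀ ∩ tqCoord φ ⁻¹' V :=
    ⟨φ.map_target hz, by rw [mem_preimage, hzc]; exact hzV⟩
  have hgd : HasModelDeriv 𝓘(ℝ, Coord n × Coord n) 𝓘(ℝ, Fin c → ℝ) g z (fderiv ℝ g z) :=
    hasModelDeriv_iff_hasFDerivAt.2
      ((hg.contDiffAt (hV.mem_nhds hzV)).differentiableAt (by simp)).hasFDerivAt
  have hd := (hgd.comp (contMDiffAt_tqCoord hφ hzU.1).hasModelDeriv hzc).modelDeriv_eq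
  have hd' : ∀ a, modelDeriv (modelTQ n) 𝓘(ℝ, Fin c → ℝ) (g ∘ tqCoord φ) (tqParam φ z)
      (tqParamD φ z a) = fderiv ℝ g z a := fun a => by
    rw [hd]
    exact congrArg (fderiv ℝ g z) (tqCoordD_tqParamD hφ hz a)
  rw [mem_tangentTo_of_levelSet (hc.continuousOn.isOpen_inter_preimage hU₀ hV) hzU hzM
    (hg.contMDiffOn.comp (hc.mono inter_subset_left) fun v hv => hv.2)
    (fun y => by
      obtain ⟨a, rfl⟩ := hs y
      exact ⟨_, hd' a⟩) ?_, hd']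
  ext v
  constructor
  · rintro ⟨h1, h2⟩
    refine ⟨h2, (hM _ h2.2).1 ?_⟩
    rwa [tqParam_tqCoord hφ h2.1]
  · rintro ⟨h2, h1⟩
    have h3 := (hM _ h2.2).2 h1
    rw [tqParam_tqCoord hφ h2.1] at h3
    exact ⟨h3, h2⟩

theorem exists_coord_levelSet (hφ : φ ∈ IsManifold.maximalAtlas (𝓡 n) ∞ Q)
    {z : Coord n × Coord n} (hz : z.1 ∈ φ.target)
    (hM : IsLocalLevelSet (modelTQ n) M c (tqParam φ z)) :
    ∃ (V : Set (Coord n × Coord n)) (g : Coord n × Coord n → (Fin c → ℝ)), IsOpen V ∧ z ∈ V ∧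
      (∀ w ∈ V, w.1 ∈ φ.target) ∧ ContDiffOn ℝ ∞ g V ∧ Function.Surjective (fderiv ℝ g z) ∧
      ∀ w ∈ V, tqParam φ w ∈ M ↔ g w = 0 := by
  obtain ⟨U, Φ, hU, hzU, hΦ, hs, hMU⟩ := hM
  let V₀ : Set (Coord n × Coord n) := Prod.fst ⁻¹' φ.target
  have hV₀ : IsOpen V₀ := φ.open_target.preimage continuous_fst
  have hp : ContMDiffOn 𝓘(ℝ, Coord n × Coord n) (modelTQ n) ∞ (tqParam φ) V₀ := fun w hw =>
    (contMDiffAt_tqParam hφ hw).contMDiffWithinAt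
  refine ⟨V₀ ∩ tqParam φ ⁻¹' U, Φ ∘ tqParam φ,
    hp.continuousOn.isOpen_inter_preimage hV₀ hU, ⟨hz, hzU⟩, fun w hw => hw.1, ?_, ?_, ?_⟩
  · rw [← contMDiffOn_iff_contDiffOn]
    exact hΦ.comp (hp.mono inter_subset_left) fun w hw => hw.2
  · have h1 := hasModelDeriv_iff_hasFDerivAt.1
      ((hΦ.contMDiffAt (hU.mem_nhds hzU)).hasModelDeriv.comp (hasModelDeriv_tqParam hφ hz) rfl)
    have hs' : Function.Surjective (modelDeriv (modelTQ n) 𝓘(ℝ, Fin c → ℝ) Φ (tqParam φ z)) := hs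
    rw [h1.fderiv]
    exact hs'.comp (tqParamD_bijective hφ hz).2
  · intro w hw
    have h1 := Set.ext_iff.1 hMU (tqParam φ w)
    exact ⟨fun h => (h1.1 ⟨h, hw.2⟩).2, fun h => (h1.2 ⟨hw.2, h⟩).1⟩

/-- `pr₂` is a submersion, so equations cutting out `M` pull back to regular equations cutting out
`W₀`. -/
theorem mem_tangentTo_phaseSpace_iff {p : Whitney n Q}
    (hM : IsLocalLevelSet (modelTQ n) M c (pr₂ p)) (hp : pr₂ p ∈ M)
    (a : Coord n × ((Coord n →L[ℝ] ℝ) × Coord n)) :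
    a ∈ tangentTo (modelWhitney n) (phaseSpace M) p ↔
      modelDeriv (modelWhitney n) (modelTQ n) pr₂ p a ∈ tangentTo (modelTQ n) M (pr₂ p) := by
  obtain ⟨U, Φ, hU, hzU, hΦ, hs, hMU⟩ := hM
  have hpr := contMDiff_pr₂ (n := n) (Q := Q)
  have hd := ((hΦ.contMDiffAt (hU.mem_nhds hzU)).hasModelDeriv.comp
    (hpr p).hasModelDeriv rfl).modelDeriv_eq
  have hsurj : Function.Surjective (modelDeriv (modelWhitney n) (modelTQ n) pr₂ p) := by
    obtain ⟨φ, hφ, z, hz, rfl⟩ := exists_chart_param p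
    intro b
    obtain ⟨b, rfl⟩ := (tqParamD_bijective hφ (z := (z.1, z.2.2)) hz).2 b
    exact ⟨_, modelDeriv_pr₂_whitneyParamD hφ hz (b.1, (0, b.2))⟩
  have hs' : Function.Surjective (modelDeriv (modelTQ n) 𝓘(ℝ, Fin c → ℝ) Φ (pr₂ p)) := hs
  rw [mem_tangentTo_of_levelSet hU hzU hp hΦ hs hMU]
  refine (mem_tangentTo_of_levelSet (S := phaseSpace M) (Φ := Φ ∘ pr₂)
    (hU.preimage hpr.continuous) hzU hp (hΦ.comp hpr.contMDiffOn fun _ h => h)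
    (by rw [hd]; exact hs'.comp hsurj) (Set.ext fun q => Set.ext_iff.1 hMU (pr₂ q))).trans ?_
  rw [hd]
  rfl

theorem whitneyParamD_mem_tangentTo_iff (hφ : φ ∈ IsManifold.maximalAtlas (𝓡 n) ∞ Q)
    {z : Coord n × ((Coord n →L[ℝ] ℝ) × Coord n)} (hz : z.1 ∈ φ.target)
    (hM : IsLocalLevelSet (modelTQ n) M c (tqParam φ (z.1, z.2.2)))
    (hp : tqParam φ (z.1, z.2.2) ∈ M) (a : Coord n × ((Coord n →L[ℝ] ℝ) × Coord n)) :
    whitneyParamD φ z a ∈ tangentTo (modelWhitney n) (phaseSpace M) (whitneyParam φ z) ↔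
      tqParamD φ (z.1, z.2.2) (a.1, a.2.2) ∈
        tangentTo (modelTQ n) M (tqParam φ (z.1, z.2.2)) := by
  rw [mem_tangentTo_phaseSpace_iff hM hp, modelDeriv_pr₂_whitneyParamD hφ hz]
  rfl

theorem differential_hamiltonianBar (hφ : φ ∈ IsManifold.maximalAtlas (𝓡 n) ∞ Q)
    (hL : ContMDiff (modelTQ n) 𝓘(ℝ, ℝ) ∞ L)
    {z : Coord n × ((Coord n →L[ℝ] ℝ) × Coord n)} (hz : z.1 ∈ φ.target)
    (a : Coord n × ((Coord n →L[ℝ] ℝ) × Coord n)) :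
    differential (modelWhitney n) (hamiltonianBar L) (whitneyParam φ z) (whitneyParamD φ z a) =
      a.2.1 z.2.2 + z.2.1 a.2.2 +
        fderiv ℝ (coordMomentum L φ) (z.1, z.2.2) (a.1, a.2.2) z.2.2 -
        fderiv ℝ (coordLagrangian L φ) (z.1, z.2.2) (a.1, 0) := by
  have h1 := hasModelDeriv_iff_hasFDerivAt.1
    ((contMDiff_hamiltonianBar hL (whitneyParam φ z)).hasModelDeriv.comp
      (hasModelDeriv_whitneyParam hφ hz) rfl)
  have hm : HasFDerivAt (coordMomentum L φ) (fderiv ℝ (coordMomentum L φ) (z.1, z.2.2))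
      (baseVelocity n z) :=
    ((contDiffAt_coordMomentum hφ hL (z := (z.1, z.2.2)) hz).differentiableAt
      (by simp)).hasFDerivAt
  have hl : HasFDerivAt (coordLagrangian L φ) (fderiv ℝ (coordLagrangian L φ) (z.1, z.2.2))
      (baseVelocity n z) :=
    ((contDiffAt_coordLagrangian hφ hL (z := (z.1, z.2.2)) hz).differentiableAt
      (by simp)).hasFDerivAt
  have hv := ((ContinuousLinearMap.snd ℝ (Coord n →L[ℝ] ℝ) (Coord n)).comp
    (ContinuousLinearMap.snd ℝ (Coord n) ((Coord n →L[ℝ] ℝ) × Coord n))).hasFDerivAt (x := z)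
  have hα := ((ContinuousLinearMap.fst ℝ (Coord n →L[ℝ] ℝ) (Coord n)).comp
    (ContinuousLinearMap.snd ℝ (Coord n) ((Coord n →L[ℝ] ℝ) × Coord n))).hasFDerivAt (x := z)
  have hb := (baseVelocity n).hasFDerivAt (x := z)
  have h2 := (hα.clm_apply hv).add (((hm.comp z hb).clm_apply hv).sub (hl.comp z hb))
  have h3 := h1.unique (h2.congr_of_eventuallyEq
    ((continuousAt_fst.eventually_mem (φ.open_target.mem_nhds hz)).mono fun w hw =>
      hamiltonianBar_whitneyParam hφ hL hw))
  refine (DFunLike.congr_fun h3 a).trans ?_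
  -- The fibre part of `dL` is the momentum, which cancels the same term in the derivative of `p_L ·
  -- q̇`; only `∂L/∂q` survives.
  have h4 : fderiv ℝ (coordLagrangian L φ) (z.1, z.2.2) (a.1, a.2.2) =
      fderiv ℝ (coordLagrangian L φ) (z.1, z.2.2) (a.1, 0) + coordMomentum L φ (z.1, z.2.2) a.2.2 := by
    rw [coordMomentum, ContinuousLinearMap.comp_apply, ← map_add]
    simp
  simp only [add_apply, sub_apply, ContinuousLinearMap.comp_apply, ContinuousLinearMap.flip_apply,
    ContinuousLinearMap.coe_fst', ContinuousLinearMap.coe_snd', baseVelocity,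
    ContinuousLinearMap.prod_apply, Function.comp_apply, h4]
  ring

/-- The kernel of the restricted form is computed exactly: it consists of the vectors `(0, -dp_L(0,
y), y)` with `T(0, y) = 0`, on which `dH̄` is `p(y)`. The hypothesis `hTs`, that tangent vectors of
`M` reach every base direction, bounds the kernel from above. -/
theorem mem_seqP_one_iff (hφ : φ ∈ IsManifold.maximalAtlas (𝓡 n) ∞ Q)
    (hL : ContMDiff (modelTQ n) 𝓘(ℝ, ℝ) ∞ L)
    {z : Coord n × ((Coord n →L[ℝ] ℝ) × Coord n)} (hz : z.1 ∈ φ.target)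
    (hM : IsLocalLevelSet (modelTQ n) M c (tqParam φ (z.1, z.2.2)))
    (hp : tqParam φ (z.1, z.2.2) ∈ M) {T : Coord n × Coord n →L[ℝ] (Fin c → ℝ)}
    (hT : ∀ a, tqParamD φ (z.1, z.2.2) a ∈ tangentTo (modelTQ n) M (tqParam φ (z.1, z.2.2)) ↔
      T a = 0) (hTs : ∀ x, ∃ y, T (x, y) = 0) :
    whitneyParam φ z ∈ seqP L M 1 ↔ ∀ y, T (0, y) = 0 → z.2.1 y = 0 := by
  have hW : ∀ a, whitneyParamD φ z a ∈
      tangentTo (modelWhitney n) (phaseSpace M) (whitneyParam φ z) ↔ T (a.1, a.2.2) = 0 := fun a =>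
    (whitneyParamD_mem_tangentTo_iff hφ hz hM hp a).trans (hT _)
  have hΩ := formΩL_whitneyParamD hφ hL hz
  have hH := differential_hamiltonianBar hφ hL hz
  constructor
  · rintro ⟨-, h⟩ y hy
    -- The momentum component is chosen to cancel the `ω_L` contribution of the vertical vector `y`.
    have h1 := h (whitneyParamD φ z
      (0, (-fderiv ℝ (coordMomentum L φ) (z.1, z.2.2) (0, y), y))) ((hW _).2 hy) ?_
    · have h2 := (hH _).symm.trans h1
      have h0 : fderiv ℝ (coordLagrangian L φ) (z.1, z.2.2) ((0 : Coord n), (0 : Coord n)) = 0 :=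
        map_zero _
      simpa [h0] using h2
    · intro u _
      obtain ⟨u, rfl⟩ := (whitneyParamD_bijective hφ hz).2 u
      refine (hΩ u _).trans ?_
      simp
  · intro h
    refine ⟨hp, fun b hb hu => ?_⟩
    obtain ⟨b, rfl⟩ := (whitneyParamD_bijective hφ hz).2 b
    have hΩ' : ∀ u : Coord n × ((Coord n →L[ℝ] ℝ) × Coord n), T (u.1, u.2.2) = 0 →
        b.2.1 u.1 - u.2.1 b.1 + (fderiv ℝ (coordMomentum L φ) (z.1, z.2.2) (b.1, b.2.2) u.1
          - fderiv ℝ (coordMomentum L φ) (z.1, z.2.2) (u.1, u.2.2) b.1) = 0 := fun u hu' =>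
      (hΩ u b).symm.trans (hu _ ((hW u).2 hu'))
    -- Testing against pure momentum directions, always tangent to `W₀`, kills the base component.
    have hb1 : b.1 = 0 := by
      have h1 : ∀ α : Coord n →L[ℝ] ℝ, α b.1 = 0 := fun α => by
        have := hΩ' (0, (α, 0)) (map_zero T)
        have h0 : fderiv ℝ (coordMomentum L φ) (z.1, z.2.2) ((0 : Coord n), (0 : Coord n)) = 0 :=
          map_zero _
        simpa [h0] using this
      exact SeparatingDual.eq_zero_of_forall_dual_eq_zero (R := ℝ) h1
    have hb3 : T (0, b.2.2) = 0 := by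
      have := (hW b).1 hb
      rwa [hb1] at this
    -- Testing against a lift `(x, 0, y)` of each base direction `x` determines the momentum
    -- component.
    have hb2 : b.2.1 = -fderiv ℝ (coordMomentum L φ) (z.1, z.2.2) (0, b.2.2) := by
      refine ContinuousLinearMap.ext fun x => ?_
      obtain ⟨y, hy⟩ := hTs x
      have := hΩ' (x, (0, y)) hy
      rw [hb1] at this
      simp only [map_zero, sub_zero] at this
      rw [neg_apply]
      linarith
    refine (hH b).trans ?_
    rw [hb2, hb1, h _ hb3]
    have h0 : fderiv ℝ (coordLagrangian L φ) (z.1, z.2.2) ((0 : Coord n), (0 : Coord n)) = 0 :=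
      map_zero _
    simp [h0]

/-- Rank-nullity: this is how the dimension count in `Admissible` becomes injectivity of `S^*` on
conormals. -/
theorem eq_zero_of_finrank_map_eq {V W : Type*} [AddCommGroup V] [Module ℝ V]
    [FiniteDimensional ℝ V] [AddCommGroup W] [Module ℝ W] (S : V →ₗ[ℝ] W) (C : Submodule ℝ V)
    (h : Module.finrank ℝ C = Module.finrank ℝ (C.map S)) {β : V} (hβ : β ∈ C) (hS : S β = 0) :
    β = 0 := by
  have hr : LinearMap.range (S.domRestrict C) = C.map S := LinearMap.range_domRestrict _ _
  have hk := (S.domRestrict C).finrank_range_add_finrank_ker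
  rw [hr, ← h, Nat.add_eq_left, Submodule.finrank_eq_zero] at hk
  have h1 : (⟨β, hβ⟩ : C) ∈ LinearMap.ker (S.domRestrict C) := hS
  rw [hk] at h1
  exact congrArg Subtype.val ((Submodule.mem_bot ℝ).1 h1)

/-- Otherwise some `l ≠ 0` kills the image of `T(0, ·)`. The covector `l ∘ T` is conormal and `S^*`
sends it to `a ↦ l(T(0, a₁)) = 0`; admissibility makes it zero, and `l = 0` because `T` is onto. -/
theorem tangentTo_submersive_of_admissible (hφ : φ ∈ IsManifold.maximalAtlas (𝓡 n) ∞ Q)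
    {z : Coord n × Coord n} (hz : z.1 ∈ φ.target)
    (hadm : Module.finrank ℝ (conormal (modelTQ n) M (tqParam φ z)) =
      Module.finrank ℝ ((conormal (modelTQ n) M (tqParam φ z)).map
        (verticalEndoDual (tqParam φ z))))
    {T : Coord n × Coord n →L[ℝ] (Fin c → ℝ)} (hTs : Function.Surjective T)
    (hT : ∀ a, tqParamD φ z a ∈ tangentTo (modelTQ n) M (tqParam φ z) ↔ T a = 0) :
    Function.Surjective (T.comp (ContinuousLinearMap.inr ℝ (Coord n) (Coord n))) := by
  by_contra hB
  set B := T.comp (ContinuousLinearMap.inr ℝ (Coord n) (Coord n)) with hBdef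
  have hlt : LinearMap.range B.toLinearMap < ⊤ :=
    lt_top_iff_ne_top.2 fun h => hB (LinearMap.range_eq_top.1 h)
  obtain ⟨l, hl0, hl⟩ := Submodule.exists_le_ker_of_lt_top _ hlt
  have hlB : ∀ y, l (T (0, y)) = 0 := fun y => hl ⟨y, rfl⟩
  let β₀ : Coord n × Coord n →L[ℝ] ℝ := ((LinearMap.toContinuousLinearMap l).comp T).comp
    (tqCoordD φ (tqParam φ z))
  have hβ₀ : ∀ a, β₀ (tqParamD φ z a) = l (T a) := fun a => by
    change l (T (tqCoordD φ (tqParam φ z) (tqParamD φ z a))) = l (T a)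
    rw [tqCoordD_tqParamD hφ hz]
  let β : TangentSpace (modelTQ n) (tqParam φ z) →L[ℝ] ℝ := β₀
  have hβ : β ∈ conormal (modelTQ n) M (tqParam φ z) := by
    intro u hu
    obtain ⟨a, rfl⟩ := (tqParamD_bijective hφ hz).2 u
    refine (hβ₀ a).trans ?_
    rw [(hT a).1 hu, map_zero]
  have hSβ : verticalEndoDual (tqParam φ z) β = 0 := by
    refine ContinuousLinearMap.ext fun u => ?_
    obtain ⟨a, rfl⟩ := (tqParamD_bijective hφ hz).2 u
    refine (congrArg β₀ (verticalEndo_tqParamD hφ hz a)).trans ?_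
    exact (hβ₀ _).trans (hlB _)
  have : FiniteDimensional ℝ (Coord n × Coord n →L[ℝ] ℝ) :=
    Module.Finite.equiv (LinearMap.toContinuousLinearMap : (Coord n × Coord n →ₗ[ℝ] ℝ) ≃ₗ[ℝ] _)
  let S : (Coord n × Coord n →L[ℝ] ℝ) →ₗ[ℝ] (Coord n × Coord n →L[ℝ] ℝ) :=
    verticalEndoDual (tqParam φ z)
  let C : Submodule ℝ (Coord n × Coord n →L[ℝ] ℝ) := conormal (modelTQ n) M (tqParam φ z)
  have hβ1 : β₀ = 0 := eq_zero_of_finrank_map_eq S C hadm hβ hSβ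
  refine hl0 (LinearMap.ext fun y => ?_)
  obtain ⟨a, rfl⟩ := hTs y
  rw [← hβ₀, hβ1]
  rfl

theorem exists_eq_comp_of_ker_le {E F : Type*} [AddCommGroup E] [Module ℝ E] [AddCommGroup F]
    [Module ℝ F] (B : E →ₗ[ℝ] F) (α : E →ₗ[ℝ] ℝ) (h : ∀ y, B y = 0 → α y = 0) :
    ∃ l : F →ₗ[ℝ] ℝ, α = l.comp B := by
  have h1 : α ∈ (LinearMap.ker B).dualAnnihilator :=
    (Submodule.mem_dualAnnihilator _).2 fun y hy => h y hy
  rw [← LinearMap.range_dualMap_eq_dualAnnihilator_ker] at h1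
  obtain ⟨l, hl⟩ := h1
  exact ⟨l, hl.symm⟩

/-- Since `S^*β` evaluates `β` on vertical vectors, `τ^*α = S^*β` says that `p` is the vertical part
of a conormal. If `p` kills `ker T(0, ·)`, it factors as `l ∘ T(0, ·)` and `β = l ∘ T` works. -/
theorem mem_reactionBundle_iff (hφ : φ ∈ IsManifold.maximalAtlas (𝓡 n) ∞ Q)
    {z : Coord n × ((Coord n →L[ℝ] ℝ) × Coord n)} (hz : z.1 ∈ φ.target)
    (hp : tqParam φ (z.1, z.2.2) ∈ M) {T : Coord n × Coord n →L[ℝ] (Fin c → ℝ)}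
    (hT : ∀ a, tqParamD φ (z.1, z.2.2) a ∈ tangentTo (modelTQ n) M (tqParam φ (z.1, z.2.2)) ↔
      T a = 0) :
    whitneyParam φ z ∈ reactionBundle M ↔ ∀ y, T (0, y) = 0 → z.2.1 y = 0 := by
  set v : TQ n Q := tqParam φ (z.1, z.2.2) with hv
  have hz' : (z.1, z.2.2).1 ∈ φ.target := hz
  have hpull : ∀ a, pullτ v (z.2.1.comp (chartD φ (φ.symm z.1))) (tqParamD φ (z.1, z.2.2) a) =
      z.2.1 a.1 := fun a =>
    (congrArg (fun u => z.2.1 (chartD φ (φ.symm z.1) u)) (dτ_tqParamD hφ hz' a)).trans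
      (congrArg z.2.1 (chartD_chartDSymm hφ hz a.1))
  have hS := verticalEndo_tqParamD hφ hz'
  constructor
  · rintro ⟨-, β, hβ, hβα⟩ y hy
    have h1 := hβ (tqParamD φ (z.1, z.2.2) (0, y)) ((hT _).2 hy)
    have h2 := DFunLike.congr_fun hβα (tqParamD φ (z.1, z.2.2) (y, 0))
    have h3 := (congrArg β (hS (y, 0))).symm.trans h2
    exact ((h1.symm.trans h3).trans (hpull (y, 0))).symm
  · intro h
    obtain ⟨l, hl⟩ := exists_eq_comp_of_ker_le
      (T.comp (ContinuousLinearMap.inr ℝ (Coord n) (Coord n))).toLinearMap z.2.1.toLinearMap h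
    let β : Coord n × Coord n →L[ℝ] ℝ := ((LinearMap.toContinuousLinearMap l).comp T).comp
      (tqCoordD φ v)
    have hβ : ∀ a, β (tqParamD φ (z.1, z.2.2) a) = l (T a) := fun a => by
      change l (T (tqCoordD φ v (tqParamD φ _ a))) = l (T a)
      rw [tqCoordD_tqParamD hφ hz']
    refine ⟨hp, β, ?_, ?_⟩
    · intro u hu
      obtain ⟨a, rfl⟩ := (tqParamD_bijective hφ hz').2 u
      refine (hβ a).trans ?_
      rw [(hT a).1 hu, map_zero]
    · refine ContinuousLinearMap.ext fun u => ?_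
      obtain ⟨a, rfl⟩ := (tqParamD_bijective hφ hz').2 u
      refine ((congrArg β (hS a)).trans ((hβ _).trans ?_)).trans (hpull a).symm
      exact (DFunLike.congr_fun hl a.1).symm

theorem dτ_surjective (v : TQ n Q) : Function.Surjective (dτ v) := by
  obtain ⟨φ, hφ, z, hz, rfl⟩ := exists_tq_param v
  intro u
  refine ⟨tqParamD φ z (chartD φ (φ.symm z.1) u, 0), (dτ_tqParamD hφ hz _).trans ?_⟩
  have h := chartDSymm_chartD hφ (φ.map_target hz) u
  rwa [φ.right_inv hz] at h

theorem seqP_one_eq_reactionBundle (hL : ContMDiff (modelTQ n) 𝓘(ℝ, ℝ) ∞ L)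
    (hM : IsSubmanifoldOfCodim (modelTQ n) M c) (hadm : Admissible M) :
    seqP L M 1 = reactionBundle M := by
  ext p
  by_cases hp : pr₂ p ∈ M
  · obtain ⟨φ, hφ, z, hz, rfl⟩ := exists_chart_param p
    obtain ⟨V, g, hV, hzV, hVφ, hg, hs, hMg⟩ :=
      exists_coord_levelSet hφ (z := (z.1, z.2.2)) hz (hM _ hp)
    have hT := tqParamD_mem_tangentTo_iff hφ hV hzV hVφ hg hs hMg hp
    have hB := tangentTo_submersive_of_admissible hφ (z := (z.1, z.2.2)) hz (hadm _ hp) hs hT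
    rw [mem_reactionBundle_iff hφ hz hp hT]
    refine mem_seqP_one_iff hφ hL hz (hM _ hp) hp hT fun x => ?_
    -- Solving `T(0, y) = -T(x, 0)` completes the base direction `x` to a tangent vector `(x, y)` of
    -- `M`.
    obtain ⟨y, hy⟩ := hB (-fderiv ℝ g (z.1, z.2.2) (x, 0))
    refine ⟨y, ?_⟩
    have h1 : ((x, y) : Coord n × Coord n) = (x, 0) + (0, y) := by simp
    rw [h1, map_add]
    exact add_eq_zero_iff_eq_neg'.2 hy
  · exact ⟨fun h => absurd h.1 hp, fun h => absurd h.1 hp⟩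

theorem bijOn_pullτ (hP : seqP L M 1 = reactionBundle M) {v : TQ n Q} (hv : v ∈ M) :
    Set.BijOn (pullτ v) {α | (⟨v.1, (α, v.2)⟩ : Whitney n Q) ∈ seqP L M 1}
      (reactionForces M v) := by
  rw [hP]
  refine ⟨fun α hα => hα.2, fun α _ β _ h => ?_, fun β hβ => ?_⟩
  · refine ContinuousLinearMap.ext fun u => ?_
    obtain ⟨w, rfl⟩ := dτ_surjective v u
    exact DFunLike.congr_fun h w
  · obtain ⟨γ, hγ, rfl⟩ := hβ
    -- `S` is by definition the vertical lift after `dτ`, so `S^*γ` is the pullback of `γ` composed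
    -- with the vertical lift.
    exact ⟨γ.comp (verticalLift v), ⟨hv, γ, hγ, rfl⟩, rfl⟩

end Constraints

/-! ### Distributions and the mixed bundle -/

section LinearConstraints

/-- A vector outside `D` is detected by a functional vanishing on `D`, hence constant along any
curve in `D`; straight lines give the converse. -/
theorem mem_tangentTo_submodule_iff {E : Type*} [NormedAddCommGroup E] [NormedSpace ℝ E]
    [FiniteDimensional ℝ E] (D : Submodule ℝ E) {x : E} (hx : x ∈ D) (y : E) :
    y ∈ tangentTo 𝓘(ℝ, E) (D : Set E) x ↔ y ∈ D := by
  rw [mem_tangentTo_iff]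
  constructor
  · rintro ⟨γ, -, hD, rfl, hγ⟩
    by_contra hy
    obtain ⟨f, hfy, hf⟩ := Submodule.exists_le_ker_of_notMem hy
    have h1 := (LinearMap.toContinuousLinearMap f).hasFDerivAt.comp (0 : ℝ)
      (hasModelDeriv_iff_hasFDerivAt.1 hγ)
    have h2 : (LinearMap.toContinuousLinearMap f) ∘ γ = fun _ => 0 := funext fun t => hf (hD t)
    rw [h2] at h1
    have h3 := DFunLike.congr_fun (h1.unique (hasFDerivAt_const 0 0)) 1
    rw [ContinuousLinearMap.comp_apply, ContinuousLinearMap.toSpanSingleton_apply_one] at h3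
    exact hfy h3
  · intro hy
    refine ⟨fun t => x + t • y, ?_, fun t => D.add_mem hx (D.smul_mem t hy), by simp, ?_⟩
    · exact (contDiff_const.add (contDiff_id.smul contDiff_const)).contMDiff
    · exact hasModelDeriv_iff_hasFDerivAt.2
        ((ContinuousLinearMap.toSpanSingleton ℝ y).hasFDerivAt.const_add x)

variable {n : ℕ} {Q : Type*} [TopologicalSpace Q] [ChartedSpace (EuclideanSpace ℝ (Fin n)) Q]
  [IsManifold (𝓡 n) ∞ Q] {L : TQ n Q → ℝ} {c : ℕ}
  {φ : OpenPartialHomeomorph Q (Coord n)}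
  {D : ∀ x : Q, Submodule ℝ (TangentSpace (𝓡 n) x)}

/-- The tangent space of one fibre is computed twice: as the kernel of `g` restricted to the fibre,
regular by `hB`, and as the linear subspace itself. -/
theorem vertical_tangent_totalSet_iff
    {z : Coord n × Coord n} {V : Set (Coord n × Coord n)} (hV : IsOpen V) (hzV : z ∈ V)
    {g : Coord n × Coord n → (Fin c → ℝ)}
    (hg : ContDiffOn ℝ ∞ g V)
    (hB : Function.Surjective
      ((fderiv ℝ g z).comp (ContinuousLinearMap.inr ℝ (Coord n) (Coord n))))
    (hM : ∀ w ∈ V, tqParam φ w ∈ totalSet D ↔ g w = 0) (hzM : tqParam φ z ∈ totalSet D)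
    (y : Coord n) :
    fderiv ℝ g z (0, y) = 0 ↔ chartDSymm φ z.1 y ∈ D (φ.symm z.1) := by
  let D' : Submodule ℝ (Coord n) := D (φ.symm z.1)
  let Dx : Submodule ℝ (Coord n) := D'.comap (chartDSymm φ z.1).toLinearMap
  have hzD : z.2 ∈ Dx := hzM
  have hi : ContDiff ℝ ∞ (fun y' : Coord n => (z.1, y')) := contDiff_const.prodMk contDiff_id
  have hgd : HasFDerivAt g (fderiv ℝ g z) (z.1, z.2) :=
    ((hg.contDiffAt (hV.mem_nhds hzV)).differentiableAt (by simp)).hasFDerivAt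
  have hd : HasFDerivAt (fun y' : Coord n => g (z.1, y'))
      ((fderiv ℝ g z).comp (ContinuousLinearMap.inr ℝ (Coord n) (Coord n))) z.2 :=
    hgd.comp z.2 (hasFDerivAt_fibre z.1 z.2)
  have hd' := (hasModelDeriv_iff_hasFDerivAt.2 hd).modelDeriv_eq
  have h := mem_tangentTo_of_levelSet (I := 𝓘(ℝ, Coord n)) (S := (Dx : Set (Coord n)))
    (hV.preimage hi.continuous) hzV hzD
    (hg.comp hi.contDiffOn fun _ h => h).contMDiffOn
    (by change Function.Surjective (modelDeriv 𝓘(ℝ, Coord n) 𝓘(ℝ, Fin c → ℝ)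
          (fun y' : Coord n => g (z.1, y')) z.2)
        rw [hd']; exact hB)
    (by
      ext y'
      constructor
      · rintro ⟨h1, h2⟩
        exact ⟨h2, (hM (z.1, y') h2).1 h1⟩
      · rintro ⟨h2, h1⟩
        exact ⟨(hM (z.1, y') h2).2 h1, h2⟩) (v := y)
  rw [mem_tangentTo_submodule_iff Dx hzD] at h
  refine Iff.trans ?_ h.symm
  change _ ↔ modelDeriv 𝓘(ℝ, Coord n) 𝓘(ℝ, Fin c → ℝ) (fun y' : Coord n => g (z.1, y')) z.2 y = 0
  rw [hd']
  rfl

theorem seqP_one_eq_mixedBundle (hL : ContMDiff (modelTQ n) 𝓘(ℝ, ℝ) ∞ L)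
    (hM : IsSubmanifoldOfCodim (modelTQ n) (totalSet D) c) (hadm : Admissible (totalSet D)) :
    seqP L (totalSet D) 1 = mixedBundle D := by
  rw [seqP_one_eq_reactionBundle hL hM hadm]
  ext p
  by_cases hp : pr₂ p ∈ totalSet D
  · obtain ⟨φ, hφ, z, hz, rfl⟩ := exists_chart_param p
    obtain ⟨V, g, hV, hzV, hVφ, hg, hs, hMg⟩ :=
      exists_coord_levelSet hφ (z := (z.1, z.2.2)) hz (hM _ hp)
    have hT := tqParamD_mem_tangentTo_iff hφ hV hzV hVφ hg hs hMg hp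
    have hB := tangentTo_submersive_of_admissible hφ (z := (z.1, z.2.2)) hz (hadm _ hp) hs hT
    rw [mem_reactionBundle_iff hφ hz hp hT]
    constructor
    · intro h
      refine ⟨fun u hu => ?_, hp⟩
      have h1 : chartDSymm φ z.1 (chartD φ (φ.symm z.1) u) = u := by
        have h := chartDSymm_chartD hφ (φ.map_target hz) u
        rwa [φ.right_inv hz] at h
      refine h (chartD φ (φ.symm z.1) u) ((vertical_tangent_totalSet_iff hV hzV hg hB hMg hp _).2 ?_)
      rw [h1]
      exact hu
    · rintro ⟨h, -⟩ y hy
      have h1 := h _ ((vertical_tangent_totalSet_iff hV hzV hg hB hMg hp y).1 hy)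
      exact (congrArg z.2.1 (chartD_chartDSymm hφ hz y)).symm.trans h1
  · exact ⟨fun h => absurd h.1 hp, fun h => absurd h.2 hp⟩

end LinearConstraints

/-! ### Lagrange multipliers and the equations along a curve in coordinates -/

section Multipliers

variable {E : Type*} [NormedAddCommGroup E] [NormedSpace ℝ E] {m : ℕ}

theorem apply_eq_sum_mul_apply_single (l : (Fin m → ℝ) →ₗ[ℝ] ℝ) (r : Fin m → ℝ) :
    l r = ∑ α, r α * l (Pi.single α 1) := by
  rw [LinearMap.pi_apply_eq_sum_univ l r]
  refine Finset.sum_congr rfl fun α _ => ?_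
  rw [smul_eq_mul]
  congr 2
  funext j
  simp [Pi.single_apply, eq_comm]

/-- A functional killing the range of `y ↦ (f α y)` would be a linear relation among the `f α`. -/
theorem exists_forall_apply_eq_of_linearIndependent {f : Fin m → (E →L[ℝ] ℝ)}
    (hf : LinearIndependent ℝ f) (r : Fin m → ℝ) : ∃ y, ∀ α, f α y = r α := by
  let B : E →ₗ[ℝ] (Fin m → ℝ) := LinearMap.pi fun α => (f α).toLinearMap
  suffices h : LinearMap.range B = ⊤ by
    obtain ⟨y, hy⟩ := LinearMap.range_eq_top.1 h r
    exact ⟨y, fun α => congrFun hy α⟩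
  by_contra h
  obtain ⟨l, hl0, hl⟩ := Submodule.exists_le_ker_of_lt_top _ (lt_top_iff_ne_top.2 h)
  have hl1 := apply_eq_sum_mul_apply_single l
  have h1 : ∑ α, l (Pi.single α 1) • f α = 0 := by
    refine ContinuousLinearMap.ext fun y => ?_
    have h2 : l (B y) = 0 := hl ⟨y, rfl⟩
    rw [hl1] at h2
    simpa [B, mul_comm] using h2
  have h3 := Fintype.linearIndependent_iff.1 hf _ h1
  exact hl0 (LinearMap.ext fun r => by rw [hl1]; simp [h3])

theorem exists_eq_sum_smul_of_forall_ker {f : Fin m → (E →L[ℝ] ℝ)} {β : E →L[ℝ] ℝ}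
    (h : ∀ y, (∀ α, f α y = 0) → β y = 0) : ∃ μ : Fin m → ℝ, β = ∑ α, μ α • f α := by
  obtain ⟨l, hl⟩ := exists_eq_comp_of_ker_le (LinearMap.pi fun α => (f α).toLinearMap)
    β.toLinearMap fun y hy => h y fun α => congrFun hy α
  refine ⟨fun α => l (Pi.single α 1), ContinuousLinearMap.ext fun y => ?_⟩
  have h1 : β y = l fun α => f α y := DFunLike.congr_fun hl y
  rw [h1, apply_eq_sum_mul_apply_single l]
  simp [mul_comm]

/-- Coefficients exist pointwise by linear algebra. Evaluating on vectors dual to the `f α` at a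
fixed time gives a linear system that is invertible nearby, and its smooth solution is the chosen
coefficients. -/
theorem exists_contDiffOn_coefficients {J : Set ℝ} (hJ : IsOpen J) {f : Fin m → ℝ → (E →L[ℝ] ℝ)}
    {β : ℝ → (E →L[ℝ] ℝ)} (hf : ∀ α, ContDiffOn ℝ ∞ (f α) J) (hβ : ContDiffOn ℝ ∞ β J)
    (hli : ∀ t ∈ J, LinearIndependent ℝ fun α => f α t)
    (h : ∀ t ∈ J, ∀ y, (∀ α, f α t y = 0) → β t y = 0) :
    ∃ μ : Fin m → ℝ → ℝ, (∀ α, ContDiffOn ℝ ∞ (μ α) J) ∧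
      ∀ t ∈ J, β t = ∑ α, μ α t • f α t := by
  have hex : ∀ t, ∃ μ : Fin m → ℝ, t ∈ J → β t = ∑ α, μ α • f α t := fun t => by
    by_cases ht : t ∈ J
    · obtain ⟨μ, hμ⟩ := exists_eq_sum_smul_of_forall_ker (h t ht)
      exact ⟨μ, fun _ => hμ⟩
    · exact ⟨0, fun h' => absurd h' ht⟩
  choose μ hμ using hex
  refine ⟨fun α t => μ t α, ?_, hμ⟩
  suffices hs : ContDiffOn ℝ ∞ μ J from contDiffOn_pi.1 hs
  intro t₀ ht₀
  refine ContDiffAt.contDiffWithinAt ?_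
  -- These vectors are dual to the `f α` at `t₀`, so that the matrix `f α t (e γ)` is the identity
  -- at `t = t₀`.
  choose e he using fun γ : Fin m =>
    exists_forall_apply_eq_of_linearIndependent (hli t₀ ht₀) (fun α => if α = γ then 1 else 0)
  let C : Fin m → Fin m → ((Fin m → ℝ) →L[ℝ] (Fin m → ℝ)) := fun α γ =>
    (ContinuousLinearMap.proj α : (Fin m → ℝ) →L[ℝ] ℝ).smulRight (Pi.single γ 1)
  let A : ℝ → ((Fin m → ℝ) →L[ℝ] (Fin m → ℝ)) := fun t => ∑ α, ∑ γ, f α t (e γ) • C α γ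
  have hA : ∀ t r γ, A t r γ = ∑ α, r α * f α t (e γ) := fun t r γ => by
    simp [A, C, Finset.sum_apply, Pi.single_apply, mul_comm]
  have hfat : ∀ α, ContDiffAt ℝ ∞ (f α) t₀ := fun α => (hf α).contDiffAt (hJ.mem_nhds ht₀)
  have hβat : ContDiffAt ℝ ∞ β t₀ := hβ.contDiffAt (hJ.mem_nhds ht₀)
  have hAat : ContDiffAt ℝ ∞ A t₀ := ContDiffAt.sum fun α _ => ContDiffAt.sum fun γ _ =>
    ((hfat α).clm_apply contDiffAt_const).smul contDiffAt_const
  have hA0 : A t₀ = (ContinuousLinearEquiv.refl ℝ (Fin m → ℝ) :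
      (Fin m → ℝ) →L[ℝ] (Fin m → ℝ)) := by
    refine ContinuousLinearMap.ext fun r => funext fun γ => ?_
    rw [hA]
    simp [he]
  have hinv : ContDiffAt ℝ ∞ (fun t => (A t).inverse) t₀ := by
    have h1 := contDiffAt_map_inverse (𝕜 := ℝ) (n := ∞)
      (ContinuousLinearEquiv.refl ℝ (Fin m → ℝ))
    rw [← hA0] at h1
    exact h1.comp t₀ hAat
  have hev : ∀ᶠ t in 𝓝 t₀, A t ∈ range ((↑) : ((Fin m → ℝ) ≃L[ℝ] (Fin m → ℝ)) →
      ((Fin m → ℝ) →L[ℝ] (Fin m → ℝ))) := by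
    refine hAat.continuousAt.eventually_mem ?_
    rw [hA0]
    exact ContinuousLinearEquiv.nhds _
  have hb : ContDiffAt ℝ ∞ (fun t => (fun γ => β t (e γ) : Fin m → ℝ)) t₀ :=
    contDiffAt_pi.2 fun γ => hβat.clm_apply contDiffAt_const
  refine (hinv.clm_apply hb).congr_of_eventuallyEq ?_
  filter_upwards [hev, hJ.mem_nhds ht₀] with t ⟨A', hA'⟩ ht
  have h1 : (fun γ => β t (e γ)) = A' (μ t) := by
    funext γ
    have h2 : A' (μ t) = A t (μ t) := DFunLike.congr_fun hA' (μ t)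
    rw [h2, hA, hμ t ht]
    simp
  rw [h1, ← hA', ContinuousLinearMap.inverse_equiv]
  simp

/-- Here `P` stands for the derivative of the momentum and `ℓ` for `∂L/∂q`; only linearity of `P t`
matters. Once `y = ẋ`, the terms `P(a, c)` on both sides cancel and the equation reads `P(ẋ, ẏ)a - ℓ
a = -ṗ a - p c`. Inserting `p = -μ_α η^α` and the tangency of `(a, c)` turns the right side into the
`μ̇ η + μ i_ẋ dη` of the multiplier equation. -/
theorem coord_equations_iff {J : Set ℝ} (hJ : IsOpen J) {W : Set E} (hW : IsOpen W)
    {η : Fin m → E → (E →L[ℝ] ℝ)} (hη : ∀ α, ContDiffOn ℝ ∞ (η α) W)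
    (hli : ∀ x ∈ W, LinearIndependent ℝ fun α => η α x)
    {x y : ℝ → E} {p : ℝ → (E →L[ℝ] ℝ)} (hx : ContDiffOn ℝ ∞ x J) (hy : ContDiffOn ℝ ∞ y J)
    (hp : ContDiffOn ℝ ∞ p J) (hxW : ∀ t ∈ J, x t ∈ W)
    (P : ℝ → (E × E →L[ℝ] (E →L[ℝ] ℝ))) (ℓ : ℝ → (E →L[ℝ] ℝ)) :
    (∀ t ∈ J, (∀ α, η α (x t) (y t) = 0) ∧
      (∀ α, fderiv ℝ (η α) (x t) (deriv x t) (y t) + η α (x t) (deriv y t) = 0) ∧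
      ∀ (a : E) (b : E →L[ℝ] ℝ) (c : E),
        (∀ α, fderiv ℝ (η α) (x t) a (y t) + η α (x t) c = 0) →
        b (deriv x t) - deriv p t a + (P t (a, c) (deriv x t) - P t (deriv x t, deriv y t) a) =
          b (y t) + p t c + P t (a, c) (y t) - ℓ t a) ↔
    ∃ μ : Fin m → ℝ → ℝ, (∀ α, ContDiffOn ℝ ∞ (μ α) J) ∧ ∀ t ∈ J, y t = deriv x t ∧
      p t = -∑ α, μ α t • η α (x t) ∧
      (∀ z, P t (deriv x t, deriv y t) z - ℓ t z = ∑ α, (deriv (μ α) t * η α (x t) z +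
        μ α t * (fderiv ℝ (η α) (x t) (deriv x t) z - fderiv ℝ (η α) (x t) z (deriv x t)))) ∧
      ∀ α, η α (x t) (deriv x t) = 0 := by
  have hηx : ∀ α, ContDiffOn ℝ ∞ (fun t => η α (x t)) J := fun α => (hη α).comp hx hxW
  have hdx : ∀ t ∈ J, HasDerivAt x (deriv x t) t := fun t ht =>
    ((hx.contDiffAt (hJ.mem_nhds ht)).differentiableAt (by simp)).hasDerivAt
  have hdy : ∀ t ∈ J, HasDerivAt y (deriv y t) t := fun t ht =>
    ((hy.contDiffAt (hJ.mem_nhds ht)).differentiableAt (by simp)).hasDerivAt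
  have hdη : ∀ t ∈ J, ∀ α, HasDerivAt (fun t => η α (x t)) (fderiv ℝ (η α) (x t) (deriv x t)) t :=
    fun t ht α => ((((hη α).contDiffAt (hW.mem_nhds (hxW t ht))).differentiableAt
      (by simp)).hasFDerivAt).comp_hasDerivAt t (hdx t ht)
  have hdp : ∀ μ : Fin m → ℝ → ℝ, (∀ α, ContDiffOn ℝ ∞ (μ α) J) →
      (∀ t ∈ J, p t = -∑ α, μ α t • η α (x t)) → ∀ t ∈ J, deriv p t =
        -∑ α, (μ α t • fderiv ℝ (η α) (x t) (deriv x t) + deriv (μ α) t • η α (x t)) := by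
    intro μ hμ hpμ t ht
    have h1 : HasDerivAt (fun t => -∑ α, μ α t • η α (x t)) _ t :=
      (HasDerivAt.fun_sum fun α _ => ((((hμ α).contDiffAt (hJ.mem_nhds ht)).differentiableAt
        (by simp)).hasDerivAt).smul (hdη t ht α)).neg
    refine (h1.congr_of_eventuallyEq ?_).deriv
    filter_upwards [hJ.mem_nhds ht] with s hs using hpμ s hs
  constructor
  · intro H
    have hxy : ∀ t ∈ J, y t = deriv x t := fun t ht => by
      have h1 : ∀ b : E →L[ℝ] ℝ, b (deriv x t - y t) = 0 := fun b => by
        have := (H t ht).2.2 0 b 0 (by simp)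
        have h0 : P t ((0 : E), (0 : E)) = 0 := map_zero _
        simp [h0] at this
        rw [map_sub, this, sub_self]
      exact (sub_eq_zero.1 (SeparatingDual.eq_zero_of_forall_dual_eq_zero (R := ℝ) h1)).symm
    -- Vertical test vectors `(0, 0, c)` show that `p` annihilates the common kernel of the `η α`.
    have hker : ∀ t ∈ J, ∀ c, (∀ α, η α (x t) c = 0) → (-p) t c = 0 := fun t ht c hc => by
      have := (H t ht).2.2 0 0 c (by simpa using hc)
      rw [hxy t ht] at this
      simp at this
      simp [this]
    obtain ⟨μ, hμ, hpμ⟩ := exists_contDiffOn_coefficients hJ hηx hp.neg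
      (fun t ht => hli _ (hxW t ht)) hker
    have hpμ' : ∀ t ∈ J, p t = -∑ α, μ α t • η α (x t) := fun t ht => by
      rw [← hpμ t ht]; simp
    refine ⟨μ, hμ, fun t ht => ⟨hxy t ht, hpμ' t ht, fun z => ?_, fun α => ?_⟩⟩
    -- This `c` completes the base direction `z` to a tangent vector of the constraint set.
    · obtain ⟨c, hc⟩ := exists_forall_apply_eq_of_linearIndependent (hli _ (hxW t ht))
        (fun α => -fderiv ℝ (η α) (x t) z (y t))
      have h1 := (H t ht).2.2 z 0 c (fun α => by rw [hc]; ring)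
      have h2 : P t (deriv x t, deriv y t) z - ℓ t z = -deriv p t z - p t c := by
        rw [hxy t ht] at h1
        simp only [zero_apply] at h1
        linarith
      rw [h2, hdp μ hμ hpμ' t ht, hpμ' t ht]
      simp only [neg_apply, sum_apply, add_apply, smul_apply, smul_eq_mul, hc, neg_neg,
        ← Finset.sum_add_distrib, sub_neg_eq_add, hxy t ht]
      exact Finset.sum_congr rfl fun α _ => by ring
    · rw [← hxy t ht]; exact (H t ht).1 α
  · rintro ⟨μ, hμ, H⟩ t ht
    have hpμ : ∀ t ∈ J, p t = -∑ α, μ α t • η α (x t) := fun t ht => (H t ht).2.1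
    obtain ⟨h1, h2, h3, h4⟩ := H t ht
    refine ⟨fun α => h1 ▸ h4 α, fun α => ?_, fun a b c hc => ?_⟩
    -- Tangency of the curve is the time derivative of the constraint, which holds throughout the
    -- open set `J`.
    · have h5 := (hdη t ht α).clm_apply (hdy t ht)
      have h6 : (fun s => η α (x s) (y s)) =ᶠ[𝓝 t] fun _ => 0 := by
        filter_upwards [hJ.mem_nhds ht] with s hs
        rw [(H s hs).1]
        exact (H s hs).2.2.2 α
      exact h5.unique ((hasDerivAt_const t (0 : ℝ)).congr_of_eventuallyEq h6)
    · have h5 := h3 a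
      have h6 : deriv p t a = -∑ α, (μ α t * fderiv ℝ (η α) (x t) (deriv x t) a +
          deriv (μ α) t * η α (x t) a) := by
        rw [hdp μ hμ hpμ t ht]
        simp
      have h7 : p t c = ∑ α, μ α t * fderiv ℝ (η α) (x t) a (deriv x t) := by
        rw [h2, neg_apply, sum_apply, ← Finset.sum_neg_distrib]
        refine Finset.sum_congr rfl fun α _ => ?_
        have := hc α
        rw [h1] at this
        rw [smul_apply, smul_eq_mul]
        linear_combination -(μ α t) * this
      have h8 : ∑ α, (deriv (μ α) t * η α (x t) a +
          μ α t * (fderiv ℝ (η α) (x t) (deriv x t) a - fderiv ℝ (η α) (x t) a (deriv x t))) =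
          -deriv p t a - p t c := by
        rw [h6, h7, neg_neg, ← Finset.sum_sub_distrib]
        exact Finset.sum_congr rfl fun α _ => by ring
      rw [h8] at h5
      rw [h1]
      linarith

end Multipliers

/-! ### The Vershik-Gershkovich equations -/

section VershikGershkovich

variable {n m k : ℕ} {Q : Type*} [TopologicalSpace Q] [ChartedSpace (EuclideanSpace ℝ (Fin n)) Q]
  [IsManifold (𝓡 n) ∞ Q] {L : TQ n Q → ℝ}
  {φ : OpenPartialHomeomorph Q (Coord n)}
  {D : ∀ x : Q, Submodule ℝ (TangentSpace (𝓡 n) x)}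
  {η : Fin m → Coord n → (Coord n →L[ℝ] ℝ)}

theorem tqParam_mem_totalSet_iff (hη : IsAnnihilatorBasis D φ η) {w : Coord n × Coord n}
    (hw : w.1 ∈ φ.target) : tqParam φ w ∈ totalSet D ↔ ∀ α, η α w.1 w.2 = 0 :=
  (hη.2 w.1 hw).2 w.2

/-- The functions `η^α(x)(y)` are defining equations of `D`, regular already in the fibre directions
because the `η^α` are independent. -/
theorem tqParamD_mem_tangentTo_totalSet_iff (hφ : φ ∈ IsManifold.maximalAtlas (𝓡 n) ∞ Q)
    (hη : IsAnnihilatorBasis D φ η) {z : Coord n × Coord n} (hz : z.1 ∈ φ.target)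
    (hzM : tqParam φ z ∈ totalSet D) (a : Coord n × Coord n) :
    tqParamD φ z a ∈ tangentTo (modelTQ n) (totalSet D) (tqParam φ z) ↔
      ∀ α, fderiv ℝ (η α) z.1 a.1 z.2 + η α z.1 a.2 = 0 := by
  let V : Set (Coord n × Coord n) := Prod.fst ⁻¹' φ.target
  have hV : IsOpen V := φ.open_target.preimage continuous_fst
  let g : Coord n × Coord n → (Fin m → ℝ) := fun w α => η α w.1 w.2
  have hg : ContDiffOn ℝ ∞ g V := contDiffOn_pi.2 fun α =>
    ((hη.1 α).comp contDiffOn_fst fun _ h => h).clm_apply contDiffOn_snd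
  have hd : ∀ a α, fderiv ℝ g z a α = fderiv ℝ (η α) z.1 a.1 z.2 + η α z.1 a.2 := by
    intro a α
    have h1 : ∀ α, HasFDerivAt (fun w : Coord n × Coord n => η α w.1 w.2) _ z := fun α =>
      (((((hη.1 α).contDiffAt (φ.open_target.mem_nhds hz)).differentiableAt
        (by simp)).hasFDerivAt).comp z hasFDerivAt_fst).clm_apply hasFDerivAt_snd
    rw [(hasFDerivAt_pi.2 h1).fderiv]
    simp [add_comm]
  rw [tqParamD_mem_tangentTo_iff hφ hV hz (fun _ h => h) hg ?_ ?_ hzM, funext_iff]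
  · exact forall_congr' fun α => by rw [hd]; rfl
  · intro r
    obtain ⟨y, hy⟩ := exists_forall_apply_eq_of_linearIndependent (hη.2 z.1 hz).1 r
    refine ⟨(0, y), funext fun α => ?_⟩
    rw [hd, hy]
    simp
  · intro w hw
    rw [tqParam_mem_totalSet_iff hη hw, funext_iff]
    rfl

theorem solvesHamiltonEq_whitneyParam_iff (hφ : φ ∈ IsManifold.maximalAtlas (𝓡 n) ∞ Q)
    (hL : ContMDiff (modelTQ n) 𝓘(ℝ, ℝ) ∞ L)
    (hM : IsSubmanifoldOfCodim (modelTQ n) (totalSet D) k)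
    (hη : IsAnnihilatorBasis D φ η) {z : Coord n × ((Coord n →L[ℝ] ℝ) × Coord n)}
    (hz : z.1 ∈ φ.target) (X : Coord n × ((Coord n →L[ℝ] ℝ) × Coord n)) :
    SolvesHamiltonEq (modelWhitney n) (phaseSpace (totalSet D)) (formΩL L) (hamiltonianBar L)
      (whitneyParam φ z) (whitneyParamD φ z X) ↔
    (∀ α, η α z.1 z.2.2 = 0) ∧
      (∀ α, fderiv ℝ (η α) z.1 X.1 z.2.2 + η α z.1 X.2.2 = 0) ∧
      ∀ (a : Coord n) (b : Coord n →L[ℝ] ℝ) (c : Coord n),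
        (∀ α, fderiv ℝ (η α) z.1 a z.2.2 + η α z.1 c = 0) →
        b X.1 - X.2.1 a + (fderiv ℝ (coordMomentum L φ) (z.1, z.2.2) (a, c) X.1
          - fderiv ℝ (coordMomentum L φ) (z.1, z.2.2) (X.1, X.2.2) a) =
          b z.2.2 + z.2.1 c + fderiv ℝ (coordMomentum L φ) (z.1, z.2.2) (a, c) z.2.2
            - (fderiv ℝ (coordLagrangian L φ) (z.1, z.2.2)).comp
              (ContinuousLinearMap.inl ℝ (Coord n) (Coord n)) a := by
  have hmem := tqParam_mem_totalSet_iff hη (w := (z.1, z.2.2)) hz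
  have hW : whitneyParam φ z ∈ phaseSpace (totalSet D) ↔ ∀ α, η α z.1 z.2.2 = 0 := hmem
  unfold SolvesHamiltonEq
  rw [hW]
  refine and_congr_right fun h0 => ?_
  have hzM := hmem.2 h0
  have hT : ∀ a, whitneyParamD φ z a ∈
      tangentTo (modelWhitney n) (phaseSpace (totalSet D)) (whitneyParam φ z) ↔
        ∀ α, fderiv ℝ (η α) z.1 a.1 z.2.2 + η α z.1 a.2.2 = 0 := fun a =>
    (whitneyParamD_mem_tangentTo_iff hφ hz (hM _ hzM) hzM a).trans
      (tqParamD_mem_tangentTo_totalSet_iff hφ hη (z := (z.1, z.2.2)) hz hzM _)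
  refine and_congr (hT X) ?_
  have hΩ := formΩL_whitneyParamD hφ hL hz X
  have hH := differential_hamiltonianBar hφ hL hz
  constructor
  · intro h a b c hc
    have h1 := h (whitneyParamD φ z (a, (b, c))) ((hT _).2 hc)
    exact (hΩ (a, (b, c))).symm.trans (h1.trans (hH (a, (b, c))))
  · intro h u hu
    obtain ⟨u, rfl⟩ := (whitneyParamD_bijective hφ hz).2 u
    exact (hΩ u).trans ((h u.1 u.2.1 u.2.2 ((hT u).1 hu)).trans (hH u).symm)

theorem solvesHamiltonEq_congr {S : Set (Whitney n Q)}
    {Ω : ∀ x : Whitney n Q, TangentSpace (modelWhitney n) x → TangentSpace (modelWhitney n) x → ℝ}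
    {h : Whitney n Q → ℝ} {p q : Whitney n Q} (hpq : p = q)
    {X Y : Coord n × ((Coord n →L[ℝ] ℝ) × Coord n)} (hXY : X = Y) :
    SolvesHamiltonEq (modelWhitney n) S Ω h p X ↔ SolvesHamiltonEq (modelWhitney n) S Ω h q Y := by
  subst hpq hXY; rfl

theorem fderiv_chartLagrangian_right (hφ : φ ∈ IsManifold.maximalAtlas (𝓡 n) ∞ Q)
    (hL : ContMDiff (modelTQ n) 𝓘(ℝ, ℝ) ∞ L) {x : Coord n} (hx : x ∈ φ.target) (y : Coord n) :
    fderiv ℝ (chartLagrangian L φ x) y = coordMomentum L φ (x, y) := by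
  have h : HasFDerivAt (coordLagrangian L φ) (fderiv ℝ (coordLagrangian L φ) (x, y)) (x, y) :=
    ((contDiffAt_coordLagrangian hφ hL (z := (x, y)) hx).differentiableAt (by simp)).hasFDerivAt
  exact HasFDerivAt.fderiv (f := chartLagrangian L φ x) (h.comp y (hasFDerivAt_fibre x y))

theorem deriv_chart_momentum (hφ : φ ∈ IsManifold.maximalAtlas (𝓡 n) ∞ Q)
    (hL : ContMDiff (modelTQ n) 𝓘(ℝ, ℝ) ∞ L) {J : Set ℝ} (hJ : IsOpen J) {x y : ℝ → Coord n}
    (hx : ContDiffOn ℝ ∞ x J) (hy : ContDiffOn ℝ ∞ y J) (hxφ : ∀ t ∈ J, x t ∈ φ.target)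
    (hxy : ∀ t ∈ J, y t = deriv x t) {t : ℝ} (ht : t ∈ J) (z : Coord n) :
    deriv (fun s => fderiv ℝ (chartLagrangian L φ (x s)) (deriv x s) z) t =
      fderiv ℝ (coordMomentum L φ) (x t, y t) (deriv x t, deriv y t) z := by
  have hdx := ((hx.contDiffAt (hJ.mem_nhds ht)).differentiableAt (by simp)).hasDerivAt
  have hdy := ((hy.contDiffAt (hJ.mem_nhds ht)).differentiableAt (by simp)).hasDerivAt
  have hm : HasFDerivAt (coordMomentum L φ) (fderiv ℝ (coordMomentum L φ) (x t, y t)) (x t, y t) :=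
    ((contDiffAt_coordMomentum hφ hL (z := (x t, y t)) (hxφ t ht)).differentiableAt
      (by simp)).hasFDerivAt
  have h0 : HasDerivAt (fun s => coordMomentum L φ (x s, y s))
      (fderiv ℝ (coordMomentum L φ) (x t, y t) (deriv x t, deriv y t)) t := by
    have h := HasFDerivAt.comp_hasDerivAt (l := coordMomentum L φ) t hm (hdx.prodMk hdy)
    exact h
  have h1 : HasDerivAt (fun s => coordMomentum L φ (x s, y s) z)
      (fderiv ℝ (coordMomentum L φ) (x t, y t) (deriv x t, deriv y t) z) t :=
    ((ContinuousLinearMap.apply ℝ ℝ z).hasFDerivAt).comp_hasDerivAt t h0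
  refine (h1.congr_of_eventuallyEq ?_).deriv
  filter_upwards [hJ.mem_nhds ht] with s hs
  rw [← hxy s hs]
  exact congrArg (fun β : Coord n →L[ℝ] ℝ => β z)
    (fderiv_chartLagrangian_right hφ hL (hxφ s hs) (y s))

theorem fderiv_chartLagrangian_left (hφ : φ ∈ IsManifold.maximalAtlas (𝓡 n) ∞ Q)
    (hL : ContMDiff (modelTQ n) 𝓘(ℝ, ℝ) ∞ L) {x : Coord n} (hx : x ∈ φ.target) (y : Coord n) :
    fderiv ℝ (fun x' => chartLagrangian L φ x' y) x =
      (fderiv ℝ (coordLagrangian L φ) (x, y)).comp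
        (ContinuousLinearMap.inl ℝ (Coord n) (Coord n)) := by
  have h : HasFDerivAt (coordLagrangian L φ) (fderiv ℝ (coordLagrangian L φ) (x, y)) (x, y) :=
    ((contDiffAt_coordLagrangian hφ hL (z := (x, y)) hx).differentiableAt (by simp)).hasFDerivAt
  have h1 : HasFDerivAt (fun x' : Coord n => (x', y))
      (ContinuousLinearMap.inl ℝ (Coord n) (Coord n)) x := hasFDerivAt_prodMk_left x y
  have h2 := HasFDerivAt.comp (g := coordLagrangian L φ) x h h1
  exact HasFDerivAt.fderiv (f := fun x' => chartLagrangian L φ x' y) h2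

theorem pr₂_eq_iff (hφ : φ ∈ IsManifold.maximalAtlas (𝓡 n) ∞ Q) {p : Whitney n Q}
    (hp : p.1 ∈ φ.source) (y : Coord n) :
    pr₂ p = ⟨φ.symm (φ p.1), chartVector φ (φ p.1) y⟩ ↔ (whitneyCoord φ p).2.2 = y := by
  have h1 : tqParam φ (tqCoord φ (pr₂ p)) = pr₂ p := tqParam_tqCoord hφ hp
  constructor
  · intro h
    have h2 : tqCoord φ (tqParam φ (φ p.1, y)) = (φ p.1, y) :=
      tqCoord_tqParam hφ (z := (φ p.1, y)) (φ.map_source hp)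
    have h3 : tqCoord φ (pr₂ p) = (φ p.1, y) := (congrArg (tqCoord φ) h).trans h2
    exact congrArg Prod.snd h3
  · rintro rfl
    exact h1.symm

theorem pr₁_eq_iff (hφ : φ ∈ IsManifold.maximalAtlas (𝓡 n) ∞ Q) {p : Whitney n Q}
    (hp : p.1 ∈ φ.source) (β : Fin m → (Coord n →L[ℝ] ℝ)) (μ : Fin m → ℝ) :
    ((pr₁ p).2 = -∑ α, μ α • (β α).comp (mfderiv (𝓡 n) 𝓘(ℝ, Coord n) φ p.1)) ↔
      (whitneyCoord φ p).2.1 = -∑ α, μ α • β α := by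
  have h1 : -∑ α, μ α • (β α).comp (chartD φ p.1) = (-∑ α, μ α • β α).comp (chartD φ p.1) := by
    refine ContinuousLinearMap.ext fun y => ?_
    simp
  have h2 : covPart (pr₁ p) = -∑ α, μ α • (β α).comp (chartD φ p.1) ↔
      (covPart (pr₁ p)).comp (chartDSymm φ (φ p.1)) = -∑ α, μ α • β α := by
    rw [h1]
    constructor
    · intro h
      refine ContinuousLinearMap.ext fun y => ?_
      have h3 := chartD_chartDSymm hφ (φ.map_source hp) y
      rw [φ.left_inv hp] at h3
      rw [h, ContinuousLinearMap.comp_apply, ContinuousLinearMap.comp_apply, h3]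
    · intro h
      rw [← h]
      refine ContinuousLinearMap.ext fun y => ?_
      rw [ContinuousLinearMap.comp_apply, ContinuousLinearMap.comp_apply,
        chartDSymm_chartD hφ hp]
  exact h2

theorem solvesHamiltonEq_iff_solvesVershikGershkovich
    (hφ : φ ∈ IsManifold.maximalAtlas (𝓡 n) ∞ Q) (hL : ContMDiff (modelTQ n) 𝓘(ℝ, ℝ) ∞ L)
    (hM : IsSubmanifoldOfCodim (modelTQ n) (totalSet D) k) (hη : IsAnnihilatorBasis D φ η)
    {J : Set ℝ} {c : ℝ → Whitney n Q} (hJ : IsOpen J)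
    (hc : ContMDiffOn 𝓘(ℝ, ℝ) (modelWhitney n) ∞ c J) (hcφ : ∀ t ∈ J, (c t).1 ∈ φ.source) :
    (∀ t ∈ J, SolvesHamiltonEq (modelWhitney n) (phaseSpace (totalSet D)) (formΩL L)
        (hamiltonianBar L) (c t) (mfderiv 𝓘(ℝ, ℝ) (modelWhitney n) c t (1 : ℝ))) ↔
      SolvesVershikGershkovich L φ η J c := by
  let ζ : ℝ → Coord n × ((Coord n →L[ℝ] ℝ) × Coord n) := fun t => whitneyCoord φ (c t)
  let x : ℝ → Coord n := fun t => φ (c t).1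
  let p : ℝ → (Coord n →L[ℝ] ℝ) := fun t => (ζ t).2.1
  let y : ℝ → Coord n := fun t => (ζ t).2.2
  have hζ : ContDiffOn ℝ ∞ ζ J := fun t ht => by
    refine ContDiffAt.contDiffWithinAt (contMDiffAt_iff_contDiffAt.1 ?_)
    exact (contMDiffAt_whitneyCoord hφ (hcφ t ht)).comp t (hc.contMDiffAt (hJ.mem_nhds ht))
  have hx : ContDiffOn ℝ ∞ x J := hζ.fst
  have hp : ContDiffOn ℝ ∞ p J := hζ.snd.fst
  have hy : ContDiffOn ℝ ∞ y J := hζ.snd.snd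
  have hxφ : ∀ t ∈ J, x t ∈ φ.target := fun t ht => φ.map_source (hcφ t ht)
  have hcζ : ∀ t ∈ J, c t = whitneyParam φ (ζ t) := fun t ht =>
    (whitneyParam_whitneyCoord hφ (hcφ t ht)).symm
  have hder : ∀ t ∈ J, modelDeriv 𝓘(ℝ, ℝ) (modelWhitney n) c t (1 : ℝ) =
      whitneyParamD φ (ζ t) (deriv x t, (deriv p t, deriv y t)) := fun t ht => by
    have hd : ∀ {F : Type} [NormedAddCommGroup F] [NormedSpace ℝ F] {f : ℝ → F},
        ContDiffOn ℝ ∞ f J → HasDerivAt f (deriv f t) t := fun hf =>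
      ((hf.contDiffAt (hJ.mem_nhds ht)).differentiableAt (by simp)).hasDerivAt
    have h1 : HasDerivAt ζ (deriv x t, (deriv p t, deriv y t)) t :=
      (hd hx).prodMk ((hd hp).prodMk (hd hy))
    have h2 := (hasModelDeriv_whitneyParam hφ (z := ζ t) (hxφ t ht)).comp
      (hasModelDeriv_iff_hasFDerivAt.2 h1.hasFDerivAt) rfl
    have h3 := h2.congr (g := c) (by filter_upwards [hJ.mem_nhds ht] with s hs using hcζ s hs)
    rw [h3.modelDeriv_eq, ContinuousLinearMap.comp_apply]
    congr 1
    exact one_smul ℝ _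
  have hmain := coord_equations_iff hJ φ.open_target hη.1 (fun x hx => (hη.2 x hx).1) hx hy hp hxφ
    (fun t => fderiv ℝ (coordMomentum L φ) (x t, y t))
    (fun t => (fderiv ℝ (coordLagrangian L φ) (x t, y t)).comp
      (ContinuousLinearMap.inl ℝ (Coord n) (Coord n)))
  refine Iff.trans (forall₂_congr fun t ht => ?_) (hmain.trans ?_)
  · exact (solvesHamiltonEq_congr (hcζ t ht) (hder t ht)).trans
      (solvesHamiltonEq_whitneyParam_iff hφ hL hM hη (hxφ t ht) _)
  -- The identity `y = ẋ` is needed on all of `J`, not just at `t`, since the momentum along the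
  -- curve is differentiated in time.
  · have hEL : (∀ t ∈ J, y t = deriv x t) → ∀ t ∈ J, ∀ z : Coord n,
        deriv (fun s => fderiv ℝ (chartLagrangian L φ (x s)) (deriv x s) z) t
          - fderiv ℝ (fun x' => chartLagrangian L φ x' (deriv x t)) (x t) z =
        fderiv ℝ (coordMomentum L φ) (x t, y t) (deriv x t, deriv y t) z -
          (fderiv ℝ (coordLagrangian L φ) (x t, y t)).comp
            (ContinuousLinearMap.inl ℝ (Coord n) (Coord n)) z := fun hxy t ht z => by
      rw [deriv_chart_momentum hφ hL hJ hx hy hxφ hxy ht z, ← hxy t ht,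
        fderiv_chartLagrangian_left hφ hL (hxφ t ht)]
    refine exists_congr fun μ => and_congr_right fun _ => ?_
    constructor
    · intro H t ht
      obtain ⟨h1, h2, h3, h4⟩ := H t ht
      exact ⟨(pr₂_eq_iff hφ (hcφ t ht) _).2 h1, (pr₁_eq_iff hφ (hcφ t ht) _ _).2 h2,
        fun z => (hEL (fun t ht => (H t ht).1) t ht z).trans (h3 z), h4⟩
    · intro H t ht
      have hxy : ∀ t ∈ J, y t = deriv x t := fun t ht =>
        (pr₂_eq_iff hφ (hcφ t ht) _).1 (H t ht).1
      obtain ⟨-, h2, h3, h4⟩ := H t ht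
      exact ⟨hxy t ht, (pr₁_eq_iff hφ (hcφ t ht) _ _).1 h2,
        fun z => (hEL hxy t ht z).symm.trans (h3 z), h4⟩

end VershikGershkovich

end Vakonomic

end

theorem mainTheorem6 (n m : ℕ) (Q : Type*) [TopologicalSpace Q]
    [ChartedSpace (EuclideanSpace ℝ (Fin n)) Q] [IsManifold (𝓡 n) ∞ Q]
    (L : Vakonomic.TQ n Q → ℝ)
    (hL : ContMDiff (Vakonomic.modelTQ n) 𝓘(ℝ, ℝ) ∞ L)
    (M : Set (Vakonomic.TQ n Q))
    (hM : Vakonomic.IsSubmanifoldOfCodim (Vakonomic.modelTQ n) M m)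
    (hadm : Vakonomic.Admissible M) :
    -- `F` maps each `W_i` diffeomorphically onto `P_i`
    (∀ i, (∀ k ≤ i, Vakonomic.IsSubmanifold (Vakonomic.modelWhitney n) (Vakonomic.seqW L M k)) →
      Vakonomic.IsSubmanifold (Vakonomic.modelWhitney n) (Vakonomic.seqP L M i) ∧
      Vakonomic.RestrictsToDiffeo (Vakonomic.modelWhitney n) (Vakonomic.modelWhitney n)
        (Vakonomic.fibredMap L) (Vakonomic.seqW L M i) (Vakonomic.seqP L M i)) ∧
    -- linear constraints
    (∀ D : ∀ x : Q, Submodule ℝ (TangentSpace (𝓡 n) x), M = Vakonomic.totalSet D →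
      Vakonomic.seqP L M 1 = Vakonomic.mixedBundle D ∧
      ∀ φ ∈ IsManifold.maximalAtlas (𝓡 n) ∞ Q,
      ∀ η : Fin m → Vakonomic.Coord n → (Vakonomic.Coord n →L[ℝ] ℝ),
      Vakonomic.IsAnnihilatorBasis D φ η →
      ∀ (J : Set ℝ) (c : ℝ → Vakonomic.Whitney n Q), IsOpen J →
      ContMDiffOn 𝓘(ℝ, ℝ) (Vakonomic.modelWhitney n) ∞ c J → (∀ t ∈ J, (c t).1 ∈ φ.source) →
      ((∀ t ∈ J, Vakonomic.SolvesHamiltonEq (Vakonomic.modelWhitney n) (Vakonomic.phaseSpace M)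
          (Vakonomic.formΩL L) (Vakonomic.hamiltonianBar L) (c t)
          (mfderiv 𝓘(ℝ, ℝ) (Vakonomic.modelWhitney n) c t (1 : ℝ))) ↔
        Vakonomic.SolvesVershikGershkovich L φ η J c)) ∧
    -- arbitrary constraints
    (Vakonomic.seqP L M 1 = Vakonomic.reactionBundle M ∧
      ∀ v ∈ M, Set.BijOn (Vakonomic.pullτ v)
        {α | (⟨v.1, (α, v.2)⟩ : Vakonomic.Whitney n Q) ∈ Vakonomic.seqP L M 1}
        (Vakonomic.reactionForces M v)) := by
  refine ⟨fun i hi => Vakonomic.seqP_isSubmanifold_and_restrictsToDiffeo hL M i (hi i le_rfl),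
    fun D hD => ?_, ?_, fun v hv => ?_⟩
  · subst hD
    exact ⟨Vakonomic.seqP_one_eq_mixedBundle hL hM hadm, fun φ hφ η hη J c hJ hc hcφ =>
      Vakonomic.solvesHamiltonEq_iff_solvesVershikGershkovich hφ hL hM hη hJ hc hcφ⟩
  · exact Vakonomic.seqP_one_eq_reactionBundle hL hM hadm
  · exact Vakonomic.bijOn_pullτ (Vakonomic.seqP_one_eq_reactionBundle hL hM hadm) hv
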